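/- **Setting.** Let $R_0=\mathbb{Q}[\tau, z_k,\bar z_k\,(k>0)][q^{\pm1}, \partial^n v,\partial^n u\,(n\ge 0)]$ with the derivation $\partial$ given by $\partial(\partial^n v)=\partial^{n+1}v$, $\partial(\partial^n u)=\partial^{n+1}u$, $\partial q=q\,\partial u$ (so $u=\log q$), $\partial\tau=\partial z_k=\partial\bar z_k=0$, and let $R=R_0[[\varepsilon]]$. Put $\mathsf E^s=e^{s\varepsilon\partial}$, $\nabla=\varepsilon^{-1}(\mathsf E^{1/2}-\mathsf E^{-1/2})$, $\mathsf P=\nabla^{-1}\partial=\varepsilon\partial/(\mathsf E^{1/2}-\mathsf E^{-1/2})$. $R$ carries the $\varepsilon$-linear continuous involution $\bar\tau=-\tau$, $z_k\leftrightarrow\bar z_k$, $\bar u=u$, $\bar q=q$, $\bar v=v-\tau\mathsf P u$, so that $\tau\partial u=\nabla(v-\bar v)$. Difference operators $\sum_k p_k\Lambda^k$ ($p_k\in R$, with $p_k=0$ for $k\gg0$, or $p_k=0$ for $k\ll0$) are multiplied by $a\Lambda^i\cdot b\Lambda^j=(\mathsf E^{-j/2}a)(\mathsf E^{i/2}b)\Lambda^{i+j}$.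 Let $A_+$, $A_-$ be the parts of $A$ with $k\ge0$ and with $k<0$, and let $\overline{\sum p_k\Lambda^k}=\sum_{k>0}\bar p_k q^{[k]}\Lambda^{-k}+\bar p_0+\sum_{k>0}\bar p_{-k}q^{-[k]}\Lambda^k$, where $q^{[0]}=1$, $q^{[k+1]}=\mathsf E^{k/2}q\cdot\mathsf E^{-1/2}q^{[k]}$ and $q^{-[k]}=(q^{[k]})^{-1}$. The Lax operator of the equivariant Toda lattice is an operator $L=\Lambda+v+\sum_{k\ge2}a_k\Lambda^{1-k}$ over $R$ such that, with $K=L_++\bar L_-$, one has $\varepsilon^{-1}[K,L]=\tau\partial L$ and $\varepsilon^{-1}[K,\bar L]=\tau\partial\bar L$, and whose constants of motion are the parameters $z_k$: $p_{-1}(k)-q\,p_1(k)-\tau\mathsf P p_0(k)=z_k$ for $k>0$, where $L^k=\sum_jp_j(k)\Lambda^j$. For $n>0$ put $B_n=\varepsilon^{-1}(L^n)_+$ and $C_n=-\varepsilon^{-1}(\bar L^n)_-$. The flows $\partial_n$ and $\bar\partial_n$ are the derivations of $R$ that commute with $\partial$, are linear over $\mathbb{Q}[\tau][[\varepsilon]]$,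 are compatible with $u=\log q$, and satisfy $\partial_nL=[B_n,L]$, $\partial_n\bar L=[B_n,\bar L]$, respectively $\bar\partial_nL=[C_n,L]$, $\bar\partial_n\bar L=[C_n,\bar L]$. Functionals are classes $\int f\,dx\in R/\partial R$, with variational derivatives $\delta_vF$, $\delta_uF$ (where $q=e^u$). Put $h_n=\frac1{n+1}\int p_0(n+1)\,dx$ and, for $n>0$, $$H_n=h_n-\tau h_{n-1}+\sum_{k=1}^{n-1}z_kh_{n-k-1},$$ and let $\bar H_n$ be the conjugate of $H_n$. **Theorem.** The operator $\begin{bmatrix}\tau\partial&\nabla\\ \nabla&0\end{bmatrix}$ in the variables $(v,u)$ is Hamiltonian: the bracket $\{F,G\}=\int\bigl(\delta_vF\,(\tau\partial\,\delta_vG+\nabla\delta_uG)+\delta_uF\,\nabla\delta_vG\bigr)dx$ on $R/\partial R$, that is $\{v(x),v(y)\}=\tau\partial\delta(x-y)$, $\{v(x),u(y)\}=\nabla_x\delta(x-y)$, $\{u(x),u(y)\}=0$, is antisymmetric and satisfies the Jacobi identity. The Lax operator $L$ exists and is unique and, for every $n>0$, the flows $\partial_n$ and $\bar\partial_n$ exist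 and are unique. They are Hamiltonian with Hamiltonians $H_n$ and $\bar H_n$ respectively: $$\partial_n\begin{bmatrix}v\\u\end{bmatrix}=\begin{bmatrix}\tau\partial&\nabla\\ \nabla&0\end{bmatrix}\begin{bmatrix}\delta_vH_n\\ \delta_uH_n\end{bmatrix},\qquad \bar\partial_n\begin{bmatrix}v\\u\end{bmatrix}=\begin{bmatrix}\tau\partial&\nabla\\ \nabla&0\end{bmatrix}\begin{bmatrix}\delta_v\bar H_n\\ \delta_u\bar H_n\end{bmatrix};$$ the flows annihilate all $z_k,\bar z_k$, and $\int\partial_nf\,dx=\{\int f\,dx,H_n\}$, $\int\bar\partial_nf\,dx=\{\int f\,dx,\bar H_n\}$ for all $f\in R$. This deforms the first Hamiltonian structure of the Toda chain: under the specialization $\tau=z_k=\bar z_k=0$ both $L$ and $\bar L$ become the Toda chain Lax operator $\Lambda+v+q\Lambda^{-1}$, and the Poisson operator becomes the first Poisson operator $\begin{bmatrix}0&\nabla\\ \nabla&0\end{bmatrix}$ of the Toda chain, which is also Hamiltonian. -/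

import Mathlib

namespace EqToda

noncomputable section

open scoped BigOperators

/-! ### The differential algebra in the variables `v` and `u = log q`

Base constants: `τ` and the constants of motion `z_k`, `z̄_k` (`k > 0`).  Fields: `v`, `u` with
`q = exp u` invertible.  Everything is completed in the formal lattice spacing `ε`. -/

/-- Generators: `tau` is `τ`, `z k` is `z_{k+1}`, `zbar k` is `z̄_{k+1}`, and `v n`, `u n` are the
jet variables `∂ⁿv`, `∂ⁿu`. -/
inductive Gen : Type
  | tau : Gen
  | z : ℕ → Gen
  | zbar : ℕ → Gen
  | v : ℕ → Gen
  | u : ℕ → Gen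
  deriving DecidableEq

/-- Polynomials in the generators. -/
abbrev Jet : Type := MvPolynomial Gen ℚ

/-- Polynomials in the generators and `q, q⁻¹`; here `q ^ n` is `LaurentPolynomial.T n`. -/
abbrev DiffPoly : Type := LaurentPolynomial Jet

/-- Formal power series in `ε` (which is `PowerSeries.X`) with coefficients in `DiffPoly`. -/
abbrev DiffAlg : Type := PowerSeries DiffPoly

/-- The linear map underlying `extDer`. -/
def extLin (d : Derivation ℚ Jet Jet) (c : Jet) : DiffPoly →ₗ[ℚ] DiffPoly where
  toFun f := f.coeff.sum fun n a => AddMonoidAlgebra.single n (d a + n • (c * a))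
  map_add' f g := by
    rw [AddMonoidAlgebra.coeff_add, Finsupp.sum_add_index']
    · intro n; simp
    · intro n a b
      rw [← AddMonoidAlgebra.single_add]; congr 1
      rw [map_add, mul_add, smul_add]; abel
  map_smul' r f := by
    rw [AddMonoidAlgebra.coeff_smul, Finsupp.sum_smul_index' (by intro n; simp), Finsupp.smul_sum]
    refine Finsupp.sum_congr fun n _ => ?_
    simp only [RingHom.id_apply]
    rw [AddMonoidAlgebra.smul_single, smul_add, Derivation.map_smul, mul_smul_comm,
      smul_comm n r]

theorem extLin_single (d : Derivation ℚ Jet Jet) (c : Jet) (n : ℤ) (a : Jet) :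
    extLin d c (AddMonoidAlgebra.single n a) =
      AddMonoidAlgebra.single n (d a + n • (c * a)) := by
  change (AddMonoidAlgebra.single n a : DiffPoly).coeff.sum
    (fun n a => (AddMonoidAlgebra.single n (d a + n • (c * a)) : DiffPoly)) = _
  rw [AddMonoidAlgebra.coeff_single, Finsupp.sum_single_index]
  simp

/-- The extension of a derivation `d` of the polynomial algebra to a derivation with
`q ↦ c q`, that is, with `log q ↦ c`. -/
def extDer (d : Derivation ℚ Jet Jet) (c : Jet) : Derivation ℚ DiffPoly DiffPoly :=
  Derivation.mk' (extLin d c) (by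
    intro f g
    induction f using AddMonoidAlgebra.induction_linear with
    | zero => simp
    | add f₁ f₂ h₁ h₂ => rw [add_mul, map_add, h₁, h₂, map_add, add_smul, smul_add]; abel
    | single n a =>
      induction g using AddMonoidAlgebra.induction_linear with
      | zero => simp
      | add g₁ g₂ h₁ h₂ => rw [mul_add, map_add, h₁, h₂, map_add, add_smul, smul_add]; abel
      | single m b =>
        simp only [smul_eq_mul, extLin_single, AddMonoidAlgebra.single_mul_single]
        rw [add_comm m n, ← AddMonoidAlgebra.single_add]
        congr 1
        simp only [Derivation.leibniz, smul_eq_mul, zsmul_eq_mul]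
        push_cast
        ring)

/-- The total derivative on generators. -/
def dxGen : Gen → Jet
  | Gen.v n => MvPolynomial.X (Gen.v (n + 1))
  | Gen.u n => MvPolynomial.X (Gen.u (n + 1))
  | _ => 0

/-- The total derivative `∂` on differential polynomials; `∂q = q ∂u`. -/
def dx₀ : Derivation ℚ DiffPoly DiffPoly :=
  extDer (MvPolynomial.mkDerivation ℚ dxGen) (MvPolynomial.X (Gen.u 1))

/-- Partial derivative with respect to a generator, where `q = exp u`, i.e. `∂q/∂u = q`. -/
def pd (g : Gen) : Derivation ℚ DiffPoly DiffPoly :=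
  extDer (MvPolynomial.pderiv g) (if g = Gen.u 0 then 1 else 0)

/-- The extension of a linear map to power series in `ε`, coefficientwise. -/
def epsExt (d : DiffPoly →ₗ[ℚ] DiffPoly) : DiffAlg →ₗ[ℚ] DiffAlg where
  toFun f := PowerSeries.mk fun n => d (PowerSeries.coeff n f)
  map_add' f g := by ext1 n; simp
  map_smul' r f := by
    ext1 n
    have h : ∀ f : DiffAlg, PowerSeries.coeff n (r • f) = r • PowerSeries.coeff n f :=
      fun _ => rfl
    simp [h]

/-- The derivation `∂`. -/
def dx : DiffAlg →ₗ[ℚ] DiffAlg := epsExt dx₀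

/-- A generator as an element of the differential algebra. -/
def gen (g : Gen) : DiffAlg := PowerSeries.C (LaurentPolynomial.C (MvPolynomial.X g))

def tau : DiffAlg := gen Gen.tau

/-- The constant of motion `z_k`, for `k > 0`. -/
def zc (k : ℕ) : DiffAlg := gen (Gen.z (k - 1))

/-- The constant of motion `z̄_k`, for `k > 0`. -/
def zbarc (k : ℕ) : DiffAlg := gen (Gen.zbar (k - 1))

/-- `q ^ m`. -/
def qpow (m : ℤ) : DiffAlg := PowerSeries.C (LaurentPolynomial.T m)

/-- The jet variables of the two fields `0 ↦ v`, `1 ↦ u`. -/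
def jet : Fin 2 → ℕ → Gen := ![Gen.v, Gen.u]

/-- The fields `v` (index `0`) and `u` (index `1`). -/
def field (i : Fin 2) : DiffAlg := gen (jet i 0)

/-! ### Operators of infinite order in `ε∂` -/

/-- The operator `φ(ε∂) = ∑ φ_k ε^k ∂^k`. -/
def opSeries (φ : PowerSeries ℚ) : DiffAlg →ₗ[ℚ] DiffAlg where
  toFun f := PowerSeries.mk fun n => ∑ p ∈ Finset.HasAntidiagonal.antidiagonal n,
    PowerSeries.coeff p.1 φ • ((dx₀ : DiffPoly →ₗ[ℚ] DiffPoly) ^ p.1) (PowerSeries.coeff p.2 f)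
  map_add' f g := by ext1 n; simp [Finset.sum_add_distrib]
  map_smul' r f := by
    ext1 n
    have h : ∀ (n : ℕ) (f : DiffAlg), PowerSeries.coeff n (r • f) = r • PowerSeries.coeff n f :=
      fun _ _ => rfl
    simp only [h, PowerSeries.coeff_mk, map_smul, RingHom.id_apply, Finset.smul_sum]
    exact Finset.sum_congr rfl fun p _ => smul_comm _ _ _

/-- The shift `E^s = exp(s ε ∂)`. -/
def shift (s : ℚ) : DiffAlg →ₗ[ℚ] DiffAlg :=
  opSeries (PowerSeries.rescale s (PowerSeries.exp ℚ))

/-- The power series `(e^{t/2} - e^{-t/2}) / t`. -/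
def sinhc : PowerSeries ℚ :=
  PowerSeries.mk fun k => PowerSeries.coeff (k + 1)
    (PowerSeries.rescale (1 / 2) (PowerSeries.exp ℚ) -
      PowerSeries.rescale (-(1 / 2)) (PowerSeries.exp ℚ))

/-- `∇ = ε⁻¹ (E^{1/2} - E^{-1/2})`. -/
def nabla : DiffAlg →ₗ[ℚ] DiffAlg := opSeries sinhc ∘ₗ dx

/-- `P = ∇⁻¹ ∂ = ε∂ / (E^{1/2} - E^{-1/2})`. -/
def opP : DiffAlg →ₗ[ℚ] DiffAlg := opSeries sinhc⁻¹

/-! ### Substitutions and the involution -/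

/-- The substitution on differential polynomials which sends each generator `g` to `σ g` and
fixes `q`. -/
def subst₀ (σ : Gen → DiffAlg) : DiffPoly →+* DiffAlg :=
  LaurentPolynomial.eval₂ (MvPolynomial.aeval σ : Jet →ₐ[ℚ] DiffAlg).toRingHom
    ⟨qpow 1, qpow (-1),
      by rw [qpow, qpow, ← map_mul, ← LaurentPolynomial.T_add]; rfl,
      by rw [qpow, qpow, ← map_mul, ← LaurentPolynomial.T_add]; rfl⟩

/-- The `ε`-linear and `ε`-adically continuous extension of `subst₀ σ`. -/
def subst (σ : Gen → DiffAlg) (f : DiffAlg) : DiffAlg :=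
  PowerSeries.mk fun n => ∑ p ∈ Finset.HasAntidiagonal.antidiagonal n,
    PowerSeries.coeff p.1 (subst₀ σ (PowerSeries.coeff p.2 f))

/-- The involution on generators: `τ̄ = -τ`, `z_k ↔ z̄_k`, `ū = u`, `v̄ = v - τ P u`. -/
def barGen : Gen → DiffAlg
  | Gen.tau => -tau
  | Gen.z k => gen (Gen.zbar k)
  | Gen.zbar k => gen (Gen.z k)
  | Gen.v n => gen (Gen.v n) - tau * opP (gen (Gen.u n))
  | Gen.u n => gen (Gen.u n)

/-- The involution `p ↦ p̄`; it fixes `ε` and `q`. -/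
def bar : DiffAlg → DiffAlg := subst barGen

/-- The specialization at `τ = 0` and `z_k = z̄_k = 0`, on generators. -/
def spGen : Gen → DiffAlg
  | Gen.v n => gen (Gen.v n)
  | Gen.u n => gen (Gen.u n)
  | _ => 0

/-- The specialization at `τ = 0` and `z_k = z̄_k = 0`. -/
def specialize : DiffAlg → DiffAlg := subst spGen

/-! ### Difference operators -/

/-- The formal sum `∑ A k Λ^k`.  The operators that occur below have coefficients which vanish
either for all large `k` or for all small `k`. -/
abbrev DiffOp : Type := ℤ → DiffAlg

/-- The product
`(∑ a_i Λ^i)(∑ b_j Λ^j) = ∑_k (∑_{i+j=k} (E^{-j/2} a_i)(E^{i/2} b_j)) Λ^k`; the inner sums are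
finite for two operators that are bounded on the same side. -/
def opMul (A B : DiffOp) : DiffOp := fun k =>
  ∑ᶠ i : ℤ, shift (-((k - i : ℤ) : ℚ) / 2) (A i) * shift ((i : ℚ) / 2) (B (k - i))

def opOne : DiffOp := Pi.single 0 1

def opPow (A : DiffOp) : ℕ → DiffOp
  | 0 => opOne
  | n + 1 => opMul (opPow A n) A

def opComm (A B : DiffOp) : DiffOp := opMul A B - opMul B A

def opPlus (A : DiffOp) : DiffOp := fun k => if 0 ≤ k then A k else 0

def opMinus (A : DiffOp) : DiffOp := fun k => if k < 0 then A k else 0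

/-- For `m = 1` this is `q^{[k]}` and for `m = -1` its inverse `q^{-[k]}`, so that
`(qΛ⁻¹)^k = q^{[k]} Λ^{-k}`. -/
def qBracket (m : ℤ) : ℕ → DiffAlg
  | 0 => 1
  | k + 1 => shift ((k : ℚ) / 2) (qpow m) * shift (-(1 / 2)) (qBracket m k)

/-- The involution `∑ p_k Λ^k ↦ ∑_{k>0} p̄_k q^{[k]} Λ^{-k} + p̄_0 + ∑_{k>0} p̄_{-k} q^{-[k]} Λ^k`. -/
def opConj (A : DiffOp) : DiffOp := fun k =>
  bar (A (-k)) * if k ≤ 0 then qBracket 1 (-k).toNat else qBracket (-1) k.toNat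

/-! ### The equivariant Toda lattice -/

/-- The operator `K = L_+ + L̄_-`. -/
def opK (L : DiffOp) : DiffOp := opPlus L + opMinus (opConj L)

/-- `L = Λ + v + ∑_{k>1} a_k Λ^{1-k}` is the Lax operator of the equivariant Toda lattice:
`L` and `L̄` satisfy the constraints `ε⁻¹[K, L] = τ∂L` and `ε⁻¹[K, L̄] = τ∂L̄`, and the constants of
motion are `z_k = p_{-1}(k) - q p_1(k) - τ P p_0(k)`, where `L^k = ∑ p_j(k) Λ^j`. -/
structure IsEquivariantToda (L : DiffOp) : Prop where
  top : ∀ k : ℤ, 1 < k → L k = 0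
  one : L 1 = 1
  zero : L 0 = field 0
  constraint : ∀ k : ℤ, opComm (opK L) L k = PowerSeries.X * (tau * dx (L k))
  constraint_bar : ∀ k : ℤ,
    opComm (opK L) (opConj L) k = PowerSeries.X * (tau * dx (opConj L k))
  constants : ∀ k : ℕ, 0 < k →
    opPow L k (-1) - qpow 1 * opPow L k 1 - tau * opP (opPow L k 0) = zc k

/-- Evolutionary derivations, linear over the power series in `ε` and the polynomials in `τ`, and
compatible with `u = log q`. -/
structure IsEvolutionary (D : Derivation ℚ DiffAlg DiffAlg) : Prop where
  eps : D PowerSeries.X = 0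
  tau : D tau = 0
  log : D (qpow 1) = qpow 1 * D (field 1)
  comm : ∀ f, D (dx f) = dx (D f)

/-- `D` is an evolutionary derivation with `D L = [ε⁻¹B, L]` and `D L̄ = [ε⁻¹B, L̄]`. -/
structure IsLaxFlow (L B : DiffOp) (D : Derivation ℚ DiffAlg DiffAlg) : Prop where
  evol : IsEvolutionary D
  lax : ∀ k : ℤ, PowerSeries.X * D (L k) = opComm B L k
  lax_bar : ∀ k : ℤ, PowerSeries.X * D (opConj L k) = opComm B (opConj L) k

/-- `D` is the flow `∂_n`, given by the Lax equations with `B_n = ε⁻¹ (L^n)_+`. -/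
def IsFlow (L : DiffOp) (n : ℕ) (D : Derivation ℚ DiffAlg DiffAlg) : Prop :=
  IsLaxFlow L (opPlus (opPow L n)) D

/-- `D` is the flow `∂̄_n`, given by the Lax equations with `C_n = -ε⁻¹ (L̄^n)_-`. -/
def IsFlowBar (L : DiffOp) (n : ℕ) (D : Derivation ℚ DiffAlg DiffAlg) : Prop :=
  IsLaxFlow L (-opMinus (opPow (opConj L) n)) D

/-! ### Functionals and variational derivatives -/

/-- Functionals: densities modulo total derivatives. -/
abbrev Functional : Type := DiffAlg ⧸ LinearMap.range dx

/-- `f ↦ ∫ f dx`. -/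
def integral : DiffAlg →ₗ[ℚ] Functional := (LinearMap.range dx).mkQ

theorem extDer_single (d : Derivation ℚ Jet Jet) (c : Jet) (n : ℤ) (a : Jet) :
    extDer d c (AddMonoidAlgebra.single n a) =
      AddMonoidAlgebra.single n (d a + n • (c * a)) := extLin_single d c n a

theorem exists_bound_jet (g : ℕ → Gen) (hg : Function.Injective g) (f : DiffPoly) :
    ∃ N : ℕ, ∀ n, N ≤ n → pd (g n) f = 0 := by
  induction f using AddMonoidAlgebra.induction_linear with
  | zero => exact ⟨0, fun n _ => map_zero _⟩
  | add f₁ f₂ h₁ h₂ =>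
    obtain ⟨N₁, h₁⟩ := h₁
    obtain ⟨N₂, h₂⟩ := h₂
    refine ⟨max N₁ N₂, fun n hn => ?_⟩
    rw [map_add, h₁ n (le_trans (le_max_left _ _) hn), h₂ n (le_trans (le_max_right _ _) hn),
      add_zero]
  | single m a =>
    classical
    have hfin : {n | g n ∈ a.vars ∪ {Gen.u 0}}.Finite :=
      Set.Finite.preimage hg.injOn (a.vars ∪ {Gen.u 0}).finite_toSet
    obtain ⟨N, hN⟩ := hfin.bddAbove
    refine ⟨N + 1, fun n hn => ?_⟩
    have hn' : g n ∉ a.vars ∪ {Gen.u 0} := fun h => by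
      have := hN h
      omega
    simp only [Finset.mem_union, Finset.mem_singleton, not_or] at hn'
    rw [pd, extDer_single, if_neg hn'.2, MvPolynomial.pderiv_eq_zero_of_notMem_vars hn'.1]
    simp

theorem jet_injective (i : Fin 2) : Function.Injective (jet i) := by
  fin_cases i <;> intro a b h <;> simpa [jet] using h

/-- The terms `(-∂)^n (∂f / ∂x_i^{(n)})` of the variational derivative. -/
def varTerm (i : Fin 2) (n : ℕ) : DiffPoly →ₗ[ℚ] DiffPoly :=
  ((-(dx₀ : DiffPoly →ₗ[ℚ] DiffPoly)) ^ n) ∘ₗ (pd (jet i n) : DiffPoly →ₗ[ℚ] DiffPoly)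

theorem varTerm_finite (i : Fin 2) (f : DiffPoly) :
    (Function.support fun n => varTerm i n f).Finite := by
  obtain ⟨N, hN⟩ := exists_bound_jet (jet i) (jet_injective i) f
  refine (Set.finite_lt_nat N).subset fun n hn => ?_
  by_contra h
  exact hn (by simp [varTerm, hN n (not_lt.mp h)])

/-- The variational derivative `∑ (-∂)^n ∂f/∂x_i^{(n)}` of a differential polynomial. -/
def varDer₀ (i : Fin 2) : DiffPoly →ₗ[ℚ] DiffPoly where
  toFun f := ∑ᶠ n : ℕ, varTerm i n f
  map_add' f g := by
    simp only [map_add]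
    exact finsum_add_distrib (varTerm_finite i f) (varTerm_finite i g)
  map_smul' r f := by
    simp only [map_smul, RingHom.id_apply]
    exact (smul_finsum' r (varTerm_finite i f)).symm

theorem extDer_comm (d d' : Derivation ℚ Jet Jet) (c c' : Jet) (f : DiffPoly) :
    extDer d c (extDer d' c' f) =
      extDer d' c' (extDer d c f) + extDer ⁅d, d'⁆ (d c' - d' c) f := by
  induction f using AddMonoidAlgebra.induction_linear with
  | zero => simp
  | add f₁ f₂ h₁ h₂ => simp only [map_add, h₁, h₂]; abel
  | single n a =>
    simp only [extDer_single, ← AddMonoidAlgebra.single_add]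
    congr 1
    simp only [Derivation.commutator_apply, map_add, zsmul_eq_mul, Derivation.leibniz,
      Derivation.map_intCast, smul_eq_mul]
    ring

theorem extDer_zero (f : DiffPoly) : extDer 0 0 f = 0 := by
  induction f using AddMonoidAlgebra.induction_linear with
  | zero => simp
  | add f₁ f₂ h₁ h₂ => rw [map_add, h₁, h₂, add_zero]
  | single n a => rw [extDer_single]; simp

theorem pd_dx_zero (i : Fin 2) (f : DiffPoly) :
    pd (jet i 0) (dx₀ f) = dx₀ (pd (jet i 0) f) := by
  rw [pd, dx₀, extDer_comm]
  have h1 : ⁅MvPolynomial.pderiv (R := ℚ) (jet i 0), MvPolynomial.mkDerivation ℚ dxGen⁆ = 0 := by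
    refine MvPolynomial.derivation_ext fun g => ?_
    fin_cases i <;> cases g <;>
      simp [Derivation.commutator_apply, jet, dxGen, MvPolynomial.pderiv_X, Pi.single_apply,
        MvPolynomial.mkDerivation_X, apply_ite]
  have h2 : (MvPolynomial.pderiv (R := ℚ) (jet i 0)) (MvPolynomial.X (Gen.u 1)) -
      (MvPolynomial.mkDerivation ℚ dxGen) (if jet i 0 = Gen.u 0 then 1 else 0) = 0 := by
    fin_cases i <;> simp [jet, MvPolynomial.pderiv_X]
  rw [h1, h2, extDer_zero, add_zero]

theorem pd_dx_succ (i : Fin 2) (n : ℕ) (f : DiffPoly) :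
    pd (jet i (n + 1)) (dx₀ f) = dx₀ (pd (jet i (n + 1)) f) + pd (jet i n) f := by
  rw [pd, dx₀, extDer_comm, pd]
  have h1 : ⁅MvPolynomial.pderiv (R := ℚ) (jet i (n + 1)), MvPolynomial.mkDerivation ℚ dxGen⁆ =
      MvPolynomial.pderiv (jet i n) := by
    refine MvPolynomial.derivation_ext fun g => ?_
    fin_cases i <;> cases g <;>
      simp [Derivation.commutator_apply, jet, dxGen, MvPolynomial.pderiv_X, Pi.single_apply,
        MvPolynomial.mkDerivation_X, apply_ite]
  have h2 : (MvPolynomial.pderiv (R := ℚ) (jet i (n + 1))) (MvPolynomial.X (Gen.u 1)) -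
      (MvPolynomial.mkDerivation ℚ dxGen) (if jet i (n + 1) = Gen.u 0 then 1 else 0) =
      if jet i n = Gen.u 0 then 1 else 0 := by
    fin_cases i <;> simp [jet, MvPolynomial.pderiv_X, Pi.single_apply, eq_comm]
  rw [h1, h2]

theorem varDer₀_dx (i : Fin 2) (f : DiffPoly) : varDer₀ i (dx₀ f) = 0 := by
  obtain ⟨N, hN⟩ := exists_bound_jet (jet i) (jet_injective i) f
  obtain ⟨M, hM⟩ := exists_bound_jet (jet i) (jet_injective i) (dx₀ f)
  have key : ∀ m, ∑ n ∈ Finset.range (m + 1), varTerm i n (dx₀ f) =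
      -(((-(dx₀ : DiffPoly →ₗ[ℚ] DiffPoly)) ^ (m + 1)) (pd (jet i m) f)) := by
    intro m
    induction m with
    | zero => simp [varTerm, pd_dx_zero]
    | succ m ih =>
      rw [Finset.sum_range_succ, ih, varTerm, LinearMap.comp_apply, Derivation.coeFn_coe,
        pd_dx_succ, map_add, pow_succ _ (m + 1), Module.End.mul_apply, LinearMap.neg_apply,
        map_neg, Derivation.coeFn_coe]
      abel
  have hs : varDer₀ i (dx₀ f) =
      ∑ n ∈ Finset.range (max N M + 1), varTerm i n (dx₀ f) := by
    refine finsum_eq_sum_of_support_subset _ fun n hn => ?_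
    rw [Finset.coe_range, Set.mem_Iio]
    by_contra h
    have h' : M ≤ n := le_trans (le_max_right N M) (by omega)
    exact hn (by simp [varTerm, hM n h'])
  rw [hs, key, hN _ (le_max_left _ _), map_zero, neg_zero]

/-- The variational derivative of a functional: `varDer 0 = δ_v`, `varDer 1 = δ_u`. -/
def varDer (i : Fin 2) : Functional →ₗ[ℚ] DiffAlg :=
  (LinearMap.range dx).liftQ (epsExt (varDer₀ i)) (by
    rintro _ ⟨f, rfl⟩
    rw [LinearMap.mem_ker]
    ext1 n
    simp [dx, epsExt, varDer₀_dx])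

/-! ### Hamiltonian structures -/

/-- Matrices of operators on the differential algebra. -/
abbrev MatOp : Type := Matrix (Fin 2) (Fin 2) (DiffAlg →ₗ[ℚ] DiffAlg)

/-- The bracket `{F, G} = ∑ ∫ (δ_i F) (P_ij (δ_j G)) dx` of functionals. -/
def bracket (P : MatOp) (F G : Functional) : Functional :=
  integral (∑ i, ∑ j, varDer i F * P i j (varDer j G))

/-- The bracket is a Lie bracket on functionals, i.e. `P` is a Hamiltonian (Poisson) operator. -/
structure IsPoisson (P : MatOp) : Prop where
  skew : ∀ F G, bracket P F G = -bracket P G F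
  jacobi : ∀ F G H, bracket P F (bracket P G H) + bracket P G (bracket P H F) +
    bracket P H (bracket P F G) = 0

/-- `D` is the Hamiltonian vector field of `H`: `D x_i = ∑ P_ij (δ_j H)` for the fields, the
parameters `z_k`, `z̄_k` are constants of motion, and `D` acts on functionals by `{·, H}`. -/
structure IsHamiltonianFlow (P : MatOp) (H : Functional)
    (D : Derivation ℚ DiffAlg DiffAlg) : Prop where
  fields : ∀ i, D (field i) = ∑ j, P i j (varDer j H)
  z : ∀ k, 0 < k → D (zc k) = 0
  zbar : ∀ k, 0 < k → D (zbarc k) = 0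
  functionals : ∀ f, integral (D f) = bracket P (integral f) H

/-- The Poisson operator of the equivariant Toda lattice. -/
def equivariantPoisson : MatOp :=
  !![LinearMap.mulLeft ℚ tau ∘ₗ dx, nabla; nabla, 0]

/-- The first Poisson operator of the Toda chain. -/
def todaPoisson : MatOp := !![0, nabla; nabla, 0]

/-- The Lax operator `Λ + v + qΛ⁻¹` of the Toda chain. -/
def todaChainLax : DiffOp := fun k =>
  if k = 1 then 1 else if k = 0 then field 0 else if k = -1 then qpow 1 else 0

/-- The density of `h_n = (n+1)⁻¹ Res(L^{n+1})`. -/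
def hDensity (L : DiffOp) (n : ℕ) : DiffAlg := (1 / ((n : ℚ) + 1)) • opPow L (n + 1) 0

/-- The density of `H_n = h_n - τ h_{n-1} + ∑_{k=1}^{n-1} z_k h_{n-k-1}`, for `n > 0`. -/
def hamDensity (L : DiffOp) (n : ℕ) : DiffAlg :=
  hDensity L n - tau * hDensity L (n - 1) +
    ∑ k ∈ Finset.Icc 1 (n - 1), zc k * hDensity L (n - k - 1)

/-- The Hamiltonian `H_n`. -/
def ham (L : DiffOp) (n : ℕ) : Functional := integral (hamDensity L n)

/-- The conjugate Hamiltonian `H̄_n`. -/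
def hamBar (L : DiffOp) (n : ℕ) : Functional := integral (bar (hamDensity L n))

end

end EqToda

namespace EqToda
noncomputable section
open scoped BigOperators

/-! ### Maps linear over the power series in `ε` -/

/-! The centre of the argument is the formula K − ετ∂ = L − τ log L − ∑_{m>0} (z_m/m) L^{-m}, where
K = Λ + v + qΛ⁻¹ and log L = ε∂ + w with w of negative order. Multiplying its variation by L^n and
taking the trace ∫ res, the right side becomes the variation of H_n and the left side becomes ∫
(p_0(n) dv + q p_1(n) du). Hence δ_v H_n = p_0(n) and δ_u H_n = q p_1(n).

Lax operator. The operator K depends only on the two leading terms of L (`opK_eq`). The coefficient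
of Λ^{-k} in L enters the k-th constant of motion through the invertible operator
sinh(kε∂/2)/sinh(ε∂/2) and does not enter the earlier ones, so the constants of motion alone
determine L (`exists_motion`, `eq_of_motion`). The constraint is then a consequence: the degree 0
part of [K, X] − ετ∂X is ε∇(X_{-1} − qX_1 − τPX_0) (`adA_coeff_zero`), which vanishes on all powers
of L, and any leading coefficient of [K, L] − ετ∂L is detected there on a suitable power
(`adA_eq_zero`). The constraint for the conjugate of L follows because conjugation is an
anti-automorphism (`conj_lax`, `CommA.conj`).

Flows. If Q commutes with K − ετ∂, its truncation −Q_- fails to do so only in degrees 0 and −1,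
because K has only three terms (`adA_negMinus`). The two defects prescribe the evolution of v and u.
The Lax equation then follows from this zero curvature equation (`lax_of_zero_curvature`): its
defect commutes with K − ετ∂, so the leading coefficient is a constant, and invariance of z_k forces
that constant to be zero. Taking Q to be L^n, or the n-th power of the conjugate of L, gives both
families of flows; the equations for the conjugate of L come from `conj_lax`. For uniqueness, the
coefficients of L and of its conjugate determine a derivation on all generators
(`isLaxFlow_unique`).

Logarithm. Modulo every power of ε, the conjugate L^n X L^{-n} is polynomial in n, since each finite
difference gains a factor ε (`exists_hasLin`). Its linear coefficient plays the role of [log L, X]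
and has the form ε∂X + [w, X] (`MonicUnit.exists_log`). The operator S = K − L + τw commutes with L
and has negative order, so it expands in powers of L⁻¹ with constant coefficients. Applying the
grading derivation aΛ^k ↦ kaΛ^k and the trace identifies these coefficients as −z_m/m
(`IsToda.expCoeff_eq`); the variation of H_n follows in `IsToda.integral_hamDensity`.

Poisson structure and specialization. The matrix operator is skew-adjoint and commutes with
evolutionary derivations, so the Jacobi identity reduces to symmetry of the second variation
(`IsConstSkew.isPoisson`). At τ = z = z̄ = 0 the operator Λ + v + qΛ⁻¹ is fixed by conjugation and
so has vanishing constants of motion; uniqueness of L identifies it with the specialized L. -/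

theorem coeff_rat_smul (n : ℕ) (r : ℚ) (f : DiffAlg) :
    PowerSeries.coeff n (r • f) = r • PowerSeries.coeff n f := rfl

/-- The ε-adic topology is separated. Identities for operators of infinite order gain one factor ε
per induction step and end here. -/
theorem eq_zero_of_forall_dvd {f : DiffAlg}
    (h : ∀ N : ℕ, (PowerSeries.X : DiffAlg) ^ N ∣ f) : f = 0 := by
  ext1 n
  exact PowerSeries.X_pow_dvd_iff.1 (h (n + 1)) n n.lt_succ_self

/-- Additive maps commuting with multiplication by `ε` are determined by their values on
`ε`-independent elements. -/
theorem eps_ext {T₁ T₂ : DiffAlg →+ DiffAlg}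
    (h₁ : ∀ f, T₁ (PowerSeries.X * f) = PowerSeries.X * T₁ f)
    (h₂ : ∀ f, T₂ (PowerSeries.X * f) = PowerSeries.X * T₂ f)
    (h : ∀ a, T₁ (PowerSeries.C a) = T₂ (PowerSeries.C a)) (f : DiffAlg) : T₁ f = T₂ f := by
  rw [← sub_eq_zero]
  refine eq_zero_of_forall_dvd fun N => ?_
  induction N generalizing f with
  | zero => simp
  | succ N ih =>
    rw [PowerSeries.eq_X_mul_shift_add_const f, map_add, map_add, h₁, h₂, h, add_sub_add_right_eq_sub,
      ← mul_sub, pow_succ']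
    exact mul_dvd_mul_left _ (ih _)

/-- The extension of an additive map on differential polynomials to power series in `ε`. -/
def epsLift (d : DiffPoly →+ DiffAlg) : DiffAlg →+ DiffAlg where
  toFun f := PowerSeries.mk fun n => ∑ p ∈ Finset.HasAntidiagonal.antidiagonal n,
    PowerSeries.coeff p.1 (d (PowerSeries.coeff p.2 f))
  map_zero' := by ext1 n; simp
  map_add' f g := by ext1 n; simp [Finset.sum_add_distrib]

theorem coeff_epsLift (d : DiffPoly →+ DiffAlg) (f : DiffAlg) (n : ℕ) :
    PowerSeries.coeff n (epsLift d f) = ∑ p ∈ Finset.HasAntidiagonal.antidiagonal n,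
      PowerSeries.coeff p.1 (d (PowerSeries.coeff p.2 f)) := by
  simp [epsLift]

theorem epsLift_C (d : DiffPoly →+ DiffAlg) (a : DiffPoly) :
    epsLift d (PowerSeries.C a) = d a := by
  ext1 n
  rw [coeff_epsLift, Finset.sum_eq_single (n, 0)]
  · simp
  · rintro ⟨i, j⟩ hij hne
    rw [Finset.HasAntidiagonal.mem_antidiagonal] at hij
    have : j ≠ 0 := by rintro rfl; exact hne (by simp_all)
    simp [PowerSeries.coeff_C, this]
  · simp

theorem epsLift_X_mul (d : DiffPoly →+ DiffAlg) (f : DiffAlg) :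
    epsLift d (PowerSeries.X * f) = PowerSeries.X * epsLift d f := by
  ext1 n
  rw [coeff_epsLift]
  cases n with
  | zero => simp
  | succ n =>
    rw [PowerSeries.coeff_succ_X_mul, coeff_epsLift, Finset.Nat.antidiagonal_succ']
    simp [PowerSeries.coeff_succ_X_mul]

theorem epsLift_unique {d : DiffPoly →+ DiffAlg} {T : DiffAlg →+ DiffAlg}
    (h₁ : ∀ f, T (PowerSeries.X * f) = PowerSeries.X * T f)
    (h : ∀ a, T (PowerSeries.C a) = d a) (f : DiffAlg) : T f = epsLift d f :=
  eps_ext h₁ (epsLift_X_mul d) (fun a => by rw [h, epsLift_C]) f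

/-- Two biadditive maps which are `ε`-linear in each argument agree if they agree on
`ε`-independent elements. -/
theorem eps_ext₂ {T₁ T₂ : DiffAlg →+ DiffAlg →+ DiffAlg}
    (h₁ : ∀ f g, T₁ (PowerSeries.X * f) g = PowerSeries.X * T₁ f g)
    (h₁' : ∀ f g, T₁ f (PowerSeries.X * g) = PowerSeries.X * T₁ f g)
    (h₂ : ∀ f g, T₂ (PowerSeries.X * f) g = PowerSeries.X * T₂ f g)
    (h₂' : ∀ f g, T₂ f (PowerSeries.X * g) = PowerSeries.X * T₂ f g)
    (h : ∀ a b, T₁ (PowerSeries.C a) (PowerSeries.C b) = T₂ (PowerSeries.C a) (PowerSeries.C b))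
    (f g : DiffAlg) : T₁ f g = T₂ f g := by
  refine eps_ext (h₁' f) (h₂' f) (fun b => ?_) g
  exact eps_ext (T₁ := T₁.flip (PowerSeries.C b)) (T₂ := T₂.flip (PowerSeries.C b))
    (fun f => h₁ f _) (fun f => h₂ f _) (fun a => h a b) f

/-- Multiplicativity is an identity between two biadditive maps that are ε-linear in each argument,
so ε-independent arguments suffice. -/
theorem eps_mul_of_C {T : DiffAlg →+ DiffAlg}
    (h₁ : ∀ f, T (PowerSeries.X * f) = PowerSeries.X * T f)
    (h : ∀ a b : DiffPoly, T (PowerSeries.C (a * b)) = T (PowerSeries.C a) * T (PowerSeries.C b))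
    (f g : DiffAlg) : T (f * g) = T f * T g := by
  refine eps_ext₂ (T₁ := (AddMonoidHom.mul (R := DiffAlg)).compr₂ T)
    (T₂ := ((AddMonoidHom.mul (R := DiffAlg)).comp T).compl₂ T) ?_ ?_ ?_ ?_ ?_ f g <;> intro f g
  · simp [mul_assoc, h₁]
  · simp [mul_left_comm f, h₁]
  · simp [mul_assoc, h₁]
  · simp [mul_left_comm _ PowerSeries.X, h₁]
  · simpa using h f g

theorem eps_leibniz_of_C {T : DiffAlg →+ DiffAlg}
    (h₁ : ∀ f, T (PowerSeries.X * f) = PowerSeries.X * T f)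
    (h : ∀ a b : DiffPoly, T (PowerSeries.C (a * b)) =
      PowerSeries.C a * T (PowerSeries.C b) + PowerSeries.C b * T (PowerSeries.C a))
    (f g : DiffAlg) : T (f * g) = f * T g + g * T f := by
  refine eps_ext₂ (T₁ := (AddMonoidHom.mul (R := DiffAlg)).compr₂ T)
    (T₂ := (AddMonoidHom.mul (R := DiffAlg)).compl₂ T +
      ((AddMonoidHom.mul (R := DiffAlg)).compl₂ T).flip) ?_ ?_ ?_ ?_ ?_ f g <;> intro f g
  · simp [mul_assoc, h₁]
  · simp [mul_left_comm f, h₁]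
  · simp [mul_assoc, h₁, mul_add, mul_left_comm g]
  · simp [mul_assoc, h₁, mul_add, mul_left_comm f]
  · simpa using h f g

/-! ### The derivation `∂` -/

theorem epsExt_X_mul (d : DiffPoly →ₗ[ℚ] DiffPoly) (f : DiffAlg) :
    epsExt d (PowerSeries.X * f) = PowerSeries.X * epsExt d f := by
  ext1 n
  cases n <;> simp [epsExt, PowerSeries.coeff_succ_X_mul]

theorem coeff_epsExt (d : DiffPoly →ₗ[ℚ] DiffPoly) (f : DiffAlg) (n : ℕ) :
    PowerSeries.coeff n (epsExt d f) = d (PowerSeries.coeff n f) := by simp [epsExt]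

theorem epsExt_C (d : DiffPoly →ₗ[ℚ] DiffPoly) (a : DiffPoly) :
    epsExt d (PowerSeries.C a) = PowerSeries.C (d a) := by
  ext1 n
  by_cases h : n = 0 <;> simp [epsExt, PowerSeries.coeff_C, h]

theorem epsExt_leibniz (d : Derivation ℚ DiffPoly DiffPoly) (f g : DiffAlg) :
    epsExt d (f * g) = f * epsExt d g + g * epsExt d f := by
  refine eps_leibniz_of_C (T := (epsExt d).toAddMonoidHom) (fun f => epsExt_X_mul _ f)
    (fun a b => ?_) f g
  change epsExt d _ = _ * epsExt d _ + _ * epsExt d _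
  rw [epsExt_C, epsExt_C, epsExt_C, Derivation.coeFn_coe, Derivation.leibniz, smul_eq_mul,
    smul_eq_mul, map_add, map_mul, map_mul]

theorem dx_X_mul (f : DiffAlg) : dx (PowerSeries.X * f) = PowerSeries.X * dx f := epsExt_X_mul _ f

theorem coeff_dx (f : DiffAlg) (n : ℕ) :
    PowerSeries.coeff n (dx f) = dx₀ (PowerSeries.coeff n f) := coeff_epsExt _ f n

theorem dx_C (a : DiffPoly) : dx (PowerSeries.C a) = PowerSeries.C (dx₀ a) := epsExt_C _ a

theorem dx_mul (f g : DiffAlg) : dx (f * g) = f * dx g + g * dx f := epsExt_leibniz dx₀ f g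

theorem dx_one : dx 1 = 0 := by
  have := dx_mul 1 1
  simpa using this

theorem dx_gen_v (n : ℕ) : dx (gen (Gen.v n)) = gen (Gen.v (n + 1)) := by
  rw [gen, dx_C, dx₀, ← LaurentPolynomial.single_eq_C, extDer_single]
  simp [dxGen, gen]

theorem dx_gen_u (n : ℕ) : dx (gen (Gen.u n)) = gen (Gen.u (n + 1)) := by
  rw [gen, dx_C, dx₀, ← LaurentPolynomial.single_eq_C, extDer_single]
  simp [dxGen, gen]

theorem dx_tau : dx tau = 0 := by
  rw [tau, gen, dx_C, dx₀, ← LaurentPolynomial.single_eq_C, extDer_single]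
  simp [dxGen]

theorem dx_gen_z (k : ℕ) : dx (gen (Gen.z k)) = 0 := by
  rw [gen, dx_C, dx₀, ← LaurentPolynomial.single_eq_C, extDer_single]
  simp [dxGen]

theorem dx_gen_zbar (k : ℕ) : dx (gen (Gen.zbar k)) = 0 := by
  rw [gen, dx_C, dx₀, ← LaurentPolynomial.single_eq_C, extDer_single]
  simp [dxGen]

theorem dx_tau_mul (f : DiffAlg) : dx (tau * f) = tau * dx f := by
  rw [dx_mul, dx_tau, mul_zero, add_zero]

theorem dx_qpow (m : ℤ) : dx (qpow m) = m • (qpow m * gen (Gen.u 1)) := by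
  rw [qpow, dx_C, dx₀, LaurentPolynomial.T, extDer_single, gen, ← map_mul, ← map_zsmul,
    ← LaurentPolynomial.single_eq_C, AddMonoidAlgebra.single_mul_single]
  simp
  ring

theorem qpow_add (m n : ℤ) : qpow (m + n) = qpow m * qpow n := by
  rw [qpow, qpow, qpow, ← map_mul, ← LaurentPolynomial.T_add]

theorem qpow_zero : qpow 0 = 1 := by simp [qpow]

theorem qpow_mul_neg (m : ℤ) : qpow m * qpow (-m) = 1 := by
  rw [← qpow_add, add_neg_cancel, qpow_zero]

/-! ### The operators `φ(ε∂)` -/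

theorem opSeries_X_mul (φ : PowerSeries ℚ) (f : DiffAlg) :
    opSeries φ (PowerSeries.X * f) = PowerSeries.X * opSeries φ f := by
  ext1 n
  cases n with
  | zero => simp [opSeries]
  | succ n =>
    rw [PowerSeries.coeff_succ_X_mul]
    simp only [opSeries, LinearMap.coe_mk, AddHom.coe_mk, PowerSeries.coeff_mk]
    rw [Finset.Nat.antidiagonal_succ']
    simp [PowerSeries.coeff_succ_X_mul]

theorem coeff_opSeries (φ : PowerSeries ℚ) (f : DiffAlg) (n : ℕ) :
    PowerSeries.coeff n (opSeries φ f) = ∑ p ∈ Finset.HasAntidiagonal.antidiagonal n,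
      PowerSeries.coeff p.1 φ • ((dx₀ : DiffPoly →ₗ[ℚ] DiffPoly) ^ p.1) (PowerSeries.coeff p.2 f) := by
  simp [opSeries]

theorem coeff_opSeries_C (φ : PowerSeries ℚ) (a : DiffPoly) (n : ℕ) :
    PowerSeries.coeff n (opSeries φ (PowerSeries.C a)) =
      PowerSeries.coeff n φ • ((dx₀ : DiffPoly →ₗ[ℚ] DiffPoly) ^ n) a := by
  rw [coeff_opSeries, Finset.sum_eq_single (n, 0)]
  · simp
  · rintro ⟨i, j⟩ hij hne
    rw [Finset.HasAntidiagonal.mem_antidiagonal] at hij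
    have : j ≠ 0 := by rintro rfl; exact hne (by simp_all)
    simp [PowerSeries.coeff_C, this]
  · simp

theorem opSeries_mul (φ ψ : PowerSeries ℚ) (f : DiffAlg) :
    opSeries (φ * ψ) f = opSeries φ (opSeries ψ f) := by
  refine eps_ext (T₁ := (opSeries (φ * ψ)).toAddMonoidHom)
    (T₂ := (opSeries φ ∘ₗ opSeries ψ).toAddMonoidHom) (fun f => opSeries_X_mul _ f)
    (fun f => ?_) (fun a => ?_) f
  · change opSeries φ (opSeries ψ _) = _ * opSeries φ (opSeries ψ _)
    rw [opSeries_X_mul, opSeries_X_mul]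
  · change opSeries (φ * ψ) _ = opSeries φ (opSeries ψ _)
    ext1 n
    rw [coeff_opSeries_C, coeff_opSeries, PowerSeries.coeff_mul, Finset.sum_smul]
    refine Finset.sum_congr rfl fun p hp => ?_
    rw [coeff_opSeries_C, map_smul, smul_smul, ← Module.End.mul_apply, ← pow_add,
      Finset.HasAntidiagonal.mem_antidiagonal.1 hp]

theorem opSeries_add (φ ψ : PowerSeries ℚ) (f : DiffAlg) :
    opSeries (φ + ψ) f = opSeries φ f + opSeries ψ f := by
  ext1 n; simp [coeff_opSeries, add_smul, Finset.sum_add_distrib]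

theorem opSeries_sub (φ ψ : PowerSeries ℚ) (f : DiffAlg) :
    opSeries (φ - ψ) f = opSeries φ f - opSeries ψ f := by
  rw [eq_sub_iff_add_eq, ← opSeries_add, sub_add_cancel]

theorem opSeries_C (r : ℚ) (f : DiffAlg) : opSeries (PowerSeries.C r) f = r • f := by
  ext1 n
  rw [coeff_opSeries, Finset.sum_eq_single (0, n)]
  · simp
  · rintro ⟨i, j⟩ hij hne
    rw [Finset.HasAntidiagonal.mem_antidiagonal] at hij
    have : i ≠ 0 := by rintro rfl; exact hne (by simp_all)
    simp [PowerSeries.coeff_C, this]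
  · simp

theorem opSeries_one (f : DiffAlg) : opSeries 1 f = f := by
  rw [← map_one (PowerSeries.C (R := ℚ)), opSeries_C, one_smul]

theorem opSeries_X (f : DiffAlg) : opSeries PowerSeries.X f = PowerSeries.X * dx f := by
  refine eps_ext (T₁ := (opSeries PowerSeries.X).toAddMonoidHom)
    (T₂ := (AddMonoidHom.mulLeft (PowerSeries.X : DiffAlg)).comp dx.toAddMonoidHom)
    (fun f => opSeries_X_mul _ f) (fun f => ?_) (fun a => ?_) f
  · change PowerSeries.X * dx _ = _ * (PowerSeries.X * dx _)
    rw [dx_X_mul]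
  · change opSeries PowerSeries.X _ = PowerSeries.X * dx _
    ext1 n
    rw [coeff_opSeries_C, dx_C, PowerSeries.coeff_X]
    rcases n with _ | _ | n
    · simp
    · simp
    · simp [PowerSeries.coeff_X]

/-- The shift of the coefficients of a power series. -/
def tail (φ : PowerSeries ℚ) : PowerSeries ℚ :=
  PowerSeries.mk fun n => PowerSeries.coeff (n + 1) φ

/-- From φ(t) = φ(0) + t·φ₁(t) at t = ε∂. The second summand is divisible by ε and is also a total
derivative; the first fact drives the ε-adic inductions, the second the statements modulo ∂. -/
theorem opSeries_eq_tail (φ : PowerSeries ℚ) (f : DiffAlg) :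
    opSeries φ f = PowerSeries.constantCoeff φ • f +
      PowerSeries.X * opSeries (tail φ) (dx f) := by
  conv_lhs => rw [PowerSeries.eq_X_mul_shift_add_const φ]
  rw [opSeries_add, opSeries_C, mul_comm, opSeries_mul, opSeries_X, opSeries_X_mul, add_comm]
  rfl

/-- Splitting both sides with `opSeries_eq_tail` gains a factor ε, so no continuity of `T` has to be
assumed. -/
theorem opSeries_commute {T : DiffAlg →+ DiffAlg}
    (h : ∀ f, T (PowerSeries.X * f) = PowerSeries.X * T f) (h' : ∀ f, T (dx f) = dx (T f))
    (φ : PowerSeries ℚ) (f : DiffAlg) : T (opSeries φ f) = opSeries φ (T f) := by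
  rw [← sub_eq_zero]
  refine eq_zero_of_forall_dvd fun N => ?_
  induction N generalizing f φ with
  | zero => simp
  | succ N ih =>
    rw [opSeries_eq_tail, opSeries_eq_tail φ (T f), map_add, map_rat_smul, h,
      add_sub_add_left_eq_sub, ← mul_sub, pow_succ', ← h']
    exact mul_dvd_mul_left _ (ih _ _)

theorem opSeries_dx (φ : PowerSeries ℚ) (f : DiffAlg) : opSeries φ (dx f) = dx (opSeries φ f) :=
  (opSeries_commute (T := dx.toAddMonoidHom) dx_X_mul (fun _ => rfl) φ f).symm

theorem opSeries_comm (φ ψ : PowerSeries ℚ) (f : DiffAlg) :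
    opSeries φ (opSeries ψ f) = opSeries ψ (opSeries φ f) := by
  rw [← opSeries_mul, mul_comm, opSeries_mul]

theorem opSeries_sub_mem (φ : PowerSeries ℚ) (f : DiffAlg) :
    opSeries φ f - PowerSeries.constantCoeff φ • f ∈ LinearMap.range dx := by
  rw [opSeries_eq_tail, add_sub_cancel_left, opSeries_dx, ← dx_X_mul]
  exact ⟨_, rfl⟩

theorem opSeries_mul_const (φ : PowerSeries ℚ) {c : DiffAlg} (hc : dx c = 0) (f : DiffAlg) :
    opSeries φ (c * f) = c * opSeries φ f :=
  (opSeries_commute (T := AddMonoidHom.mulLeft c) (fun f => mul_left_comm _ _ _)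
    (fun f => by simp [dx_mul, hc]) φ f).symm

theorem opSeries_const (φ : PowerSeries ℚ) {c : DiffAlg} (hc : dx c = 0) :
    opSeries φ c = PowerSeries.constantCoeff φ • c := by
  rw [opSeries_eq_tail, hc, map_zero, mul_zero, add_zero]

theorem opSeries_inv (φ : PowerSeries ℚ) (h : PowerSeries.constantCoeff φ ≠ 0) (f : DiffAlg) :
    opSeries φ (opSeries φ⁻¹ f) = f := by
  rw [← opSeries_mul, PowerSeries.mul_inv_cancel _ h, opSeries_one]

theorem opSeries_inv' (φ : PowerSeries ℚ) (h : PowerSeries.constantCoeff φ ≠ 0) (f : DiffAlg) :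
    opSeries φ⁻¹ (opSeries φ f) = f := by
  rw [opSeries_comm, opSeries_inv φ h]

/-! ### The shifts -/

theorem shift_X_mul (s : ℚ) (f : DiffAlg) :
    shift s (PowerSeries.X * f) = PowerSeries.X * shift s f := opSeries_X_mul _ f

theorem shift_add_apply (s t : ℚ) (f : DiffAlg) : shift (s + t) f = shift s (shift t f) := by
  rw [shift, shift, shift, ← opSeries_mul, PowerSeries.exp_mul_exp_eq_exp_add]

theorem shift_zero_apply (f : DiffAlg) : shift 0 f = f := by
  rw [shift, PowerSeries.rescale_zero_apply, PowerSeries.constantCoeff_exp, map_one, opSeries_one]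

theorem shift_const (s : ℚ) {c : DiffAlg} (hc : dx c = 0) : shift s c = c := by
  rw [shift, opSeries_const _ hc, ← PowerSeries.coeff_zero_eq_constantCoeff_apply]; simp

theorem shift_one_apply (s : ℚ) : shift s 1 = 1 := shift_const s dx_one

/-- With 1/n! in front the binomial coefficients of Leibniz's rule disappear; this is the form that
makes exp(sε∂) multiplicative. -/
theorem dx_pow_mul_div (n : ℕ) (a b : DiffPoly) :
    ((n.factorial : ℚ)⁻¹) • ((dx₀ : DiffPoly →ₗ[ℚ] DiffPoly) ^ n) (a * b) =
      ∑ p ∈ Finset.HasAntidiagonal.antidiagonal n,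
        (((p.1.factorial : ℚ)⁻¹) • ((dx₀ : DiffPoly →ₗ[ℚ] DiffPoly) ^ p.1) a) *
          (((p.2.factorial : ℚ)⁻¹) • ((dx₀ : DiffPoly →ₗ[ℚ] DiffPoly) ^ p.2) b) := by
  have key : ((dx₀ : DiffPoly →ₗ[ℚ] DiffPoly) ^ n) (a * b) =
      ∑ p ∈ Finset.HasAntidiagonal.antidiagonal n, n.choose p.1 •
        (((dx₀ : DiffPoly →ₗ[ℚ] DiffPoly) ^ p.1) a * ((dx₀ : DiffPoly →ₗ[ℚ] DiffPoly) ^ p.2) b) := by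
    induction n with
    | zero => simp
    | succ n ih =>
      rw [pow_succ', Module.End.mul_apply, ih, map_sum,
        Finset.sum_antidiagonal_choose_succ_nsmul (fun i j =>
          ((dx₀ : DiffPoly →ₗ[ℚ] DiffPoly) ^ i) a * ((dx₀ : DiffPoly →ₗ[ℚ] DiffPoly) ^ j) b),
        ← Finset.sum_add_distrib]
      refine Finset.sum_congr rfl fun p hp => ?_
      obtain rfl := Finset.HasAntidiagonal.mem_antidiagonal.1 hp
      rw [Nat.choose_symm_add, map_nsmul, Derivation.coeFn_coe, Derivation.leibniz, pow_succ',
        pow_succ', smul_eq_mul, smul_eq_mul, ← smul_add]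
      simp only [Module.End.mul_apply, Derivation.coeFn_coe]
      rw [mul_comm (dx₀ _)]
  rw [key, Finset.smul_sum]
  refine Finset.sum_congr rfl fun p hp => ?_
  rw [smul_mul_smul_comm, ← Nat.cast_smul_eq_nsmul ℚ, smul_smul]
  congr 1
  obtain rfl := Finset.HasAntidiagonal.mem_antidiagonal.1 hp
  rw [Nat.choose_symm_add, Nat.add_choose, Nat.cast_div (Nat.factorial_mul_factorial_dvd_factorial_add _ _)
    (by positivity)]
  have := Nat.factorial_ne_zero (p.1 + p.2)
  push_cast
  field_simp

theorem coeff_shift_C (s : ℚ) (a : DiffPoly) (n : ℕ) :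
    PowerSeries.coeff n (shift s (PowerSeries.C a)) =
      s ^ n • (n.factorial : ℚ)⁻¹ • ((dx₀ : DiffPoly →ₗ[ℚ] DiffPoly) ^ n) a := by
  rw [shift, coeff_opSeries_C, smul_smul]
  simp [PowerSeries.coeff_exp]

theorem shift_mul (s : ℚ) (f g : DiffAlg) : shift s (f * g) = shift s f * shift s g := by
  refine eps_mul_of_C (T := (shift s).toAddMonoidHom) (shift_X_mul s) (fun a b => ?_) f g
  change shift s _ = shift s _ * shift s _
  ext1 n
  rw [PowerSeries.coeff_mul, coeff_shift_C, dx_pow_mul_div, Finset.smul_sum]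
  refine Finset.sum_congr rfl fun p hp => ?_
  rw [coeff_shift_C, coeff_shift_C, smul_mul_smul_comm (s ^ p.1), ← pow_add,
    Finset.HasAntidiagonal.mem_antidiagonal.1 hp]

theorem shift_neg_apply (s : ℚ) (f : DiffAlg) : shift (-s) (shift s f) = f := by
  rw [← shift_add_apply, neg_add_cancel, shift_zero_apply]

theorem shift_apply_neg (s : ℚ) (f : DiffAlg) : shift s (shift (-s) f) = f := by
  rw [← shift_add_apply, add_neg_cancel, shift_zero_apply]

theorem shift_injective (s : ℚ) : Function.Injective (shift s) :=
  Function.LeftInverse.injective (shift_neg_apply s)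

theorem shift_dx (s : ℚ) (f : DiffAlg) : shift s (dx f) = dx (shift s f) := opSeries_dx _ f

theorem constantCoeff_exp_rescale (s : ℚ) :
    PowerSeries.constantCoeff (PowerSeries.rescale s (PowerSeries.exp ℚ)) = 1 := by
  rw [← PowerSeries.coeff_zero_eq_constantCoeff_apply]; simp

theorem shift_sub_mem (s : ℚ) (f : DiffAlg) : shift s f - f ∈ LinearMap.range dx := by
  have := opSeries_sub_mem (PowerSeries.rescale s (PowerSeries.exp ℚ)) f
  rwa [constantCoeff_exp_rescale, one_smul] at this

theorem shift_const_mul (s : ℚ) {c : DiffAlg} (hc : dx c = 0) (f : DiffAlg) :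
    shift s (c * f) = c * shift s f := opSeries_mul_const _ hc f

theorem shift_commute {T : DiffAlg →+ DiffAlg}
    (h : ∀ f, T (PowerSeries.X * f) = PowerSeries.X * T f) (h' : ∀ f, T (dx f) = dx (T f))
    (s : ℚ) (f : DiffAlg) : T (shift s f) = shift s (T f) := opSeries_commute h h' _ f

/-! ### The operators `∇` and `P` -/

theorem constantCoeff_sinhc : PowerSeries.constantCoeff sinhc = 1 := by
  rw [← PowerSeries.coeff_zero_eq_constantCoeff_apply, sinhc]
  simp [PowerSeries.coeff_exp]
  norm_num

theorem X_mul_sinhc : PowerSeries.X * sinhc = PowerSeries.rescale (1 / 2) (PowerSeries.exp ℚ) -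
    PowerSeries.rescale (-(1 / 2)) (PowerSeries.exp ℚ) := by
  ext n
  cases n with
  | zero =>
    rw [map_sub, PowerSeries.coeff_rescale, PowerSeries.coeff_rescale]
    simp
  | succ n => rw [PowerSeries.coeff_succ_X_mul, sinhc, PowerSeries.coeff_mk]

theorem nabla_eq (f : DiffAlg) : nabla f = opSeries sinhc (dx f) := rfl

theorem X_mul_nabla (f : DiffAlg) :
    PowerSeries.X * nabla f = shift (1 / 2) f - shift (-(1 / 2)) f := by
  rw [nabla_eq, ← opSeries_X_mul, ← opSeries_X, ← opSeries_mul, mul_comm, X_mul_sinhc, opSeries_sub]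
  rfl

theorem nabla_opP (f : DiffAlg) : nabla (opP f) = dx f := by
  rw [nabla_eq, opP, ← opSeries_dx, opSeries_inv _ (by simp [constantCoeff_sinhc])]

theorem opP_nabla (f : DiffAlg) : opP (nabla f) = dx f := by
  rw [nabla_eq, opP, opSeries_inv' _ (by simp [constantCoeff_sinhc])]

theorem dx_eq_zero_of_nabla {f : DiffAlg} (h : nabla f = 0) : dx f = 0 := by
  rw [← opP_nabla, h, map_zero]

theorem nabla_const {c : DiffAlg} (h : dx c = 0) : nabla c = 0 := by rw [nabla_eq, h, map_zero]

theorem nabla_const_mul {c : DiffAlg} (hc : dx c = 0) (f : DiffAlg) :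
    nabla (c * f) = c * nabla f := by
  rw [nabla_eq, dx_mul, hc, mul_zero, add_zero, opSeries_mul_const _ hc, nabla_eq]

theorem nabla_commute {T : DiffAlg →+ DiffAlg}
    (h : ∀ f, T (PowerSeries.X * f) = PowerSeries.X * T f) (h' : ∀ f, T (dx f) = dx (T f))
    (f : DiffAlg) : T (nabla f) = nabla (T f) := by
  rw [nabla_eq, opSeries_commute h h', h', nabla_eq]

theorem opP_sub_mem (f : DiffAlg) : opP f - f ∈ LinearMap.range dx := by
  have := opSeries_sub_mem sinhc⁻¹ f
  rwa [PowerSeries.constantCoeff_inv, constantCoeff_sinhc, inv_one, one_smul] at this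

theorem opP_X_mul (f : DiffAlg) : opP (PowerSeries.X * f) = PowerSeries.X * opP f :=
  opSeries_X_mul _ f

theorem X_ne_zero : (PowerSeries.X : DiffAlg) ≠ 0 := PowerSeries.X_ne_zero

theorem X_mul_cancel {f g : DiffAlg} (h : (PowerSeries.X : DiffAlg) * f = PowerSeries.X * g) :
    f = g := mul_left_cancel₀ X_ne_zero h

/-- The hypothesis says ε∇f = 0; here ε is not a zero divisor, and ∂ = P∇. -/
theorem dx_eq_zero_of_shift {f : DiffAlg} (h : shift (1 / 2) f = shift (-(1 / 2)) f) :
    dx f = 0 := by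
  refine dx_eq_zero_of_nabla (X_mul_cancel ?_)
  rw [X_mul_nabla, h, sub_self, mul_zero]

/-! ### The ring of difference operators which are bounded above -/

/-- `A` has order at most `n`. -/
def OrdLE (A : DiffOp) (n : ℤ) : Prop := ∀ k, n < k → A k = 0

theorem OrdLE.mono {A : DiffOp} {m n : ℤ} (h : OrdLE A m) (hmn : m ≤ n) : OrdLE A n :=
  fun k hk => h k (lt_of_le_of_lt hmn hk)

theorem OrdLE.add {A B : DiffOp} {n : ℤ} (hA : OrdLE A n) (hB : OrdLE B n) : OrdLE (A + B) n :=
  fun k hk => by rw [Pi.add_apply, hA k hk, hB k hk, add_zero]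

theorem OrdLE.neg {A : DiffOp} {n : ℤ} (hA : OrdLE A n) : OrdLE (-A) n :=
  fun k hk => by rw [Pi.neg_apply, hA k hk, neg_zero]

theorem OrdLE.sub {A B : DiffOp} {n : ℤ} (hA : OrdLE A n) (hB : OrdLE B n) : OrdLE (A - B) n :=
  fun k hk => by rw [Pi.sub_apply, hA k hk, hB k hk, sub_zero]

theorem ordLE_zero (n : ℤ) : OrdLE 0 n := fun _ _ => rfl

theorem OrdLE.pred {A : DiffOp} {n : ℤ} (h : OrdLE A n) (h' : A n = 0) : OrdLE A (n - 1) :=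
  fun k hk => by
    rcases eq_or_lt_of_le (show n ≤ k by omega) with rfl | h''
    · exact h'
    · exact h k h''

theorem ordLE_single (n : ℤ) (f : DiffAlg) : OrdLE (Pi.single n f) n :=
  fun _ hk => Pi.single_eq_of_ne (ne_of_gt hk) _

theorem eq_zero_of_ordLE {A : DiffOp} {n : ℤ} (h : OrdLE A n)
    (h' : ∀ m : ℤ, m ≤ n → OrdLE A m → A m = 0) : A = 0 := by
  have key : ∀ j : ℕ, OrdLE A (n - j) := by
    intro j
    induction j with
    | zero => simpa using h
    | succ j ih =>
      have := ih.pred (h' _ (by omega) ih)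
      rwa [sub_sub] at this
  funext k
  exact key ((n - k).toNat + 1) k (by push_cast; omega)

/-- Any finite set containing the window [k − b, a] may serve as index set, so that several products
can be compared over a common one. -/
theorem opMul_eq_sum {A B : DiffOp} {a b : ℤ} (hA : OrdLE A a) (hB : OrdLE B b) (k : ℤ)
    (s : Finset ℤ) (hs : Finset.Icc (k - b) a ⊆ s) :
    opMul A B k = ∑ i ∈ s, shift (-((k - i : ℤ) : ℚ) / 2) (A i) * shift ((i : ℚ) / 2) (B (k - i)) := by
  refine finsum_eq_sum_of_support_subset _ fun i hi => hs ?_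
  rw [Finset.mem_Icc]
  by_contra h
  refine hi ?_
  by_cases h1 : a < i
  · simp [hA i h1]
  · simp [hB (k - i) (by omega)]

theorem OrdLE.mul {A B : DiffOp} {a b : ℤ} (hA : OrdLE A a) (hB : OrdLE B b) :
    OrdLE (opMul A B) (a + b) := by
  intro k hk
  rw [opMul_eq_sum hA hB k _ subset_rfl, Finset.Icc_eq_empty (by omega), Finset.sum_empty]

theorem opMul_lead {A B : DiffOp} {a b : ℤ} (hA : OrdLE A a) (hB : OrdLE B b) :
    opMul A B (a + b) = shift (-(b : ℚ) / 2) (A a) * shift ((a : ℚ) / 2) (B b) := by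
  rw [opMul_eq_sum hA hB (a + b) {a} (by simp), Finset.sum_singleton, add_sub_cancel_left]

/-- For terms of degrees i, j, l either bracketing shifts the three coefficients by −(j+l)/2,
(i−l)/2 and (i+j)/2. -/
theorem opMul_assoc {A B C : DiffOp} {a b c : ℤ} (hA : OrdLE A a) (hB : OrdLE B b)
    (hC : OrdLE C c) : opMul (opMul A B) C = opMul A (opMul B C) := by
  funext k
  set s := Finset.Icc (k - b - c) a
  set t := Finset.Icc (k - c) (a + b)
  rw [opMul_eq_sum (hA.mul hB) hC k t subset_rfl,
    opMul_eq_sum hA (hB.mul hC) k s (Finset.Icc_subset_Icc (by omega) le_rfl)]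
  have h1 : ∀ m ∈ t, opMul A B m = ∑ i ∈ s,
      shift (-((m - i : ℤ) : ℚ) / 2) (A i) * shift ((i : ℚ) / 2) (B (m - i)) := fun m hm =>
    opMul_eq_sum hA hB m s (Finset.Icc_subset_Icc (by
      have := Finset.mem_Icc.1 hm; omega) le_rfl)
  have h2 : ∀ i ∈ s, opMul B C (k - i) = ∑ m ∈ t,
      shift (-((k - m : ℤ) : ℚ) / 2) (B (m - i)) * shift (((m - i : ℤ) : ℚ) / 2) (C (k - m)) := by
    intro i hi
    -- The inner sum is indexed by the joint degree m of the first two factors, so its range does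
    -- not depend on i and the two sums can be exchanged.
    rw [opMul, ← finsum_comp_equiv (Equiv.subRight i)]
    simp only [Equiv.subRight_apply, sub_sub_sub_cancel_right]
    refine finsum_eq_sum_of_support_subset _ fun m hm => ?_
    rw [Finset.mem_coe, Finset.mem_Icc]
    have := Finset.mem_Icc.1 hi
    by_contra h
    refine hm ?_
    by_cases h1 : b < m - i
    · simp [hB _ h1]
    · simp [hC (k - m) (by omega)]
  have e1 : ∀ m ∈ t, shift (-((k - m : ℤ) : ℚ) / 2) (opMul A B m) * shift ((m : ℚ) / 2) (C (k - m)) =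
      shift (-((k - m : ℤ) : ℚ) / 2) (∑ i ∈ s, shift (-((m - i : ℤ) : ℚ) / 2) (A i) *
        shift ((i : ℚ) / 2) (B (m - i))) * shift ((m : ℚ) / 2) (C (k - m)) :=
    fun m hm => by rw [h1 m hm]
  have e2 : ∀ i ∈ s, shift (-((k - i : ℤ) : ℚ) / 2) (A i) * shift ((i : ℚ) / 2) (opMul B C (k - i)) =
      shift (-((k - i : ℤ) : ℚ) / 2) (A i) * shift ((i : ℚ) / 2) (∑ m ∈ t,
        shift (-((k - m : ℤ) : ℚ) / 2) (B (m - i)) * shift (((m - i : ℤ) : ℚ) / 2) (C (k - m))) :=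
    fun i hi => by rw [h2 i hi]
  rw [Finset.sum_congr rfl e1, Finset.sum_congr rfl e2]
  simp only [map_sum, shift_mul, Finset.sum_mul, Finset.mul_sum]
  rw [Finset.sum_comm]
  refine Finset.sum_congr rfl fun i _ => Finset.sum_congr rfl fun m _ => ?_
  simp only [← shift_add_apply]
  rw [mul_assoc]
  have q1 : -((k - m : ℤ) : ℚ) / 2 + -((m - i : ℤ) : ℚ) / 2 = -((k - i : ℤ) : ℚ) / 2 := by
    push_cast; ring
  have q2 : -((k - m : ℤ) : ℚ) / 2 + (i : ℚ) / 2 = (i : ℚ) / 2 + -((k - m : ℤ) : ℚ) / 2 := by ring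
  have q3 : (m : ℚ) / 2 = (i : ℚ) / 2 + ((m - i : ℤ) : ℚ) / 2 := by push_cast; ring
  rw [q1, q2, ← q3]

theorem opMul_add_left {A A' B : DiffOp} {a b : ℤ} (hA : OrdLE A a) (hA' : OrdLE A' a)
    (hB : OrdLE B b) : opMul (A + A') B = opMul A B + opMul A' B := by
  funext k
  rw [Pi.add_apply, opMul_eq_sum hA hB k _ subset_rfl, opMul_eq_sum hA' hB k _ subset_rfl,
    opMul_eq_sum (hA.add hA') hB k _ subset_rfl]
  simp [add_mul, Finset.sum_add_distrib]

theorem opMul_add_right {A B B' : DiffOp} {a b : ℤ} (hA : OrdLE A a) (hB : OrdLE B b)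
    (hB' : OrdLE B' b) : opMul A (B + B') = opMul A B + opMul A B' := by
  funext k
  rw [Pi.add_apply, opMul_eq_sum hA hB k _ subset_rfl, opMul_eq_sum hA hB' k _ subset_rfl,
    opMul_eq_sum hA (hB.add hB') k _ subset_rfl]
  simp [mul_add, Finset.sum_add_distrib]

theorem single_opMul (m : ℤ) (f : DiffAlg) (B : DiffOp) (k : ℤ) :
    opMul (Pi.single m f) B k =
      shift (-((k - m : ℤ) : ℚ) / 2) f * shift ((m : ℚ) / 2) (B (k - m)) := by
  rw [opMul, finsum_eq_single _ m]
  · simp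
  · intro i hi; simp [Pi.single_eq_of_ne hi]

theorem opMul_single (m : ℤ) (f : DiffAlg) (A : DiffOp) (k : ℤ) :
    opMul A (Pi.single m f) k =
      shift (-(m : ℚ) / 2) (A (k - m)) * shift (((k - m : ℤ) : ℚ) / 2) f := by
  rw [opMul, finsum_eq_single _ (k - m)]
  · simp
  · intro i hi
    rw [Pi.single_eq_of_ne (show k - i ≠ m by omega), map_zero, mul_zero]

theorem opOne_opMul (A : DiffOp) : opMul opOne A = A := by
  funext k
  rw [opOne, single_opMul]
  simp [shift_one_apply, shift_zero_apply]

theorem opMul_opOne (A : DiffOp) : opMul A opOne = A := by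
  funext k
  rw [opOne, opMul_single]
  simp [shift_one_apply, shift_zero_apply]

/-- The operators bounded above. -/
@[ext]
structure Op : Type where
  val : DiffOp
  bdd : ∃ n, OrdLE val n

namespace Op

theorem val_injective : Function.Injective Op.val := fun _ _ h => Op.ext h

instance : Zero Op := ⟨⟨0, 0, ordLE_zero 0⟩⟩

instance : Add Op :=
  ⟨fun A B => ⟨A.1 + B.1, by
    obtain ⟨m, hA⟩ := A.2
    obtain ⟨n, hB⟩ := B.2
    exact ⟨max m n, (hA.mono (le_max_left _ _)).add (hB.mono (le_max_right _ _))⟩⟩⟩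

instance : Neg Op := ⟨fun A => ⟨-A.1, A.2.imp fun _ h => h.neg⟩⟩

instance : Sub Op :=
  ⟨fun A B => ⟨A.1 - B.1, by
    obtain ⟨m, hA⟩ := A.2
    obtain ⟨n, hB⟩ := B.2
    exact ⟨max m n, (hA.mono (le_max_left _ _)).sub (hB.mono (le_max_right _ _))⟩⟩⟩

theorem ordLE_smul {S : Type*} [SMulZeroClass S DiffAlg] (r : S) {A : DiffOp} {n : ℤ}
    (h : OrdLE A n) : OrdLE (r • A) n := fun k hk => by rw [Pi.smul_apply, h k hk, smul_zero]

instance : SMul ℕ Op := ⟨fun r A => ⟨r • A.1, A.2.imp fun _ h => ordLE_smul r h⟩⟩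

instance : SMul ℤ Op := ⟨fun r A => ⟨r • A.1, A.2.imp fun _ h => ordLE_smul r h⟩⟩

instance : SMul ℚ Op := ⟨fun r A => ⟨r • A.1, A.2.imp fun _ h => ordLE_smul r h⟩⟩

instance : AddCommGroup Op :=
  val_injective.addCommGroup _ rfl (fun _ _ => rfl) (fun _ => rfl) (fun _ _ => rfl)
    (fun _ _ => rfl) fun _ _ => rfl

instance : Module ℚ Op :=
  val_injective.module ℚ ⟨⟨Op.val, rfl⟩, fun _ _ => rfl⟩ fun _ _ => rfl

end Op

theorem Op.ext' {A B : Op} (h : ∀ k, A.1 k = B.1 k) : A = B := Op.ext (funext h)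

instance : Mul Op :=
  ⟨fun A B => ⟨opMul A.1 B.1, by
    obtain ⟨a, ha⟩ := A.2
    obtain ⟨b, hb⟩ := B.2
    exact ⟨a + b, ha.mul hb⟩⟩⟩

instance : One Op := ⟨⟨opOne, 0, ordLE_single 0 1⟩⟩

theorem Op.mul_val (A B : Op) : (A * B).1 = opMul A.1 B.1 := rfl

theorem Op.add_apply (A B : Op) (k : ℤ) : (A + B).1 k = A.1 k + B.1 k := rfl

theorem Op.sub_apply (A B : Op) (k : ℤ) : (A - B).1 k = A.1 k - B.1 k := rfl

theorem Op.neg_apply (A : Op) (k : ℤ) : (-A).1 k = -A.1 k := rfl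

theorem Op.zero_apply (k : ℤ) : (0 : Op).1 k = 0 := rfl

theorem Op.smul_apply (r : ℚ) (A : Op) (k : ℤ) : (r • A).1 k = r • A.1 k := rfl

theorem Op.one_val : (1 : Op).1 = opOne := rfl

/-- The coefficient of `Λ^k`. -/
def Op.coeff (k : ℤ) : Op →ₗ[ℚ] DiffAlg where
  toFun A := A.1 k
  map_add' _ _ := rfl
  map_smul' _ _ := rfl

theorem exists_common_bound (A B : Op) : ∃ n, OrdLE A.1 n ∧ OrdLE B.1 n := by
  obtain ⟨a, ha⟩ := A.2
  obtain ⟨b, hb⟩ := B.2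
  exact ⟨max a b, ha.mono (le_max_left _ _), hb.mono (le_max_right _ _)⟩

instance : Ring Op where
  __ := (inferInstance : AddCommGroup Op)
  left_distrib A B C := by
    obtain ⟨a, ha⟩ := A.2
    obtain ⟨b, hb, hc⟩ := exists_common_bound B C
    exact Op.ext (opMul_add_right ha hb hc)
  right_distrib A B C := by
    obtain ⟨c, hc⟩ := C.2
    obtain ⟨b, ha, hb⟩ := exists_common_bound A B
    exact Op.ext (opMul_add_left ha hb hc)
  zero_mul A := by
    refine Op.ext' fun k => ?_
    change opMul 0 A.1 k = 0
    simp [opMul]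
  mul_zero A := by
    refine Op.ext' fun k => ?_
    change opMul A.1 0 k = 0
    simp [opMul]
  mul_assoc A B C := by
    obtain ⟨a, ha⟩ := A.2
    obtain ⟨b, hb⟩ := B.2
    obtain ⟨c, hc⟩ := C.2
    exact Op.ext (opMul_assoc ha hb hc)
  one_mul A := Op.ext (opOne_opMul A.1)
  mul_one A := Op.ext (opMul_opOne A.1)

theorem Op.pow_val (A : Op) (n : ℕ) : (A ^ n).1 = opPow A.1 n := by
  induction n with
  | zero => rfl
  | succ n ih => rw [pow_succ, Op.mul_val, ih, opPow]

theorem Op.comm_val (A B : Op) : (A * B - B * A).1 = opComm A.1 B.1 := rfl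

theorem Op.sum_apply {ι : Type*} (s : Finset ι) (A : ι → Op) (k : ℤ) :
    (∑ i ∈ s, A i).1 k = ∑ i ∈ s, (A i).1 k := map_sum (Op.coeff k) A s

/-- The operator `f Λ^n`. -/
def Op.mono (n : ℤ) (f : DiffAlg) : Op := ⟨Pi.single n f, n, ordLE_single n f⟩

/-- `A` has order at most `n`. -/
def Op.Le (A : Op) (n : ℤ) : Prop := OrdLE A.1 n

theorem Op.mono_le (n : ℤ) (f : DiffAlg) : (Op.mono n f).Le n := ordLE_single n f

theorem Op.Le.trans {A : Op} {m n : ℤ} (h : A.Le m) (hmn : m ≤ n) : A.Le n := OrdLE.mono h hmn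

theorem Op.Le.add {A B : Op} {n : ℤ} (hA : A.Le n) (hB : B.Le n) : (A + B).Le n := OrdLE.add hA hB

theorem Op.Le.sub {A B : Op} {n : ℤ} (hA : A.Le n) (hB : B.Le n) : (A - B).Le n := OrdLE.sub hA hB

theorem Op.Le.neg {A : Op} {n : ℤ} (hA : A.Le n) : (-A).Le n := OrdLE.neg hA

theorem Op.Le.mul {A B : Op} {a b : ℤ} (hA : A.Le a) (hB : B.Le b) : (A * B).Le (a + b) :=
  OrdLE.mul hA hB

theorem Op.mul_lead {A B : Op} {a b : ℤ} (hA : A.Le a) (hB : B.Le b) :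
    (A * B).1 (a + b) = shift (-(b : ℚ) / 2) (A.1 a) * shift ((a : ℚ) / 2) (B.1 b) :=
  opMul_lead hA hB

theorem Op.zero_le (n : ℤ) : (0 : Op).Le n := ordLE_zero n

theorem Op.one_le : (1 : Op).Le 0 := ordLE_single 0 1

theorem Op.one_apply (k : ℤ) : (1 : Op).1 k = if k = 0 then 1 else 0 := by
  rw [Op.one_val, opOne, Pi.single_apply]

theorem Op.mono_apply (n : ℤ) (f : DiffAlg) (k : ℤ) :
    (Op.mono n f).1 k = if k = n then f else 0 := by
  exact Pi.single_apply n f k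

theorem Op.Le.pred {A : Op} {n : ℤ} (h : A.Le n) (h' : A.1 n = 0) : A.Le (n - 1) :=
  OrdLE.pred h h'

theorem Op.eq_zero_of_le {A : Op} {n : ℤ} (h : A.Le n)
    (h' : ∀ m : ℤ, m ≤ n → A.Le m → A.1 m = 0) : A = 0 :=
  Op.ext (eq_zero_of_ordLE h h')

theorem Op.mono_mul_apply (m : ℤ) (f : DiffAlg) (B : Op) (k : ℤ) : (Op.mono m f * B).1 k =
    shift (-((k - m : ℤ) : ℚ) / 2) f * shift ((m : ℚ) / 2) (B.1 (k - m)) :=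
  single_opMul m f B.1 k

theorem Op.mul_mono_apply (m : ℤ) (f : DiffAlg) (A : Op) (k : ℤ) : (A * Op.mono m f).1 k =
    shift (-(m : ℚ) / 2) (A.1 (k - m)) * shift (((k - m : ℤ) : ℚ) / 2) f :=
  opMul_single m f A.1 k

/-- `A` is monic of order `n`. -/
structure Op.Monic (A : Op) (n : ℤ) : Prop where
  le : A.Le n
  lead : A.1 n = 1

theorem Op.Monic.mul {A B : Op} {a b : ℤ} (hA : A.Monic a) (hB : B.Monic b) :
    (A * B).Monic (a + b) :=
  ⟨hA.le.mul hB.le, by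
    rw [Op.mul_lead hA.le hB.le, hA.lead, hB.lead, shift_one_apply, shift_one_apply, mul_one]⟩

theorem Op.monic_one : (1 : Op).Monic 0 := ⟨Op.one_le, by rw [Op.one_apply, if_pos rfl]⟩

theorem Op.Monic.pow {A : Op} {a : ℤ} (hA : A.Monic a) (n : ℕ) : (A ^ n).Monic (n * a) := by
  induction n with
  | zero => simpa using Op.monic_one
  | succ n ih =>
    rw [pow_succ]
    convert ih.mul hA using 1
    push_cast; ring

/-- Multiplication by constants. -/
def Op.const (c : DiffAlg) : Op := Op.mono 0 c

theorem Op.const_mul_apply {c : DiffAlg} (hc : dx c = 0) (A : Op) (k : ℤ) :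
    (Op.const c * A).1 k = c * A.1 k := by
  rw [Op.const, Op.mono_mul_apply, shift_const _ hc]
  simp [shift_zero_apply]

theorem Op.mul_const_apply {c : DiffAlg} (hc : dx c = 0) (A : Op) (k : ℤ) :
    (A * Op.const c).1 k = c * A.1 k := by
  rw [Op.const, Op.mul_mono_apply, shift_const _ hc, mul_comm]
  simp [shift_zero_apply]

theorem Op.const_comm {c : DiffAlg} (hc : dx c = 0) (A : Op) :
    Op.const c * A = A * Op.const c :=
  Op.ext' fun k => by rw [Op.const_mul_apply hc, Op.mul_const_apply hc]

/-! ### The trace -/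

/-- Densities which are total derivatives. -/
abbrev exact : Submodule ℚ DiffAlg := LinearMap.range dx

theorem const_mul_mem_exact {c f : DiffAlg} (hc : dx c = 0) (hf : f ∈ exact) : c * f ∈ exact := by
  obtain ⟨g, rfl⟩ := hf
  exact ⟨c * g, by rw [dx_mul, hc, mul_zero, add_zero]⟩

theorem mul_dx_add_mem (f g : DiffAlg) : f * dx g + g * dx f ∈ exact := ⟨f * g, dx_mul f g⟩

/-- The degree 0 terms of the two products are E^{i/2} and E^{-i/2} of the same function A_i B_{-i},
and a shift changes a density only by a total derivative. -/
theorem Op.mul_apply_zero_sub_mem (A B : Op) : (A * B).1 0 - (B * A).1 0 ∈ exact := by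
  obtain ⟨a, ha⟩ := A.2
  obtain ⟨b, hb⟩ := B.2
  have h1 := opMul_eq_sum ha hb 0 (Finset.Icc (-b) a) (by simp)
  have h2 : opMul B.1 A.1 0 = ∑ i ∈ Finset.Icc (-b) a, shift (-(i : ℚ) / 2) (A.1 i * B.1 (-i)) := by
    rw [opMul_eq_sum hb ha 0 (Finset.Icc (-a) b) (by simp)]
    refine Finset.sum_nbij' (fun i => -i) (fun i => -i) ?_ ?_ ?_ ?_ ?_
    · intro i hi; simp only [Finset.mem_Icc] at hi ⊢; omega
    · intro i hi; simp only [Finset.mem_Icc] at hi ⊢; omega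
    · intro i _; exact neg_neg i
    · intro i _; exact neg_neg i
    · intro i _
      rw [shift_mul, mul_comm]
      simp
  rw [Op.mul_val, Op.mul_val, h1, h2, ← Finset.sum_sub_distrib]
  refine Submodule.sum_mem _ fun i _ => ?_
  have := Submodule.sub_mem _ (shift_sub_mem ((i : ℚ) / 2) (A.1 i * B.1 (-i)))
    (shift_sub_mem (-(i : ℚ) / 2) (A.1 i * B.1 (-i)))
  rw [sub_sub_sub_cancel_right] at this
  rw [shift_mul] at this
  simpa using this

/-! ### Derivations -/

theorem dx_intCast (n : ℤ) : dx (n : DiffAlg) = 0 := by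
  rw [← zsmul_one, map_zsmul, dx_one, zsmul_zero]

/-- Coefficientwise application of an additive map. -/
def coeffwise (T : DiffAlg →+ DiffAlg) : Op →+ Op where
  toFun A := ⟨fun k => T (A.1 k), by
    obtain ⟨a, ha⟩ := A.2
    exact ⟨a, fun k hk => by change T (A.1 k) = 0; rw [ha k hk, map_zero]⟩⟩
  map_zero' := Op.ext' fun k => map_zero T
  map_add' A B := Op.ext' fun k => map_add T _ _

theorem coeffwise_apply (T : DiffAlg →+ DiffAlg) (A : Op) (k : ℤ) :
    (coeffwise T A).1 k = T (A.1 k) := rfl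

theorem coeffwise_le {T : DiffAlg →+ DiffAlg} {A : Op} {n : ℤ} (h : A.Le n) :
    (coeffwise T A).Le n := fun k hk => by rw [coeffwise_apply, h k hk, map_zero]

/-- The Leibniz rule. -/
def IsDer (d : Op →+ Op) : Prop := ∀ A B, d (A * B) = d A * B + A * d B

/-- Operator products involve only products and shifts of coefficients, so a derivation that
commutes with shifts satisfies the Leibniz rule. -/
theorem isDer_coeffwise {T : DiffAlg →+ DiffAlg} (h : ∀ f g, T (f * g) = f * T g + g * T f)
    (hs : ∀ s f, T (shift s f) = shift s (T f)) : IsDer (coeffwise T) := by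
  intro A B
  obtain ⟨a, ha⟩ := A.2
  obtain ⟨b, hb⟩ := B.2
  refine Op.ext' fun k => ?_
  rw [Op.add_apply, coeffwise_apply, Op.mul_val, Op.mul_val, Op.mul_val,
    opMul_eq_sum ha hb k _ subset_rfl,
    opMul_eq_sum (A := (coeffwise T A).1) (coeffwise_le ha) hb k _ subset_rfl,
    opMul_eq_sum (B := (coeffwise T B).1) ha (coeffwise_le hb) k _ subset_rfl, map_sum,
    ← Finset.sum_add_distrib]
  refine Finset.sum_congr rfl fun i _ => ?_
  rw [h, hs, hs, coeffwise_apply, coeffwise_apply]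
  ring

/-- The derivation `N (a Λ^k) = k a Λ^k`. -/
def grade : Op →+ Op where
  toFun A := ⟨fun k => (k : DiffAlg) * A.1 k, by
    obtain ⟨a, ha⟩ := A.2
    exact ⟨a, fun k hk => by change (k : DiffAlg) * A.1 k = 0; rw [ha k hk, mul_zero]⟩⟩
  map_zero' := Op.ext' fun k => mul_zero _
  map_add' A B := Op.ext' fun k => mul_add _ _ _

theorem grade_apply (A : Op) (k : ℤ) : (grade A).1 k = k * A.1 k := rfl

theorem grade_le {A : Op} {n : ℤ} (h : A.Le n) : (grade A).Le n := fun k hk => by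
  rw [grade_apply, h k hk, mul_zero]

theorem isDer_grade : IsDer grade := by
  intro A B
  obtain ⟨a, ha⟩ := A.2
  obtain ⟨b, hb⟩ := B.2
  refine Op.ext' fun k => ?_
  rw [Op.add_apply, grade_apply, Op.mul_val, Op.mul_val, Op.mul_val,
    opMul_eq_sum ha hb k _ subset_rfl,
    opMul_eq_sum (A := (grade A).1) (grade_le ha) hb k _ subset_rfl,
    opMul_eq_sum (B := (grade B).1) ha (grade_le hb) k _ subset_rfl, Finset.mul_sum,
    ← Finset.sum_add_distrib]
  refine Finset.sum_congr rfl fun i _ => ?_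
  rw [grade_apply, grade_apply, shift_const_mul _ (dx_intCast _), shift_const_mul _ (dx_intCast _)]
  push_cast
  ring

theorem IsDer.one {d : Op →+ Op} (h : IsDer d) : d 1 = 0 := by
  have := h 1 1
  simpa using this

theorem IsDer.ad (A : Op) : IsDer (AddMonoidHom.mulLeft A - AddMonoidHom.mulRight A) := by
  intro X Y
  simp only [AddMonoidHom.sub_apply, AddMonoidHom.coe_mulLeft, AddMonoidHom.coe_mulRight]
  noncomm_ring

theorem IsDer.sub {d d' : Op →+ Op} (h : IsDer d) (h' : IsDer d') : IsDer (d - d') := by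
  intro X Y
  simp only [AddMonoidHom.sub_apply, h X Y, h' X Y]
  noncomm_ring

theorem IsDer.comm {d : Op →+ Op} (h : IsDer d) (A B : Op) :
    d (A * B - B * A) = (d A * B - B * d A) + (A * d B - d B * A) := by
  rw [map_sub, h, h]; abel

theorem IsDer.pow_eq_zero {d : Op →+ Op} (h : IsDer d) {A : Op} (hA : d A = 0) (n : ℕ) :
    d (A ^ n) = 0 := by
  induction n with
  | zero => rw [pow_zero, h.one]
  | succ n ih => rw [pow_succ, h, ih, hA, zero_mul, mul_zero, add_zero]

/-! ### Leading coefficients of powers -/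

/-- The power series `(e^{kt/2} - e^{-kt/2}) / (e^{t/2} - e^{-t/2})`. -/
def powSeries : ℕ → PowerSeries ℚ
  | 0 => 0
  | k + 1 => PowerSeries.rescale (1 / 2) (PowerSeries.exp ℚ) * powSeries k +
      PowerSeries.rescale (-(k : ℚ) / 2) (PowerSeries.exp ℚ)

theorem constantCoeff_powSeries (k : ℕ) : PowerSeries.constantCoeff (powSeries k) = k := by
  induction k with
  | zero => simp [powSeries]
  | succ k ih =>
    rw [powSeries, map_add, map_mul, ih, constantCoeff_exp_rescale, constantCoeff_exp_rescale]
    push_cast; ring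

/-- The leading coefficient of a sum `∑ A^i D C_{k-1-i}` for monic operators. -/
theorem lead_of_recursion {A D : Op} {C Y : ℕ → Op} {m : ℤ} (hA : A.Monic 1)
    (hC : ∀ k, (C k).Monic k) (hD : D.Le m) (h0 : Y 0 = 0)
    (hY : ∀ k, Y (k + 1) = A * Y k + D * C k) (k : ℕ) :
    (Y k).Le (k - 1 + m) ∧ (Y k).1 (k - 1 + m) = opSeries (powSeries k) (D.1 m) := by
  induction k with
  | zero =>
    rw [h0]
    refine ⟨Op.zero_le _, ?_⟩
    rw [Op.zero_apply, powSeries, ← map_zero (PowerSeries.C (R := ℚ)), opSeries_C, zero_smul]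
  | succ k ih =>
    have e : ((k + 1 : ℕ) : ℤ) - 1 + m = 1 + (k - 1 + m) := by push_cast; ring
    have e' : ((k + 1 : ℕ) : ℤ) - 1 + m = m + k := by push_cast; ring
    have h1 := hA.le.mul ih.1
    have h2 := hD.mul (hC k).le
    rw [← e] at h1
    rw [← e'] at h2
    refine ⟨by rw [hY]; exact h1.add h2, ?_⟩
    rw [hY, Op.add_apply]
    have e1 := Op.mul_lead hA.le ih.1
    have e2 := Op.mul_lead hD (hC k).le
    rw [← e] at e1
    rw [← e'] at e2
    -- A leading Λ on the left applies E^{1/2} to the leading coefficient, and Λ^k on the right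
    -- applies E^{-k/2}: this is the recursion defining `powSeries`.
    rw [e1, e2, hA.lead, (hC k).lead, ih.2,
      shift_one_apply, shift_one_apply, one_mul, mul_one, powSeries, opSeries_add, opSeries_mul]
    simp [shift]

theorem opSeries_powSeries_injective {k : ℕ} (hk : k ≠ 0) {f : DiffAlg}
    (h : opSeries (powSeries k) f = 0) : f = 0 := by
  rw [← opSeries_inv' (powSeries k) (by rw [constantCoeff_powSeries]; exact_mod_cast hk) f, h,
    map_zero]

/-! ### The operator `K - τε∂` -/

/-- The operator `K = Λ + v + qΛ⁻¹`. -/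
def kOp : Op := Op.mono 1 1 + Op.mono 0 (field 0) + Op.mono (-1) (qpow 1)

theorem kOp_monic : kOp.Monic 1 := by
  refine ⟨((Op.mono_le _ _).add ((Op.mono_le _ _).trans (by norm_num))).add
    ((Op.mono_le _ _).trans (by norm_num)), ?_⟩
  simp [kOp, Op.add_apply, Op.mono_apply]

/-- The map `f ↦ ετ ∂f`. -/
def epsTauDx : DiffAlg →+ DiffAlg :=
  (AddMonoidHom.mulLeft (PowerSeries.X * tau)).comp dx.toAddMonoidHom

theorem epsTauDx_apply (f : DiffAlg) : epsTauDx f = PowerSeries.X * (tau * dx f) :=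
  mul_assoc _ _ _

theorem isDer_epsTauDx : IsDer (coeffwise epsTauDx) := by
  refine isDer_coeffwise (fun f g => ?_) fun s f => ?_
  · simp only [epsTauDx_apply, dx_mul]; ring
  · rw [epsTauDx_apply, epsTauDx_apply, shift_X_mul, shift_const_mul _ dx_tau, shift_dx]

/-- The derivation `X ↦ [K, X] - ετ ∂X`. -/
def adA : Op →+ Op :=
  (AddMonoidHom.mulLeft kOp - AddMonoidHom.mulRight kOp) - coeffwise epsTauDx

theorem adA_apply (X : Op) : adA X = (kOp * X - X * kOp) - coeffwise epsTauDx X := rfl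

theorem isDer_adA : IsDer adA := (IsDer.ad kOp).sub isDer_epsTauDx

theorem adA_coeff (X : Op) (k : ℤ) : (adA X).1 k = PowerSeries.X * nabla (X.1 (k - 1)) +
    (shift (-(k : ℚ) / 2) (field 0) - shift ((k : ℚ) / 2) (field 0)) * X.1 k +
    (shift (-((k : ℚ) + 1) / 2) (qpow 1) * shift (-(1 / 2)) (X.1 (k + 1)) -
      shift (1 / 2) (X.1 (k + 1)) * shift (((k : ℚ) + 1) / 2) (qpow 1)) -
    PowerSeries.X * (tau * dx (X.1 k)) := by
  rw [adA_apply, Op.sub_apply, Op.sub_apply, coeffwise_apply, epsTauDx_apply, X_mul_nabla, kOp,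
    add_mul, add_mul, mul_add, mul_add]
  simp only [Op.add_apply, Op.mono_mul_apply, Op.mul_mono_apply, shift_one_apply]
  push_cast
  simp only [sub_neg_eq_add, neg_neg, sub_zero, zero_div, neg_zero, shift_zero_apply, one_mul,
    mul_one, neg_div]
  ring

/-- In degree 0 the commutator with v drops out, the two q terms are the half shifts of a single
product, and τ∂ = τ∇P. This is the origin of the expression defining the constants of motion. -/
theorem adA_coeff_zero (X : Op) : (adA X).1 0 =
    PowerSeries.X * nabla (X.1 (-1) - qpow 1 * X.1 1 - tau * opP (X.1 0)) := by
  rw [adA_coeff, map_sub, map_sub, nabla_const_mul dx_tau, nabla_opP, mul_sub, mul_sub,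
    X_mul_nabla (qpow 1 * _), shift_mul, shift_mul]
  simp [neg_div]
  ring

/-- One degree above the leading term, only [Λ, ·] contributes, and it contributes ε∇ of the leading
coefficient. -/
theorem dx_lead_of_adA {X : Op} {m : ℤ} (hX : X.Le m) (h : adA X = 0) : dx (X.1 m) = 0 := by
  have h1 := adA_coeff X (m + 1)
  rw [h, hX (m + 1) (by omega), hX (m + 1 + 1) (by omega), Op.zero_apply] at h1
  simp only [map_zero, mul_zero, zero_mul, sub_zero, add_zero, add_sub_cancel_right] at h1
  exact dx_eq_zero_of_nabla (X_mul_cancel (by rw [mul_zero, ← h1]))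

/-! ### Operators determined by their constants of motion -/

/-- The expression `p_{-1}(k) - q p_1(k) - t P p_0(k)` for `L^k = ∑ p_j(k) Λ^j`. -/
def motion (t : DiffAlg) (L : Op) (k : ℕ) : DiffAlg :=
  (L ^ k).1 (-1) - qpow 1 * (L ^ k).1 1 - t * opP ((L ^ k).1 0)

/-- Telescoping: A^{k+1} − B^{k+1} = A(A^k − B^k) + (A − B)B^k. -/
theorem pow_sub_pow_lead {A B : Op} (hA : A.Monic 1) (hB : B.Monic 1) {m : ℤ}
    (h : (A - B).Le m) (k : ℕ) : (A ^ k - B ^ k).Le (k - 1 + m) ∧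
      (A ^ k - B ^ k).1 (k - 1 + m) = opSeries (powSeries k) ((A - B).1 m) := by
  refine lead_of_recursion (Y := fun k => A ^ k - B ^ k) (C := fun k => B ^ k) hA
    (fun k => by simpa using hB.pow k) h (by simp) (fun k => ?_) k
  simp only [pow_succ']
  noncomm_ring

/-- A change of order −k in the operator changes its k-th power from order −1 downwards only. So p_0
and p_1 are unaffected and p_{-1} moves by the leading term. -/
theorem motion_sub {A B : Op} (hA : A.Monic 1) (hB : B.Monic 1) (t : DiffAlg) {k : ℕ}
    (h : (A - B).Le (-k)) :
    motion t A k - motion t B k = opSeries (powSeries k) ((A - B).1 (-k)) := by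
  obtain ⟨h1, h2⟩ := pow_sub_pow_lead hA hB h k
  rw [show (k : ℤ) - 1 + -k = -1 by ring] at h1 h2
  have h3 : (A ^ k).1 0 = (B ^ k).1 0 := sub_eq_zero.1 (h1 0 (by norm_num))
  have h4 : (A ^ k).1 1 = (B ^ k).1 1 := sub_eq_zero.1 (h1 1 (by norm_num))
  rw [← h2, motion, motion, h3, h4, Op.sub_apply]
  ring

theorem motion_congr {A B : Op} (hA : A.Monic 1) (hB : B.Monic 1) (t : DiffAlg) {k : ℕ}
    (h : (A - B).Le (-(k + 1))) : motion t A k = motion t B k := by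
  rw [← sub_eq_zero, motion_sub hA hB t (h.trans (by omega)), h (-k) (by omega), map_zero]

/-- The system is triangular: once all coefficients above Λ^{-k} agree, the k-th constant of motion
determines the next one, since `powSeries k` has constant term k ≠ 0. -/
theorem eq_of_motion {A B : Op} (hA : A.Monic 1) (hB : B.Monic 1) (t : DiffAlg)
    (h0 : A.1 0 = B.1 0) (h : ∀ k : ℕ, 0 < k → motion t A k = motion t B k) : A = B := by
  rw [← sub_eq_zero]
  have h1 : (A - B).Le (-1) := by
    have h2 : (A - B).Le (1 - 1) :=
      (hA.le.sub hB.le).pred (by rw [Op.sub_apply, hA.lead, hB.lead, sub_self])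
    exact Op.Le.pred (n := 0) (by simpa using h2) (by rw [Op.sub_apply, h0, sub_self])
  refine Op.eq_zero_of_le h1 fun m hm hle => ?_
  obtain ⟨k, rfl⟩ : ∃ k : ℕ, m = -k := ⟨(-m).toNat, by omega⟩
  have hk : 0 < k := by omega
  have h3 := motion_sub hA hB t hle
  rw [h k hk, sub_self] at h3
  exact opSeries_powSeries_injective hk.ne' h3.symm

/-- Approximations to the operator with prescribed constants of motion. -/
def motionApprox (f t : DiffAlg) (c : ℕ → DiffAlg) : ℕ → Op
  | 0 => Op.mono 1 1 + Op.mono 0 f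
  | n + 1 => motionApprox f t c n + Op.mono (-(n + 1)) (opSeries (powSeries (n + 1))⁻¹
      (c (n + 1) - motion t (motionApprox f t c n) (n + 1)))

theorem motionApprox_sub_le (f t : DiffAlg) (c : ℕ → DiffAlg) (n m : ℕ) :
    (motionApprox f t c (n + m) - motionApprox f t c n).Le (-(n + 1)) := by
  induction m with
  | zero => simpa using Op.zero_le _
  | succ m ih =>
    rw [← add_assoc, motionApprox, add_sub_right_comm]
    exact ih.add ((Op.mono_le _ _).trans (by omega))

theorem motionApprox_monic (f t : DiffAlg) (c : ℕ → DiffAlg) (n : ℕ) :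
    (motionApprox f t c n).Monic 1 ∧ (motionApprox f t c n).1 0 = f := by
  have h0 : (motionApprox f t c 0).Monic 1 := by
    refine ⟨(Op.mono_le _ _).add ((Op.mono_le _ _).trans (by norm_num)), ?_⟩
    simp [motionApprox, Op.add_apply, Op.mono_apply]
  have h1 := motionApprox_sub_le f t c 0 n
  rw [zero_add] at h1
  have h2 : ∀ k : ℤ, 0 ≤ k → (motionApprox f t c n).1 k = (motionApprox f t c 0).1 k :=
    fun k hk => sub_eq_zero.1 (h1 k (by push_cast; omega))
  refine ⟨⟨fun k hk => by rw [h2 k (by omega)]; exact h0.le k hk, by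
    rw [h2 1 (by norm_num)]; exact h0.lead⟩, ?_⟩
  rw [h2 0 le_rfl]
  simp [motionApprox, Op.add_apply, Op.mono_apply]

theorem motion_motionApprox (f t : DiffAlg) (c : ℕ → DiffAlg) (n : ℕ) :
    motion t (motionApprox f t c (n + 1)) (n + 1) = c (n + 1) := by
  have h := motion_sub (motionApprox_monic f t c (n + 1)).1 (motionApprox_monic f t c n).1 t
    (k := n + 1) (by simpa using motionApprox_sub_le f t c n 1)
  have h2 : (motionApprox f t c (n + 1) - motionApprox f t c n).1 (-(n + 1 : ℕ)) =
      opSeries (powSeries (n + 1))⁻¹ (c (n + 1) - motion t (motionApprox f t c n) (n + 1)) := by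
    rw [motionApprox, add_sub_cancel_left, Op.mono_apply, if_pos (by push_cast; ring)]
  rw [h2, opSeries_inv _ (by rw [constantCoeff_powSeries]; positivity)] at h
  exact sub_left_injective h

theorem exists_motion (f t : DiffAlg) (c : ℕ → DiffAlg) : ∃ L : Op, L.Monic 1 ∧ L.1 0 = f ∧
    ∀ k : ℕ, 0 < k → motion t L k = c k := by
  -- The coefficient of Λ^k with k < 0 is final from stage −k on, and the coefficients with k ≥ 0
  -- are final from the start.
  let L : Op := ⟨fun k => (motionApprox f t c (-k).toNat).1 k, 1, fun k hk =>
    (motionApprox_monic f t c _).1.le k hk⟩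
  have hL : ∀ n : ℕ, (L - motionApprox f t c n).Le (-(n + 1)) := by
    intro n k hk
    rw [Op.sub_apply]
    change (motionApprox f t c (-k).toNat).1 k - _ = 0
    have hle : (-k).toNat ≤ n := by omega
    obtain ⟨m, hm⟩ := Nat.exists_eq_add_of_le hle
    have := motionApprox_sub_le f t c (-k).toNat m k (by omega)
    rw [Op.sub_apply, ← hm] at this
    rw [← neg_sub, this, neg_zero]
  have hmon : L.Monic 1 :=
    ⟨fun k hk => (motionApprox_monic f t c _).1.le k hk, (motionApprox_monic f t c 0).1.lead⟩
  refine ⟨L, hmon, (motionApprox_monic f t c 0).2, fun k hk => ?_⟩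
  obtain ⟨k, rfl⟩ := Nat.exists_eq_succ_of_ne_zero hk.ne'
  rw [motion_congr hmon (motionApprox_monic f t c (k + 1)).1 t (hL (k + 1))]
  exact motion_motionApprox f t c k

theorem dx_zc (k : ℕ) : dx (zc k) = 0 := dx_gen_z _

/-- The Leibniz rule d(A^{k+1}) = A·d(A^k) + d(A)·A^k is again an instance of `lead_of_recursion`.
-/
theorem IsDer.pow_lead {d : Op →+ Op} (hd : IsDer d) {A : Op} (hA : A.Monic 1) {m : ℤ}
    (h : (d A).Le m) (k : ℕ) : (d (A ^ k)).Le (k - 1 + m) ∧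
      (d (A ^ k)).1 (k - 1 + m) = opSeries (powSeries k) ((d A).1 m) := by
  refine lead_of_recursion (Y := fun k => d (A ^ k)) (C := fun k => A ^ k) hA
    (fun k => by simpa using hA.pow k) h (by simp [hd.one]) (fun k => ?_) k
  rw [pow_succ', hd, add_comm]

theorem sub_kOp_le {L : Op} (hL : L.Monic 1) (h0 : L.1 0 = field 0) : (L - kOp).Le (-1) := by
  have h2 : (L - kOp).Le (1 - 1) :=
    (hL.le.sub kOp_monic.le).pred (by rw [Op.sub_apply, hL.lead, kOp_monic.lead, sub_self])
  refine Op.Le.pred (n := 0) (by simpa using h2) ?_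
  simp [Op.sub_apply, h0, kOp, Op.add_apply, Op.mono_apply]

/-- A leading coefficient of `adA L` in any order m ≤ 0 is transported to degree 0 by passing to a
power of L; there `adA` gives ε∇ of a constant of motion, which is zero. -/
theorem adA_eq_zero {L : Op} (hL : L.Monic 1) (h0 : L.1 0 = field 0)
    (h : ∀ k : ℕ, 0 < k → dx (motion tau L k) = 0) : adA L = 0 := by
  have hle : (adA L).Le 0 := by
    -- K commutes with itself, so L may be replaced by L − K, of order −1; this bounds the
    -- commutator by order 0.
    have e : adA L = (kOp * (L - kOp) - (L - kOp) * kOp) - coeffwise epsTauDx L := by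
      rw [adA_apply]; noncomm_ring
    rw [e]
    have h1 := sub_kOp_le hL h0
    refine (Op.Le.sub (kOp_monic.le.mul h1) (h1.mul kOp_monic.le)).sub ?_
    refine Op.Le.pred (n := 1) (coeffwise_le hL.le) ?_
    rw [coeffwise_apply, hL.lead, epsTauDx_apply, dx_one, mul_zero, mul_zero]
  refine Op.eq_zero_of_le hle fun m hm hm' => ?_
  -- The leading term of `adA (L ^ k)` has order k − 1 + m; this k makes it 0, and k > 0 because m ≤
  -- 0.
  obtain ⟨k, hk⟩ : ∃ k : ℕ, (k : ℤ) = 1 - m := ⟨(1 - m).toNat, by omega⟩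
  have h1 := (isDer_adA.pow_lead hL hm' k).2
  rw [hk, show 1 - m - 1 + m = 0 by ring, adA_coeff_zero] at h1
  refine opSeries_powSeries_injective (k := k) (by omega) ?_
  rw [← h1]
  change PowerSeries.X * nabla (motion tau L k) = 0
  rw [nabla_const (h k (by omega)), mul_zero]

/-! ### Substitutions -/

theorem diffPoly_induction {p : DiffPoly → Prop}
    (rat : ∀ r : ℚ, p (LaurentPolynomial.C (MvPolynomial.C r)))
    (gen : ∀ g, p (LaurentPolynomial.C (MvPolynomial.X g)))
    (q : p (LaurentPolynomial.T 1)) (qinv : p (LaurentPolynomial.T (-1)))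
    (add : ∀ a b, p a → p b → p (a + b)) (mul : ∀ a b, p a → p b → p (a * b))
    (a : DiffPoly) : p a := by
  have hC : ∀ a : Jet, p (LaurentPolynomial.C a) := fun a => by
    induction a using MvPolynomial.induction_on with
    | C r => exact rat r
    | add a b ha hb => rw [map_add]; exact add _ _ ha hb
    | mul_X a g ha => rw [map_mul]; exact mul _ _ ha (gen g)
  induction a using LaurentPolynomial.induction_on with
  | h_C a => exact hC a
  | h_add ha hb => exact add _ _ ha hb
  | h_C_mul_T n a ih => rw [LaurentPolynomial.T_add, ← mul_assoc]; exact mul _ _ ih q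
  | h_C_mul_T_Z n a ih => rw [sub_eq_add_neg, LaurentPolynomial.T_add, ← mul_assoc]; exact mul _ _ ih qinv

theorem subst_eq_epsLift (σ : Gen → DiffAlg) (f : DiffAlg) :
    subst σ f = epsLift (subst₀ σ).toAddMonoidHom f := rfl

theorem subst_C (σ : Gen → DiffAlg) (a : DiffPoly) : subst σ (PowerSeries.C a) = subst₀ σ a := by
  rw [subst_eq_epsLift, epsLift_C]; rfl

/-- The substitution as a ring homomorphism. -/
def substHom (σ : Gen → DiffAlg) : DiffAlg →+* DiffAlg where
  toFun := subst σ
  map_zero' := by rw [subst_eq_epsLift, map_zero]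
  map_add' f g := by simp only [subst_eq_epsLift, map_add]
  map_one' := by
    have h := subst_C σ 1
    rwa [map_one, map_one] at h
  map_mul' f g := by
    simp only [subst_eq_epsLift]
    refine eps_mul_of_C (epsLift_X_mul _) (fun a b => ?_) f g
    rw [epsLift_C, epsLift_C, epsLift_C]
    exact map_mul (subst₀ σ) a b

theorem substHom_X_mul (σ : Gen → DiffAlg) (f : DiffAlg) :
    substHom σ (PowerSeries.X * f) = PowerSeries.X * substHom σ f := by
  change subst σ _ = _ * subst σ _
  rw [subst_eq_epsLift, epsLift_X_mul, subst_eq_epsLift]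

theorem substHom_gen (σ : Gen → DiffAlg) (g : Gen) : substHom σ (gen g) = σ g := by
  change subst σ _ = _
  rw [gen, subst_C, subst₀, LaurentPolynomial.eval₂_C]
  simp

theorem subst₀_T (σ : Gen → DiffAlg) (n : ℤ) : subst₀ σ (LaurentPolynomial.T n) = qpow n := by
  have h1 : subst₀ σ (LaurentPolynomial.T 1) = qpow 1 := by simp [subst₀]
  have h2 : subst₀ σ (LaurentPolynomial.T (-1)) = qpow (-1) := by simp [subst₀]
  induction n with
  | zero => rw [LaurentPolynomial.T_zero, map_one, qpow_zero]
  | succ n ih => rw [LaurentPolynomial.T_add, map_mul, ih, h1, ← qpow_add]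
  | pred n ih => rw [sub_eq_add_neg, LaurentPolynomial.T_add, map_mul, ih, h2, ← qpow_add]

theorem substHom_qpow (σ : Gen → DiffAlg) (n : ℤ) : substHom σ (qpow n) = qpow n := by
  change subst σ _ = _
  rw [qpow, subst_C, subst₀_T, qpow]

theorem ringHom_eps_ext {T₁ T₂ : DiffAlg →+* DiffAlg}
    (h₁ : ∀ f, T₁ (PowerSeries.X * f) = PowerSeries.X * T₁ f)
    (h₂ : ∀ f, T₂ (PowerSeries.X * f) = PowerSeries.X * T₂ f)
    (h : ∀ g, T₁ (gen g) = T₂ (gen g)) (hq : ∀ n, T₁ (qpow n) = T₂ (qpow n)) (f : DiffAlg) :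
    T₁ f = T₂ f := by
  refine eps_ext (T₁ := T₁.toAddMonoidHom) (T₂ := T₂.toAddMonoidHom) h₁ h₂ (fun a => ?_) f
  change T₁ (PowerSeries.C a) = T₂ (PowerSeries.C a)
  induction a using diffPoly_induction with
  | rat r =>
    exact RingHom.congr_fun (Subsingleton.elim
      (T₁.comp (PowerSeries.C.comp (LaurentPolynomial.C.comp MvPolynomial.C)))
      (T₂.comp (PowerSeries.C.comp (LaurentPolynomial.C.comp MvPolynomial.C)))) r
  | gen g => exact h g
  | q => exact hq 1
  | qinv => exact hq (-1)
  | add a b ha hb => simp only [map_add, ha, hb]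
  | mul a b ha hb => simp only [map_mul, ha, hb]

theorem dx_C_rat (r : ℚ) :
    dx (PowerSeries.C (LaurentPolynomial.C (MvPolynomial.C r))) = 0 := by
  rw [dx_C, dx₀, ← LaurentPolynomial.single_eq_C, extDer_single]
  simp

theorem ringHom_C_rat (T : DiffAlg →+* DiffAlg) (r : ℚ) :
    T (PowerSeries.C (LaurentPolynomial.C (MvPolynomial.C r))) =
      PowerSeries.C (LaurentPolynomial.C (MvPolynomial.C r)) :=
  RingHom.congr_fun (Subsingleton.elim
      (T.comp (PowerSeries.C.comp (LaurentPolynomial.C.comp MvPolynomial.C)))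
      (PowerSeries.C.comp (LaurentPolynomial.C.comp MvPolynomial.C))) r

theorem ringHom_dx {T : DiffAlg →+* DiffAlg}
    (hX : ∀ f, T (PowerSeries.X * f) = PowerSeries.X * T f)
    (hg : ∀ g, T (dx (gen g)) = dx (T (gen g))) (hq : ∀ n, T (qpow n) = qpow n)
    (hu : T (gen (Gen.u 1)) = gen (Gen.u 1)) (f : DiffAlg) : T (dx f) = dx (T f) := by
  have hqd : ∀ n, T (dx (qpow n)) = dx (T (qpow n)) := fun n => by
    rw [hq, dx_qpow, map_zsmul, map_mul, hq, hu]
  refine eps_ext (T₁ := T.toAddMonoidHom.comp dx.toAddMonoidHom)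
    (T₂ := dx.toAddMonoidHom.comp T.toAddMonoidHom) (fun f => ?_) (fun f => ?_) (fun a => ?_) f
  · change T (dx _) = _ * T (dx _)
    rw [dx_X_mul, hX]
  · change dx (T _) = _ * dx (T _)
    rw [hX, dx_X_mul]
  · change T (dx (PowerSeries.C a)) = dx (T (PowerSeries.C a))
    induction a using diffPoly_induction with
    | rat r => rw [dx_C_rat, ringHom_C_rat, dx_C_rat, map_zero]
    | gen g => exact hg g
    | q => exact hqd 1
    | qinv => exact hqd (-1)
    | add a b ha hb => simp only [map_add, ha, hb]
    | mul a b ha hb => simp only [map_mul, dx_mul, map_add, ha, hb]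

/-! ### The involution -/

/-- The involution as a ring homomorphism. -/
def barHom : DiffAlg →+* DiffAlg := substHom barGen

theorem barHom_X_mul (f : DiffAlg) :
    barHom (PowerSeries.X * f) = PowerSeries.X * barHom f := substHom_X_mul _ f

theorem barHom_qpow (n : ℤ) : barHom (qpow n) = qpow n := substHom_qpow _ n

theorem barHom_gen (g : Gen) : barHom (gen g) = barGen g := substHom_gen _ g

theorem barHom_u (n : ℕ) : barHom (gen (Gen.u n)) = gen (Gen.u n) := barHom_gen _

theorem barHom_v (n : ℕ) :
    barHom (gen (Gen.v n)) = gen (Gen.v n) - tau * opP (gen (Gen.u n)) := barHom_gen _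

theorem barHom_tau : barHom tau = -tau := barHom_gen _

theorem barHom_zc (k : ℕ) : barHom (zc k) = zbarc k := barHom_gen _

theorem opP_dx (f : DiffAlg) : opP (dx f) = dx (opP f) := opSeries_dx _ f

theorem barHom_dx (f : DiffAlg) : barHom (dx f) = dx (barHom f) := by
  refine ringHom_dx barHom_X_mul (fun g => ?_) barHom_qpow (barHom_u 1) f
  cases g with
  | tau => exact (congrArg _ dx_tau).trans (by
      change _ = dx (barHom tau); rw [barHom_tau, map_neg, dx_tau, map_zero, neg_zero])
  | z k => rw [dx_gen_z, barHom_gen, barGen, dx_gen_zbar, map_zero]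
  | zbar k => rw [dx_gen_zbar, barHom_gen, barGen, dx_gen_z, map_zero]
  | v n => rw [dx_gen_v, barHom_v, barHom_v, map_sub, dx_gen_v, dx_tau_mul, ← opP_dx, dx_gen_u]
  | u n => rw [dx_gen_u, barHom_u, barHom_u, dx_gen_u]

theorem barHom_opSeries (φ : PowerSeries ℚ) (f : DiffAlg) :
    barHom (opSeries φ f) = opSeries φ (barHom f) :=
  opSeries_commute (T := barHom.toAddMonoidHom) barHom_X_mul barHom_dx φ f

theorem barHom_shift (s : ℚ) (f : DiffAlg) : barHom (shift s f) = shift s (barHom f) :=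
  barHom_opSeries _ f

theorem barHom_opP (f : DiffAlg) : barHom (opP f) = opP (barHom f) := barHom_opSeries _ f

theorem barHom_nabla (f : DiffAlg) : barHom (nabla f) = nabla (barHom f) := by
  rw [nabla_eq, barHom_opSeries, barHom_dx, nabla_eq]

theorem barHom_barHom (f : DiffAlg) : barHom (barHom f) = f := by
  refine ringHom_eps_ext (T₁ := barHom.comp barHom) (T₂ := RingHom.id _) (fun f => ?_)
    (fun f => rfl) (fun g => ?_) (fun n => ?_) f
  · simp only [RingHom.comp_apply, barHom_X_mul]
  · simp only [RingHom.comp_apply, RingHom.id_apply]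
    cases g with
    | tau =>
      change barHom (barHom tau) = tau
      rw [barHom_tau, map_neg, barHom_tau, neg_neg]
    | z k => rw [barHom_gen, barGen, barHom_gen, barGen]
    | zbar k => rw [barHom_gen, barGen, barHom_gen, barGen]
    | v n =>
      rw [barHom_v, map_sub, map_mul, barHom_v, barHom_tau, barHom_opP, barHom_u]
      ring
    | u n => rw [barHom_u, barHom_u]
  · simp only [RingHom.comp_apply, RingHom.id_apply, barHom_qpow]

theorem barHom_injective : Function.Injective barHom :=
  Function.LeftInverse.injective barHom_barHom

theorem barHom_mem_exact {f : DiffAlg} (h : f ∈ exact) : barHom f ∈ exact := by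
  obtain ⟨g, rfl⟩ := h
  exact ⟨barHom g, (barHom_dx g).symm⟩

/-! ### Powers of `qΛ⁻¹` -/

theorem Op.mono_mul_mono (a b : ℤ) (f g : DiffAlg) : Op.mono a f * Op.mono b g =
    Op.mono (a + b) (shift (-(b : ℚ) / 2) f * shift ((a : ℚ) / 2) g) := by
  refine Op.ext' fun k => ?_
  rw [Op.mono_mul_apply, Op.mono_apply, Op.mono_apply]
  by_cases h : k = a + b
  · subst h; simp
  · rw [if_neg h, if_neg (by omega), map_zero, mul_zero]

theorem Op.mono_zero_one : Op.mono 0 1 = 1 := rfl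

/-- The invertible operator `qΛ⁻¹`. -/
def qLam : Opˣ where
  val := Op.mono (-1) (qpow 1)
  inv := Op.mono 1 (qpow (-1))
  val_inv := by
    rw [Op.mono_mul_mono, ← Op.mono_zero_one]
    push_cast
    rw [← shift_mul, qpow_mul_neg, shift_one_apply]
  inv_val := by
    rw [Op.mono_mul_mono, ← Op.mono_zero_one]
    push_cast
    rw [neg_neg, ← shift_mul, mul_comm, qpow_mul_neg, shift_one_apply]

/-- The coefficient `q^{-[k]}`, for all integers `k`. -/
def qCoeff (k : ℤ) : DiffAlg :=
  if k ≤ 0 then qBracket 1 (-k).toNat else qBracket (-1) k.toNat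

theorem qLam_val : (qLam : Op) = Op.mono (-1) (qpow 1) := rfl

theorem qLam_inv_val : ((qLam⁻¹ : Opˣ) : Op) = Op.mono 1 (qpow (-1)) := rfl

theorem qLam_pow (n : ℕ) : (qLam : Op) ^ n = Op.mono (-n) (qBracket 1 n) := by
  induction n with
  | zero => rw [pow_zero, qBracket, Nat.cast_zero, neg_zero, Op.mono_zero_one]
  | succ n ih =>
    rw [pow_succ', ih, qLam_val, Op.mono_mul_mono, qBracket]
    have e : (-1 : ℤ) + -(n : ℤ) = -((n + 1 : ℕ) : ℤ) := by push_cast; ring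
    rw [e]
    push_cast
    rw [neg_neg, neg_div 2 (1 : ℚ)]

theorem qLam_inv_pow (n : ℕ) : ((qLam⁻¹ : Opˣ) : Op) ^ n = Op.mono n (qBracket (-1) n) := by
  induction n with
  | zero => rw [pow_zero, qBracket, Nat.cast_zero, Op.mono_zero_one]
  | succ n ih =>
    rw [pow_succ, ih, qLam_inv_val, Op.mono_mul_mono, qBracket]
    have e : (n : ℤ) + 1 = ((n + 1 : ℕ) : ℤ) := by push_cast; ring
    rw [e, mul_comm]
    push_cast
    rw [neg_div 2 (1 : ℚ)]

theorem qLam_zpow (k : ℤ) : ((qLam ^ (-k) : Opˣ) : Op) = Op.mono k (qCoeff k) := by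
  rcases le_or_gt k 0 with h | h
  · obtain ⟨n, rfl⟩ : ∃ n : ℕ, k = -n := ⟨(-k).toNat, by omega⟩
    rw [neg_neg, zpow_natCast, Units.val_pow_eq_pow_val, qLam_pow, qCoeff, if_pos h]
    simp
  · obtain ⟨n, rfl⟩ : ∃ n : ℕ, k = n := ⟨k.toNat, by omega⟩
    rw [zpow_neg, zpow_natCast, ← inv_pow, Units.val_pow_eq_pow_val, qLam_inv_pow, qCoeff,
      if_neg (not_le.2 h)]
    simp

/-- The cocycle rule is the law of exponents for the integer powers of the single operator qΛ⁻¹. -/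
theorem qCoeff_add (a b : ℤ) : qCoeff (a + b) =
    shift (-(b : ℚ) / 2) (qCoeff a) * shift ((a : ℚ) / 2) (qCoeff b) := by
  have h := qLam_zpow (a + b)
  rw [neg_add, zpow_add, Units.val_mul, qLam_zpow, qLam_zpow, Op.mono_mul_mono] at h
  have h2 := congrArg (fun A : Op => A.1 (a + b)) h
  simpa [Op.mono_apply] using h2.symm

theorem qCoeff_zero : qCoeff 0 = 1 := by simp [qCoeff, qBracket]

theorem qCoeff_one : qCoeff 1 = qpow (-1) := by
  simp [qCoeff, qBracket, shift_zero_apply, shift_one_apply]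

theorem qCoeff_neg_one : qCoeff (-1) = qpow 1 := by
  simp [qCoeff, qBracket, shift_zero_apply, shift_one_apply]

theorem qCoeff_neg_mul (k : ℤ) : qCoeff (-k) * qCoeff k = 1 := by
  have h := qCoeff_add (-k) k
  rw [neg_add_cancel, qCoeff_zero] at h
  push_cast at h
  rw [← shift_mul] at h
  exact shift_injective _ (h.symm.trans (shift_one_apply _).symm)

theorem qCoeff_ne_zero (k : ℤ) : qCoeff k ≠ 0 := fun h => by
  have := qCoeff_neg_mul k
  rw [h, mul_zero] at this
  exact zero_ne_one this

theorem ringHom_qCoeff {β : DiffAlg →+* DiffAlg} (hs : ∀ s f, β (shift s f) = shift s (β f))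
    (hq : ∀ n, β (qpow n) = qpow n) (k : ℤ) : β (qCoeff k) = qCoeff k := by
  have h : ∀ m n, β (qBracket m n) = qBracket m n := fun m n => by
    induction n with
    | zero => exact map_one β
    | succ n ih => rw [qBracket, map_mul, hs, hs, hq, ih]
  rw [qCoeff]
  split_ifs <;> exact h _ _

/-! ### The anti-involution of operators -/

/-- The conjugation of operators which acts on coefficients by `β`. -/
def conjWith (β : DiffAlg →+* DiffAlg) (A : DiffOp) : DiffOp := fun k => β (A (-k)) * qCoeff k

theorem opConj_eq (A : DiffOp) : opConj A = conjWith barHom A := rfl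

/-- The rule `qCoeff_add` absorbs the shifts produced by reversing the factors. The operators need
not be bounded on the same side: injectivity of β and of multiplication by `qCoeff k` lets the map
pass through the sum without finiteness. -/
theorem conjWith_mul {β : DiffAlg →+* DiffAlg} (hs : ∀ s f, β (shift s f) = shift s (β f))
    (hβ : Function.Injective β) (A B : DiffOp) :
    conjWith β (opMul A B) = opMul (conjWith β B) (conjWith β A) := by
  funext k
  have hinj : Function.Injective
      ((AddMonoidHom.mulRight (qCoeff k)).comp β.toAddMonoidHom) := fun f g h =>
    hβ (mul_right_cancel₀ (qCoeff_ne_zero k) h)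
  change (AddMonoidHom.mulRight (qCoeff k)).comp β.toAddMonoidHom (opMul A B (-k)) = _
  rw [opMul, AddMonoidHom.map_finsum_of_injective _ hinj, opMul,
    ← finsum_comp_equiv (Equiv.subRight k)]
  refine finsum_congr fun i => ?_
  simp only [AddMonoidHom.comp_apply, AddMonoidHom.coe_mulRight, RingHom.toAddMonoidHom_eq_coe,
    AddMonoidHom.coe_coe, map_mul, hs, conjWith, Equiv.subRight_apply, shift_mul]
  have h := qCoeff_add i (k - i)
  rw [add_sub_cancel] at h
  rw [h, show -k - (i - k) = -i by ring, neg_sub]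
  push_cast
  rw [neg_neg, show ((i : ℚ) - k) / 2 = -((k : ℚ) - i) / 2 by ring]
  ring

theorem opConj_mul (A B : DiffOp) : opConj (opMul A B) = opMul (opConj B) (opConj A) :=
  conjWith_mul barHom_shift barHom_injective A B

theorem opConj_sub (A B : DiffOp) : opConj (A - B) = opConj A - opConj B := by
  funext k
  simp only [opConj_eq, conjWith, Pi.sub_apply, map_sub, sub_mul]

theorem opConj_one : opConj opOne = opOne := by
  funext k
  rw [opConj_eq, conjWith, opOne, Pi.single_apply, Pi.single_apply]
  by_cases h : k = 0
  · subst h; simp [qCoeff_zero]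
  · simp [h]

theorem opConj_pow (A : Op) (n : ℕ) : opPow (opConj A.1) n = opConj (A ^ n).1 := by
  induction n with
  | zero => rw [opPow, pow_zero, Op.one_val, opConj_one]
  | succ n ih => rw [opPow, ih, ← opConj_mul, pow_succ', Op.mul_val]

theorem opComm_opConj (A B : DiffOp) :
    opComm (opConj A) (opConj B) = -opConj (opComm A B) := by
  rw [opComm, opComm, opConj_sub, opConj_mul, opConj_mul, neg_sub]

/-- Finite support on one side replaces the bound on the other; this is needed because the conjugate
of L is unbounded above, outside the ring `Op`. -/
theorem opMul_sub_left {A A' : DiffOp} (hA : A.support.Finite) (hA' : A'.support.Finite)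
    (B : DiffOp) : opMul (A - A') B = opMul A B - opMul A' B := by
  funext k
  rw [Pi.sub_apply, opMul, opMul, opMul, ← finsum_sub_distrib]
  · simp only [Pi.sub_apply, map_sub, sub_mul]
  · exact hA.subset fun i hi h => hi (by simp [h])
  · exact hA'.subset fun i hi h => hi (by simp [h])

theorem opMul_sub_right {A A' : DiffOp} (hA : A.support.Finite) (hA' : A'.support.Finite)
    (B : DiffOp) : opMul B (A - A') = opMul B A - opMul B A' := by
  funext k
  have key : ∀ A : DiffOp, A.support.Finite → (Function.support fun i : ℤ =>
      shift (-((k - i : ℤ) : ℚ) / 2) (B i) * shift ((i : ℚ) / 2) (A (k - i))).Finite :=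
    fun A hA => (hA.preimage (f := fun i => k - i) fun _ _ _ _ h => sub_right_injective h).subset
      fun i hi h => hi (by simp [h])
  rw [Pi.sub_apply, opMul, opMul, opMul, ← finsum_sub_distrib (key A hA) (key A' hA')]
  simp only [Pi.sub_apply, map_sub, mul_sub]

theorem single_support_finite (n : ℤ) (f : DiffAlg) :
    (Function.support (Pi.single n f : DiffOp)).Finite :=
  (Set.finite_singleton n).subset Pi.support_single_subset

theorem IsDer.units_inv_eq_zero {d : Op →+ Op} (hd : IsDer d) (A : Opˣ) (h : d A = 0) :
    d ((A⁻¹ : Opˣ) : Op) = 0 := by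
  have h1 := hd (A : Op) (A⁻¹ : Opˣ)
  rw [Units.mul_inv, hd.one, h, zero_mul, zero_add] at h1
  have h2 := congrArg (fun X => ((A⁻¹ : Opˣ) : Op) * X) h1
  simpa using h2.symm

theorem IsDer.units_zpow_eq_zero {d : Op →+ Op} (hd : IsDer d) (A : Opˣ) (h : d A = 0) (k : ℤ) :
    d ((A ^ k : Opˣ) : Op) = 0 := by
  obtain ⟨n, rfl | rfl⟩ := k.eq_nat_or_neg
  · rw [zpow_natCast, Units.val_pow_eq_pow_val, hd.pow_eq_zero h]
  · rw [zpow_neg, zpow_natCast, ← inv_pow, Units.val_pow_eq_pow_val,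
      hd.pow_eq_zero (hd.units_inv_eq_zero A h)]

/-- The logarithmic derivative of `q^{[k]}`. -/
theorem der_qCoeff {T : DiffAlg →+ DiffAlg} (hT : ∀ f g, T (f * g) = f * T g + g * T f)
    (hs : ∀ s f, T (shift s f) = shift s (T f)) {g : DiffAlg}
    (hq : T (qpow 1) = qpow 1 * nabla g) (k : ℤ) : PowerSeries.X * T (qCoeff k) =
      (shift (-(k : ℚ) / 2) g - shift ((k : ℚ) / 2) g) * qCoeff k := by
  set T' := (AddMonoidHom.mulLeft (PowerSeries.X : DiffAlg)).comp T with hT'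
  have hT'a : ∀ f, T' f = PowerSeries.X * T f := fun f => rfl
  -- The derivation εT − [g, ·] annihilates qΛ⁻¹, by the hypothesis on T q, and therefore all its
  -- integer powers; reading off their coefficients gives the claim.
  have hd : IsDer (coeffwise T' - (AddMonoidHom.mulLeft (Op.mono 0 g) -
      AddMonoidHom.mulRight (Op.mono 0 g))) := by
    refine IsDer.sub (isDer_coeffwise (fun f g => ?_) fun s f => ?_) (IsDer.ad _)
    · rw [hT'a, hT'a, hT'a, hT]; ring
    · rw [hT'a, hT'a, hs, shift_X_mul]
  have hcoef : ∀ (m : ℤ) (f : DiffAlg), (coeffwise T' - (AddMonoidHom.mulLeft (Op.mono 0 g) -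
      AddMonoidHom.mulRight (Op.mono 0 g))) (Op.mono m f) = Op.mono m (PowerSeries.X * T f -
        (shift (-(m : ℚ) / 2) g - shift ((m : ℚ) / 2) g) * f) := by
    intro m f
    refine Op.ext' fun j => ?_
    simp only [AddMonoidHom.sub_apply, AddMonoidHom.coe_mulLeft, AddMonoidHom.coe_mulRight,
      Op.sub_apply, coeffwise_apply, Op.mul_mono_apply, Op.mono_apply]
    by_cases h : j = m
    · subst h; simp [hT'a, shift_zero_apply]; ring
    · simp [h, sub_eq_zero]
  have h0 := hd.units_zpow_eq_zero qLam (by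
    change (coeffwise T' - _) (Op.mono (-1) (qpow 1)) = 0
    rw [hcoef, hq, mul_left_comm, X_mul_nabla]
    refine Op.ext' fun j => ?_
    rw [Op.mono_apply, Op.zero_apply, ite_eq_right_iff]
    intro _
    push_cast
    rw [neg_neg, neg_div]
    ring) (-k)
  rw [qLam_zpow, hcoef] at h0
  have h1 := congrArg (fun A : Op => A.1 k) h0
  rw [Op.mono_apply, if_pos rfl, Op.zero_apply] at h1
  exact sub_eq_zero.1 h1

/-- Conjugation of a Lax equation. -/
theorem conj_lax {T T' : DiffAlg →+ DiffAlg} (hT : ∀ f g, T' (f * g) = f * T' g + g * T' f)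
    (hs : ∀ s f, T' (shift s f) = shift s (T' f)) (hbar : ∀ f, T' (barHom f) = barHom (T f))
    {g : DiffAlg} (hq : T' (qpow 1) = qpow 1 * nabla g) {A B : DiffOp}
    (hB : B.support.Finite) (h : ∀ k, PowerSeries.X * T (A k) = opComm B A k) (k : ℤ) :
    PowerSeries.X * T' (opConj A k) = opComm (Pi.single 0 g - opConj B) (opConj A) k := by
  have hB' : (opConj B).support.Finite :=
    (hB.preimage (f := Neg.neg) neg_injective.injOn).subset fun i hi h => hi (by
      rw [opConj_eq, conjWith, h, map_zero, zero_mul])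
  -- Conjugation reverses products and so changes the sign of the commutator. The extra term, the
  -- commutator with g, accounts for the variation of the factors q^{[k]}.
  have h1 : opComm (Pi.single 0 g - opConj B) (opConj A) =
      opComm (Pi.single 0 g) (opConj A) + opConj (opComm B A) := by
    rw [← neg_neg (opConj (opComm B A)), ← opComm_opConj, opComm, opComm, opComm,
      opMul_sub_left (single_support_finite _ _) hB',
      opMul_sub_right (single_support_finite _ _) hB']
    abel
  have h2 : opComm (Pi.single 0 g) (opConj A) k =
      (shift (-(k : ℚ) / 2) g - shift ((k : ℚ) / 2) g) * opConj A k := by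
    rw [opComm, Pi.sub_apply, single_opMul, opMul_single]
    simp [shift_zero_apply]
    ring
  rw [h1, Pi.add_apply, h2, opConj_eq, conjWith, hT, mul_add, mul_left_comm, der_qCoeff hT hs hq,
    hbar, mul_left_comm PowerSeries.X, ← barHom_X_mul, h, opConj_eq, conjWith]
  ring

/-! ### Evolutionary derivations -/

/-- An additive map which is an evolutionary derivation, linear over `ε` and over the parameters
`τ`, `z_k`, `z̄_k`. -/
structure IsEvo (T : DiffAlg →+ DiffAlg) : Prop where
  eps : ∀ f, T (PowerSeries.X * f) = PowerSeries.X * T f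
  leibniz : ∀ f g, T (f * g) = f * T g + g * T f
  dx : ∀ f, T (dx f) = dx (T f)
  tau : T tau = 0
  z : ∀ k, T (gen (Gen.z k)) = 0
  zbar : ∀ k, T (gen (Gen.zbar k)) = 0
  log : T (qpow 1) = qpow 1 * T (field 1)

theorem leibniz_one {T : DiffAlg →+ DiffAlg} (h : ∀ f g, T (f * g) = f * T g + g * T f) :
    T 1 = 0 := by
  have := h 1 1
  simpa using this

theorem leibniz_rat {T : DiffAlg →+ DiffAlg} (h : ∀ f g, T (f * g) = f * T g + g * T f) (r : ℚ) :
    T (PowerSeries.C (LaurentPolynomial.C (MvPolynomial.C r))) = 0 := by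
  have h1 : (PowerSeries.C (LaurentPolynomial.C (MvPolynomial.C r)) : DiffAlg) = r • 1 := by
    rw [← Algebra.algebraMap_eq_smul_one]
    exact RingHom.congr_fun (Subsingleton.elim
      (PowerSeries.C.comp (LaurentPolynomial.C.comp MvPolynomial.C)) (algebraMap ℚ DiffAlg)) r
  rw [h1, map_rat_smul, leibniz_one h, smul_zero]

theorem leibniz_qinv {T : DiffAlg →+ DiffAlg} (h : ∀ f g, T (f * g) = f * T g + g * T f) :
    T (qpow (-1)) = -(qpow (-1) * qpow (-1) * T (qpow 1)) := by
  have h1 := h (qpow 1) (qpow (-1))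
  rw [qpow_mul_neg, leibniz_one h] at h1
  have h2 : qpow (-1) * (qpow 1 * T (qpow (-1))) = T (qpow (-1)) := by
    rw [← mul_assoc, mul_comm (qpow (-1)), qpow_mul_neg, one_mul]
  rw [← h2]
  linear_combination (-qpow (-1)) * h1

/-- Derivations are determined by their values on generators. -/
theorem der_ext {T₁ T₂ : DiffAlg →+ DiffAlg}
    (h₁ : ∀ f, T₁ (PowerSeries.X * f) = PowerSeries.X * T₁ f)
    (h₂ : ∀ f, T₂ (PowerSeries.X * f) = PowerSeries.X * T₂ f)
    (l₁ : ∀ f g, T₁ (f * g) = f * T₁ g + g * T₁ f) (l₂ : ∀ f g, T₂ (f * g) = f * T₂ g + g * T₂ f)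
    (h : ∀ g, T₁ (gen g) = T₂ (gen g)) (hq : T₁ (qpow 1) = T₂ (qpow 1)) (f : DiffAlg) :
    T₁ f = T₂ f := by
  refine eps_ext h₁ h₂ (fun a => ?_) f
  induction a using diffPoly_induction with
  | rat r => rw [leibniz_rat l₁, leibniz_rat l₂]
  | gen g => exact h g
  | q => exact hq
  | qinv =>
    change T₁ (qpow (-1)) = T₂ (qpow (-1))
    rw [leibniz_qinv l₁, leibniz_qinv l₂, hq]
  | add a b ha hb => simp only [map_add, ha, hb]
  | mul a b ha hb => simp only [map_mul, l₁, l₂, ha, hb]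

/-- The commutator of T and ∂ is again an ε-linear derivation, so it vanishes once it vanishes on
generators. -/
theorem der_commute_dx {T : DiffAlg →+ DiffAlg}
    (hX : ∀ f, T (PowerSeries.X * f) = PowerSeries.X * T f)
    (hl : ∀ f g, T (f * g) = f * T g + g * T f)
    (h : ∀ g, T (dx (gen g)) = dx (T (gen g))) (hq : T (dx (qpow 1)) = dx (T (qpow 1)))
    (f : DiffAlg) : T (dx f) = dx (T f) := by
  rw [← sub_eq_zero]
  refine der_ext (T₁ := T.comp dx.toAddMonoidHom - dx.toAddMonoidHom.comp T) (T₂ := 0)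
    (fun f => ?_) (fun f => by simp) (fun f g => ?_) (fun f g => by simp) (fun g => ?_) ?_ f
  · change T (dx _) - dx (T _) = _ * (T (dx _) - dx (T _))
    rw [dx_X_mul, hX, hX, dx_X_mul, mul_sub]
  · change T (dx _) - dx (T _) = _ * (T (dx _) - dx (T _)) + _ * (T (dx _) - dx (T _))
    simp only [dx_mul, hl, map_add]
    ring
  · change T (dx _) - dx (T _) = 0
    rw [h, sub_self]
  · change T (dx _) - dx (T _) = 0
    rw [hq, sub_self]

theorem IsEvo.opSeries {T : DiffAlg →+ DiffAlg} (h : IsEvo T) (φ : PowerSeries ℚ) (f : DiffAlg) :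
    T (opSeries φ f) = EqToda.opSeries φ (T f) := opSeries_commute h.eps h.dx φ f

theorem IsEvo.shift {T : DiffAlg →+ DiffAlg} (h : IsEvo T) (s : ℚ) (f : DiffAlg) :
    T (shift s f) = EqToda.shift s (T f) := h.opSeries _ f

theorem IsEvo.opP {T : DiffAlg →+ DiffAlg} (h : IsEvo T) (f : DiffAlg) :
    T (opP f) = EqToda.opP (T f) := h.opSeries _ f

theorem IsEvo.nabla {T : DiffAlg →+ DiffAlg} (h : IsEvo T) (f : DiffAlg) :
    T (nabla f) = EqToda.nabla (T f) := nabla_commute h.eps h.dx f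

theorem IsEvo.const_mul {T : DiffAlg →+ DiffAlg} (h : IsEvo T) {c : DiffAlg} (hc : T c = 0)
    (f : DiffAlg) : T (c * f) = c * T f := by
  rw [h.leibniz, hc, mul_zero, add_zero]

theorem IsEvo.isDer {T : DiffAlg →+ DiffAlg} (h : IsEvo T) : IsDer (coeffwise T) :=
  isDer_coeffwise h.leibniz h.shift

theorem gen_v_eq (n : ℕ) : gen (Gen.v n) = (dx ^ n) (field 0) := by
  induction n with
  | zero => rfl
  | succ n ih => rw [pow_succ', Module.End.mul_apply, ← ih, dx_gen_v]

theorem gen_u_eq (n : ℕ) : gen (Gen.u n) = (dx ^ n) (field 1) := by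
  induction n with
  | zero => rfl
  | succ n ih => rw [pow_succ', Module.End.mul_apply, ← ih, dx_gen_u]

theorem IsEvo.dx_pow {T : DiffAlg →+ DiffAlg} (h : IsEvo T) (n : ℕ) (f : DiffAlg) :
    T ((EqToda.dx ^ n) f) = (EqToda.dx ^ n) (T f) := by
  induction n with
  | zero => rfl
  | succ n ih => rw [pow_succ', Module.End.mul_apply, h.dx, ih, Module.End.mul_apply]

theorem IsEvo.ext {T₁ T₂ : DiffAlg →+ DiffAlg} (h₁ : IsEvo T₁) (h₂ : IsEvo T₂)
    (h : ∀ i, T₁ (field i) = T₂ (field i)) (f : DiffAlg) : T₁ f = T₂ f := by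
  refine der_ext h₁.eps h₂.eps h₁.leibniz h₂.leibniz (fun g => ?_) ?_ f
  · cases g with
    | tau => exact h₁.tau.trans h₂.tau.symm
    | z k => rw [h₁.z, h₂.z]
    | zbar k => rw [h₁.zbar, h₂.zbar]
    | v n => rw [gen_v_eq, h₁.dx_pow, h₂.dx_pow, h]
    | u n => rw [gen_u_eq, h₁.dx_pow, h₂.dx_pow, h]
  · rw [h₁.log, h₂.log, h]

/-! ### Construction of evolutionary derivations -/

theorem pd_C_X (i : Fin 2) (n : ℕ) (g : Gen) : pd (jet i n) (LaurentPolynomial.C (MvPolynomial.X g)) =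
    if g = jet i n then 1 else 0 := by
  rw [pd, ← LaurentPolynomial.single_eq_C, extDer_single]
  split_ifs with h h' <;> simp_all [MvPolynomial.pderiv_X]

theorem pd_T_one (i : Fin 2) (n : ℕ) : pd (jet i n) (LaurentPolynomial.T 1) =
    if jet i n = Gen.u 0 then LaurentPolynomial.T 1 else 0 := by
  rw [pd, LaurentPolynomial.T, extDer_single]
  split_ifs with h <;> simp

theorem evolTerm_finite (a : DiffAlg) (i : Fin 2) (f : DiffPoly) :
    (Function.support fun n => (dx ^ n) a * PowerSeries.C (pd (jet i n) f)).Finite := by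
  obtain ⟨N, hN⟩ := exists_bound_jet (jet i) (jet_injective i) f
  refine (Set.finite_lt_nat N).subset fun n hn => ?_
  by_contra h
  exact hn (by simp [hN n (not_lt.mp h)])

/-- The evolutionary derivation on differential polynomials. -/
def evol₀ (a : Fin 2 → DiffAlg) : DiffPoly →+ DiffAlg where
  toFun f := ∑ i, ∑ᶠ n, (dx ^ n) (a i) * PowerSeries.C (pd (jet i n) f)
  map_zero' := by simp
  map_add' f g := by
    rw [← Finset.sum_add_distrib]
    refine Finset.sum_congr rfl fun i _ => ?_
    simp only [map_add, mul_add]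
    exact finsum_add_distrib (evolTerm_finite _ i f) (evolTerm_finite _ i g)

theorem evol₀_mul (a : Fin 2 → DiffAlg) (f g : DiffPoly) :
    evol₀ a (f * g) = PowerSeries.C f * evol₀ a g + PowerSeries.C g * evol₀ a f := by
  simp only [evol₀, AddMonoidHom.coe_mk, ZeroHom.coe_mk, Finset.mul_sum]
  rw [← Finset.sum_add_distrib]
  refine Finset.sum_congr rfl fun i _ => ?_
  refine Eq.trans ?_ (congrArg₂ _ (mul_finsum' _ _ (evolTerm_finite (a i) i g))
    (mul_finsum' _ _ (evolTerm_finite (a i) i f))).symm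
  rw [← finsum_add_distrib]
  · refine finsum_congr fun n => ?_
    rw [Derivation.leibniz, smul_eq_mul, smul_eq_mul, map_add, map_mul, map_mul]
    ring
  · exact (evolTerm_finite (a i) i g).subset fun n hn h => hn (by simp only [h, mul_zero])
  · exact (evolTerm_finite (a i) i f).subset fun n hn h => hn (by simp only [h, mul_zero])

/-- The evolutionary derivation with values `a` on the fields. -/
def evol (a : Fin 2 → DiffAlg) : DiffAlg →+ DiffAlg := epsLift (evol₀ a)

theorem evol_C (a : Fin 2 → DiffAlg) (f : DiffPoly) : evol a (PowerSeries.C f) =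
    ∑ i, ∑ᶠ n, (dx ^ n) (a i) * PowerSeries.C (pd (jet i n) f) := epsLift_C _ f

theorem evol_leibniz (a : Fin 2 → DiffAlg) (f g : DiffAlg) :
    evol a (f * g) = f * evol a g + g * evol a f := by
  refine eps_leibniz_of_C (epsLift_X_mul _) (fun f g => ?_) f g
  rw [epsLift_C, epsLift_C, epsLift_C, evol₀_mul]

theorem finsum_ite_jet (b : ℕ → DiffAlg) (i : Fin 2) (g : Gen) (m : ℕ) (h : g = jet i m) :
    ∑ᶠ n, b n * PowerSeries.C (if g = jet i n then (1 : DiffPoly) else 0) = b m := by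
  rw [finsum_eq_single _ m]
  · simp [h]
  · intro n hn
    rw [if_neg fun h' => hn (jet_injective i (h'.symm.trans h)), map_zero, mul_zero]

theorem finsum_ite_jet_ne (b : ℕ → DiffAlg) (i : Fin 2) (g : Gen) (h : ∀ m, g ≠ jet i m) :
    ∑ᶠ n, b n * PowerSeries.C (if g = jet i n then (1 : DiffPoly) else 0) = 0 := by
  simp [h]

theorem evol_gen (a : Fin 2 → DiffAlg) (g : Gen) : evol a (gen g) = ∑ i, ∑ᶠ n, (dx ^ n) (a i) *
    PowerSeries.C (if g = jet i n then (1 : DiffPoly) else 0) := by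
  rw [gen, evol_C]
  simp only [pd_C_X]

theorem evol_v (a : Fin 2 → DiffAlg) (n : ℕ) : evol a (gen (Gen.v n)) = (dx ^ n) (a 0) := by
  rw [evol_gen, Fin.sum_univ_two, finsum_ite_jet _ 0 (Gen.v n) n rfl,
    finsum_ite_jet_ne _ 1 _ (fun m => by simp [jet]), add_zero]

theorem evol_u (a : Fin 2 → DiffAlg) (n : ℕ) : evol a (gen (Gen.u n)) = (dx ^ n) (a 1) := by
  rw [evol_gen, Fin.sum_univ_two, finsum_ite_jet _ 1 (Gen.u n) n rfl,
    finsum_ite_jet_ne _ 0 _ (fun m => by simp [jet]), zero_add]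

theorem evol_gen_eq_zero (a : Fin 2 → DiffAlg) {g : Gen} (h : ∀ i m, g ≠ jet i m) :
    evol a (gen g) = 0 := by
  rw [evol_gen, Fin.sum_univ_two, finsum_ite_jet_ne _ 1 _ (h 1), finsum_ite_jet_ne _ 0 _ (h 0),
    add_zero]

theorem evol_q (a : Fin 2 → DiffAlg) : evol a (qpow 1) = qpow 1 * a 1 := by
  rw [qpow, evol_C, Fin.sum_univ_two]
  simp only [pd_T_one]
  rw [finsum_eq_single _ 0, finsum_eq_single _ 0]
  · simp [jet, mul_comm]
  · intro n hn; simp [jet, hn]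
  · intro n hn; simp [jet]

theorem isEvo_evol (a : Fin 2 → DiffAlg) : IsEvo (evol a) where
  eps := epsLift_X_mul _
  leibniz := evol_leibniz a
  dx := by
    refine der_commute_dx (epsLift_X_mul _) (evol_leibniz a) (fun g => ?_) ?_
    · cases g with
      | tau =>
        rw [evol_gen_eq_zero a (fun i m => by fin_cases i <;> simp [jet]), map_zero]
        exact (congrArg _ dx_tau).trans (map_zero _)
      | z k =>
        rw [evol_gen_eq_zero a (fun i m => by fin_cases i <;> simp [jet]), map_zero, dx_gen_z,
          map_zero]
      | zbar k =>
        rw [evol_gen_eq_zero a (fun i m => by fin_cases i <;> simp [jet]), map_zero, dx_gen_zbar,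
          map_zero]
      | v n => rw [dx_gen_v, evol_v, evol_v, pow_succ', Module.End.mul_apply]
      | u n => rw [dx_gen_u, evol_u, evol_u, pow_succ', Module.End.mul_apply]
    · rw [evol_q, dx_qpow, one_smul, evol_leibniz, evol_u, evol_q, dx_mul, dx_qpow, one_smul,
        pow_one]
      ring
  tau := evol_gen_eq_zero a (fun i m => by fin_cases i <;> simp [jet])
  z k := evol_gen_eq_zero a (fun i m => by fin_cases i <;> simp [jet])
  zbar k := evol_gen_eq_zero a (fun i m => by fin_cases i <;> simp [jet])
  log := by
    rw [evol_q]
    exact congrArg _ (evol_u a 0).symm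

theorem evol_field (a : Fin 2 → DiffAlg) (i : Fin 2) : evol a (field i) = a i := by
  fin_cases i
  · exact evol_v a 0
  · exact evol_u a 0

/-! ### Constants -/

/-- Evaluation at vanishing derivatives of the fields, on generators. -/
def evGen : Gen → DiffAlg
  | Gen.v (_ + 1) => 0
  | Gen.u (_ + 1) => 0
  | g => gen g

/-- Evaluation at vanishing derivatives of the fields. -/
def evHom : DiffAlg →+* DiffAlg := substHom evGen

theorem evHom_dx (f : DiffAlg) : evHom (dx f) = 0 := by
  refine eps_ext (T₁ := evHom.toAddMonoidHom.comp dx.toAddMonoidHom) (T₂ := 0) (fun f => ?_)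
    (fun f => by simp) (fun a => ?_) f
  · change evHom (dx _) = _ * evHom (dx _)
    rw [dx_X_mul]
    exact substHom_X_mul _ _
  · change evHom (dx _) = 0
    have hq : ∀ n, evHom (dx (qpow n)) = 0 := fun n => by
      rw [dx_qpow, map_zsmul, map_mul]
      have : evHom (gen (Gen.u 1)) = 0 := substHom_gen _ _
      rw [this, mul_zero]
      exact smul_zero n
    induction a using diffPoly_induction with
    | rat r => rw [dx_C_rat, map_zero]
    | gen g =>
      change evHom (dx (gen g)) = 0
      cases g with
      | tau => exact (congrArg _ dx_tau).trans (map_zero _)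
      | z k => rw [dx_gen_z, map_zero]
      | zbar k => rw [dx_gen_zbar, map_zero]
      | v n => rw [dx_gen_v]; exact substHom_gen _ _
      | u n => rw [dx_gen_u]; exact substHom_gen _ _
    | q => exact hq 1
    | qinv => exact hq (-1)
    | add a b ha hb => rw [map_add, map_add, map_add, ha, hb, add_zero]
    | mul a b ha hb => rw [map_mul, dx_mul, map_add, map_mul, map_mul, ha, hb, mul_zero, mul_zero,
        add_zero]

theorem evHom_opSeries (φ : PowerSeries ℚ) (f : DiffAlg) :
    evHom (opSeries φ f) = PowerSeries.constantCoeff φ • evHom f := by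
  rw [opSeries_eq_tail, opSeries_dx, map_add, map_mul, evHom_dx, mul_zero, add_zero, map_rat_smul]

theorem evHom_shift (s : ℚ) (f : DiffAlg) : evHom (shift s f) = evHom f := by
  rw [shift, evHom_opSeries, constantCoeff_exp_rescale, one_smul]

/-! ### The kernel of ∂ contains no jet variables -/

/-- By [∂/∂x^{(n+1)}, ∂] = ∂/∂x^{(n)}, independence of x^{(n+1)} passes down to x^{(n)}; high jets
are absent to begin with. -/
theorem pd_eq_zero_of_dx₀ {a : DiffPoly} (h : dx₀ a = 0) (i : Fin 2) (n : ℕ) :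
    pd (jet i n) a = 0 := by
  obtain ⟨N, hN⟩ := exists_bound_jet (jet i) (jet_injective i) a
  have key : ∀ j n, N ≤ n + j → pd (jet i n) a = 0 := by
    intro j
    induction j with
    | zero => exact hN
    | succ j ih =>
      intro n hn
      have h1 := pd_dx_succ i n a
      rw [h, map_zero, ih (n + 1) (by omega), map_zero, zero_add] at h1
      exact h1.symm
  exact key N n (by omega)

/-- In characteristic zero, a monomial containing the variable contributes its coefficient times a
nonzero exponent. -/
theorem mem_vars_of_pderiv {p : Jet} {g : Gen} (h : MvPolynomial.pderiv g p = 0) :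
    g ∉ p.vars := by
  classical
  intro hg
  obtain ⟨m, hm, hg⟩ := (MvPolynomial.mem_vars_iff_mem_support g).1 hg
  have hm' : m - Finsupp.single g 1 + Finsupp.single g 1 = m := by
    refine tsub_add_cancel_of_le (Finsupp.single_le_iff.2 ?_)
    have := Finsupp.mem_support_iff.1 hg
    omega
  have h1 := MvPolynomial.coeff_pderiv (i := g) p (m - Finsupp.single g 1)
  rw [h, hm', MvPolynomial.coeff_zero] at h1
  have h2 := (mul_eq_zero.1 h1.symm).resolve_left (MvPolynomial.mem_support_iff.1 hm)
  norm_cast at h2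

theorem subst₀_evGen {a : DiffPoly} (h : ∀ i n, pd (jet i n) a = 0) :
    subst₀ evGen a = PowerSeries.C a := by
  classical
  have hv : ∀ (i : Fin 2) (n : ℕ) (m : ℤ), jet i (n + 1) ∉ (a.coeff m).vars := by
    intro i n m
    refine mem_vars_of_pderiv ?_
    have h1 := h i (n + 1)
    have h2 : ∀ f : DiffPoly, (pd (jet i (n + 1)) f).coeff m =
        MvPolynomial.pderiv (jet i (n + 1)) (f.coeff m) := by
      intro f
      induction f using AddMonoidAlgebra.induction_linear with
      | zero => simp
      | add f₁ f₂ h₁ h₂ => simp [h₁, h₂]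
      | single k p =>
        rw [pd, extDer_single, if_neg (by fin_cases i <;> simp [jet])]
        simp only [zero_mul, smul_zero, add_zero, AddMonoidAlgebra.coeff_single]
        rw [Finsupp.single_apply, Finsupp.single_apply]
        split_ifs <;> simp
    rw [← h2, h1]
    simp
  have hp : ∀ m : ℤ, MvPolynomial.aeval evGen (a.coeff m) =
      PowerSeries.C (LaurentPolynomial.C (a.coeff m)) := by
    intro m
    have := MvPolynomial.hom_congr_vars (f₁ := (MvPolynomial.aeval evGen : Jet →ₐ[ℚ] DiffAlg).toRingHom)
      (f₂ := PowerSeries.C.comp LaurentPolynomial.C) (p₁ := a.coeff m) (p₂ := a.coeff m)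
      (Subsingleton.elim _ _) (fun g hg _ => ?_) rfl
    · exact this
    · change MvPolynomial.aeval evGen (MvPolynomial.X g) = gen g
      rw [MvPolynomial.aeval_X]
      cases g with
      | tau => rfl
      | z k => rfl
      | zbar k => rfl
      | v n => cases n with
        | zero => rfl
        | succ n => exact absurd hg (hv 0 n m)
      | u n => cases n with
        | zero => rfl
        | succ n => exact absurd hg (hv 1 n m)
  have ha : a = ∑ m ∈ a.coeff.support, LaurentPolynomial.C (a.coeff m) * LaurentPolynomial.T m := by
    conv_lhs => rw [← AddMonoidAlgebra.sum_coeff_single a]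
    exact Finset.sum_congr rfl fun m _ => LaurentPolynomial.single_eq_C_mul_T _ _
  conv_lhs => rw [ha]
  conv_rhs => rw [ha]
  rw [map_sum, map_sum]
  refine Finset.sum_congr rfl fun m _ => ?_
  rw [map_mul, map_mul, subst₀_T, ← hp]
  congr 1
  rw [subst₀, LaurentPolynomial.eval₂_C]
  rfl

/-- A function annihilated by ∂ involves no derivatives of the fields, so setting them to zero
changes nothing. -/
theorem evHom_of_dx {f : DiffAlg} (h : dx f = 0) : evHom f = f := by
  ext1 n
  change PowerSeries.coeff n (subst evGen f) = _
  rw [subst_eq_epsLift, coeff_epsLift, Finset.sum_eq_single (0, n)]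
  · change PowerSeries.coeff 0 (subst₀ evGen _) = _
    rw [subst₀_evGen, PowerSeries.coeff_zero_C]
    refine pd_eq_zero_of_dx₀ ?_
    rw [← coeff_dx, h, map_zero]
  · rintro ⟨i, j⟩ hij hne
    rw [Finset.HasAntidiagonal.mem_antidiagonal] at hij
    change PowerSeries.coeff i (subst₀ evGen _) = 0
    rw [subst₀_evGen, PowerSeries.coeff_C, if_neg]
    · rintro rfl; exact hne (by simp_all)
    · refine pd_eq_zero_of_dx₀ ?_
      rw [← coeff_dx, h, map_zero]
  · simp

theorem eq_zero_of_const {f : DiffAlg} (h : dx f = 0) (h' : evHom f = 0) : f = 0 := by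
  rw [← evHom_of_dx h, h']

/-- Evaluation fixes constants and annihilates total derivatives. Equalities of integrals of
constants thus become equalities of constants. -/
theorem eq_zero_of_const_of_exact {f : DiffAlg} (h : dx f = 0) (h' : f ∈ exact) : f = 0 := by
  obtain ⟨g, rfl⟩ := h'
  exact eq_zero_of_const h (evHom_dx g)

/-- After the evaluation all shifts act trivially, and operators multiply like commuting Laurent
series. -/
theorem evHom_mul_comm (A B : Op) (k : ℤ) : evHom ((A * B).1 k) = evHom ((B * A).1 k) := by
  obtain ⟨a, ha⟩ := A.2
  obtain ⟨b, hb⟩ := B.2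
  rw [Op.mul_val, Op.mul_val, opMul_eq_sum ha hb k _ subset_rfl,
    opMul_eq_sum hb ha k _ subset_rfl, map_sum, map_sum]
  refine Finset.sum_nbij' (fun i => k - i) (fun i => k - i) ?_ ?_ ?_ ?_ ?_
  · intro i hi; simp only [Finset.mem_Icc] at hi ⊢; omega
  · intro i hi; simp only [Finset.mem_Icc] at hi ⊢; omega
  · intro i _; ring
  · intro i _; ring
  · intro i _
    rw [map_mul, map_mul, evHom_shift, evHom_shift, evHom_shift, evHom_shift, sub_sub_cancel,
      mul_comm]

/-! ### The Lax operator -/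

theorem kOp_apply (k : ℤ) : kOp.1 k =
    if k = 1 then 1 else if k = 0 then field 0 else if k = -1 then qpow 1 else 0 := by
  simp only [kOp, Op.add_apply, Op.mono_apply]
  split_ifs <;> first | omega | simp

theorem kOp_val : kOp.1 =
    (Pi.single 1 1 - Pi.single 0 (-field 0)) - Pi.single (-1) (-qpow 1) := by
  funext k
  simp only [kOp_apply, Pi.sub_apply, Pi.single_apply]
  split_ifs <;> first | omega | simp

/-- The counterpart of `adA_coeff` for arbitrary `Q`, which may be unbounded above as the conjugate
of L is; finiteness comes from the three terms of K. -/
theorem comm_kOp_coeff (Q : DiffOp) (k : ℤ) : opComm kOp.1 Q k =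
    PowerSeries.X * nabla (Q (k - 1)) +
    (shift (-(k : ℚ) / 2) (field 0) - shift ((k : ℚ) / 2) (field 0)) * Q k +
    (shift (-((k : ℚ) + 1) / 2) (qpow 1) * shift (-(1 / 2)) (Q (k + 1)) -
      shift (1 / 2) (Q (k + 1)) * shift (((k : ℚ) + 1) / 2) (qpow 1)) := by
  have hf := (single_support_finite (1 : ℤ) 1)
  have hf0 := (single_support_finite (0 : ℤ) (-field 0))
  have hf1 := (single_support_finite (-1 : ℤ) (-qpow 1))
  have hf' : (Function.support (Pi.single 1 1 - Pi.single 0 (-field 0) : DiffOp)).Finite :=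
    (hf.union hf0).subset (Function.support_sub _ _)
  rw [opComm, kOp_val, opMul_sub_left hf' hf1, opMul_sub_left hf hf0, opMul_sub_right hf' hf1,
    opMul_sub_right hf hf0, X_mul_nabla]
  simp only [Pi.sub_apply, single_opMul, opMul_single, shift_one_apply, map_neg]
  push_cast
  simp only [sub_neg_eq_add, neg_neg, sub_zero, zero_div, neg_zero, shift_zero_apply, one_mul,
    mul_one, neg_div]
  ring

/-- Operators satisfying `[K, Q] = ετ ∂Q`. -/
def CommA (Q : DiffOp) : Prop := ∀ k, opComm kOp.1 Q k = PowerSeries.X * (tau * dx (Q k))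

theorem commA_of_adA {X : Op} (h : adA X = 0) : CommA X.1 := fun k => by
  have h1 : (adA X).1 k = (0 : Op).1 k := by rw [h]
  rw [adA_apply, Op.sub_apply, Op.comm_val, coeffwise_apply, epsTauDx_apply, Op.zero_apply,
    sub_eq_zero] at h1
  exact h1

/-- `conj_lax` is applied with T = τ∂ and T' = −τ∂, which the involution interchanges, since τ̄ =
−τ. -/
theorem CommA.conj {A : DiffOp} (h : CommA A) : CommA (opConj A) := by
  intro k
  let T : DiffAlg →+ DiffAlg := (AddMonoidHom.mulLeft tau).comp dx.toAddMonoidHom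
  have hTa : ∀ f, T f = tau * dx f := fun f => rfl
  let T' : DiffAlg →+ DiffAlg := (AddMonoidHom.mulLeft (-tau)).comp dx.toAddMonoidHom
  have hTb : ∀ f, T' f = -tau * dx f := fun f => rfl
  have hf : kOp.1.support.Finite := by
    refine (Set.finite_Icc (-1 : ℤ) 1).subset fun k hk => ?_
    rw [Function.mem_support, kOp_apply] at hk
    by_contra h'
    rw [Set.mem_Icc] at h'
    exact hk (by rw [if_neg (by omega), if_neg (by omega), if_neg (by omega)])
  have h1 := conj_lax (T := T) (T' := T') (fun f g => ?_) (fun s f => ?_) (fun f => ?_)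
    (g := -(tau * opP (field 1))) ?_ hf (fun k => (h k).symm) k
  -- The term −τPu is exactly v̄ − v, so subtracting the conjugate of K from it gives −K.
  · have e : Pi.single 0 (-(tau * opP (field 1))) - opConj kOp.1 = 0 - kOp.1 := by
      funext j
      rw [Pi.sub_apply, Pi.sub_apply, opConj_eq, conjWith, kOp_apply, kOp_apply, Pi.single_apply,
        Pi.zero_apply]
      by_cases h1 : j = 1
      · subst h1
        simp [barHom_qpow, qCoeff_one, qpow_mul_neg]
      by_cases h2 : j = 0
      · subst h2
        have hv : barHom (field 0) = field 0 - tau * opP (field 1) := barHom_v 0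
        simp [qCoeff_zero, hv]
        try ring
      by_cases h3 : j = -1
      · subst h3
        simp [qCoeff_neg_one]
      · rw [if_neg h2, if_neg (by omega), if_neg (by omega), if_neg (by omega), if_neg h1,
          if_neg h2, if_neg h3, map_zero, zero_mul]
    have e2 : opComm (0 - kOp.1) (opConj A) = -opComm kOp.1 (opConj A) := by
      have h0 : (Function.support (0 : DiffOp)).Finite := by simp
      have z1 : opMul 0 (opConj A) = 0 := by funext j; simp [opMul]
      have z2 : opMul (opConj A) 0 = 0 := by funext j; simp [opMul]
      rw [opComm, opMul_sub_left h0 hf, opMul_sub_right h0 hf, z1, z2, opComm]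
      abel
    rw [e, e2, Pi.neg_apply, hTb] at h1
    linear_combination h1
  · simp only [hTb, dx_mul]
    ring
  · rw [hTb, hTb, shift_const_mul s (by rw [map_neg, dx_tau, neg_zero]), shift_dx]
  · simp only [hTa, hTb, map_mul, barHom_tau, barHom_dx]
  · rw [hTb, map_neg, nabla_const_mul dx_tau, nabla_opP, dx_qpow, one_smul]
    change _ = qpow 1 * -(tau * dx (gen (Gen.u 0)))
    rw [dx_gen_u]
    ring

/-- The Lax operator, as an operator bounded above which is determined by its constants of
motion. -/
structure IsToda (L : Op) : Prop where
  monic : L.Monic 1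
  zero : L.1 0 = field 0
  motion : ∀ k : ℕ, 0 < k → motion tau L k = zc k

theorem IsToda.adA {L : Op} (h : IsToda L) : adA L = 0 :=
  adA_eq_zero h.monic h.zero fun k hk => by rw [h.motion k hk, dx_zc]

/-- Only Λ and v survive in L_+, and the strictly negative part of the conjugate comes from Λ alone,
as qΛ⁻¹. -/
theorem opK_eq {L : Op} (h1 : L.Monic 1) (h2 : L.1 0 = field 0) : opK L.1 = kOp.1 := by
  funext k
  rw [opK, Pi.add_apply, opPlus, opMinus, kOp_apply, opConj_eq, conjWith]
  by_cases hk : 0 ≤ k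
  · rw [if_pos hk, if_neg (by omega), add_zero]
    by_cases h3 : k = 1
    · rw [if_pos h3, h3, h1.lead]
    by_cases h4 : k = 0
    · rw [if_neg h3, if_pos h4, h4, h2]
    rw [if_neg h3, if_neg h4, if_neg (by omega), h1.le k (by omega)]
  · rw [if_neg hk, if_pos (by omega), zero_add, if_neg (by omega), if_neg (by omega)]
    by_cases h3 : k = -1
    · subst h3
      rw [if_pos rfl, neg_neg, h1.lead, map_one, one_mul, qCoeff_neg_one]
    · rw [if_neg h3, h1.le (-k) (by omega), map_zero, zero_mul]

theorem IsToda.isEquivariantToda {L : Op} (h : IsToda L) : IsEquivariantToda L.1 where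
  top := h.monic.le
  one := h.monic.lead
  zero := h.zero
  constraint := by
    rw [opK_eq h.monic h.zero]
    exact commA_of_adA h.adA
  constraint_bar := by
    rw [opK_eq h.monic h.zero]
    exact (commA_of_adA h.adA).conj
  constants k hk := by
    rw [← Op.pow_val]
    exact h.motion k hk

theorem IsEquivariantToda.exists_op {A : DiffOp} (h : IsEquivariantToda A) :
    ∃ L : Op, L.1 = A ∧ IsToda L :=
  ⟨⟨A, 1, h.top⟩, rfl, ⟨h.top, h.one⟩, h.zero, fun k hk => by
    unfold EqToda.motion
    rw [Op.pow_val]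
    exact h.constants k hk⟩

/-- The constants of motion determine L, and both constraints are then automatic. -/
theorem existsUnique_toda : ∃! L : DiffOp, IsEquivariantToda L := by
  obtain ⟨L, h1, h2, h3⟩ := exists_motion (field 0) tau zc
  have hL : IsToda L := ⟨h1, h2, h3⟩
  refine ⟨L.1, hL.isEquivariantToda, fun A hA => ?_⟩
  obtain ⟨L', rfl, h'⟩ := hA.exists_op
  rw [eq_of_motion h'.monic h1 tau (h'.zero.trans h2.symm) fun k hk => by
    rw [h'.motion k hk, h3 k hk]]

/-! ### Flows -/

/-- The map `f ↦ ε T f`. -/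
def epsMul (T : DiffAlg →+ DiffAlg) : DiffAlg →+ DiffAlg :=
  (AddMonoidHom.mulLeft (PowerSeries.X : DiffAlg)).comp T

theorem epsMul_apply (T : DiffAlg →+ DiffAlg) (f : DiffAlg) :
    epsMul T f = PowerSeries.X * T f := rfl

theorem IsEvo.isDer_epsMul {T : DiffAlg →+ DiffAlg} (h : IsEvo T) : IsDer (coeffwise (epsMul T)) :=
  isDer_coeffwise (fun f g => by simp only [epsMul_apply, h.leibniz]; ring)
    fun s f => by rw [epsMul_apply, epsMul_apply, h.shift, shift_X_mul]

theorem IsEvo.motion {T : DiffAlg →+ DiffAlg} (h : IsEvo T) (L : Op) (k : ℕ) :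
    T (EqToda.motion EqToda.tau L k) = T ((L ^ k).1 (-1)) - (qpow 1 * T ((L ^ k).1 1) +
      (L ^ k).1 1 * T (qpow 1)) - EqToda.tau * EqToda.opP (T ((L ^ k).1 0)) := by
  rw [EqToda.motion, map_sub, map_sub, h.const_mul h.tau, h.leibniz, h.opP]

theorem evHom_comm (A B : Op) (k : ℤ) : evHom ((A * B - B * A).1 k) = 0 := by
  rw [Op.sub_apply, map_sub, evHom_mul_comm, sub_self]

/-- A derivation compatible with the zero curvature equation satisfies the Lax equation. -/
theorem lax_of_zero_curvature {L : Op} (hL : IsToda L) {T : DiffAlg →+ DiffAlg} (hT : IsEvo T)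
    {B : Op} (hK : coeffwise (epsMul T) kOp = -adA B)
    (hM : (coeffwise (epsMul T) L - (B * L - L * B)).Le (-1)) :
    coeffwise (epsMul T) L = B * L - L * B := by
  rw [← sub_eq_zero]
  set d := coeffwise (epsMul T) - (AddMonoidHom.mulLeft B - AddMonoidHom.mulRight B) with hd
  have hda : ∀ X, d X = coeffwise (epsMul T) X - (B * X - X * B) := fun X => rfl
  have hder : IsDer d := hT.isDer_epsMul.sub (IsDer.ad B)
  -- The zero curvature equation says that d = εT − [B, ·] applied to K gives ετ∂B, which
  -- compensates the commutator of d with ετ∂; hence d(adA L) = adA(dL), and the left side is zero.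
  have hcomm : adA (d L) = 0 := by
    have h1 : ∀ X, coeffwise (epsMul T) (coeffwise epsTauDx X) =
        coeffwise epsTauDx (coeffwise (epsMul T) X) := fun X => Op.ext' fun k => by
      simp only [coeffwise_apply, epsMul_apply, epsTauDx_apply]
      rw [hT.eps, hT.const_mul hT.tau, hT.dx, dx_X_mul]
      ring
    have h2 : d kOp = coeffwise epsTauDx B := by
      rw [hda, hK, adA_apply]
      abel
    have h3 : d (adA L) = (d kOp * L - L * d kOp) + (kOp * d L - d L * kOp) -
        d (coeffwise epsTauDx L) := by
      rw [adA_apply, map_sub, hder.comm]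
    rw [hL.adA, map_zero, h2] at h3
    have h4 : d (coeffwise epsTauDx L) = coeffwise epsTauDx (d L) +
        (coeffwise epsTauDx B * L - L * coeffwise epsTauDx B) := by
      rw [hda, hda, h1, map_sub, isDer_epsTauDx.comm B L]
      abel
    rw [h4] at h3
    rw [adA_apply]
    rw [eq_comm, sub_eq_zero] at h3
    rw [sub_eq_zero]
    have h5 := congrArg (fun X => X - (coeffwise epsTauDx B * L - L * coeffwise epsTauDx B)) h3
    simpa using h5
  refine Op.eq_zero_of_le hM fun m hm hle => ?_
  rw [← hda] at hle ⊢
  obtain ⟨k, rfl⟩ : ∃ k : ℕ, m = -k := ⟨(-m).toNat, by omega⟩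
  have hk : 0 < k := by omega
  -- The leading coefficient is a constant, so on it the series operator in `pow_lead` is
  -- multiplication by k.
  have hdx := dx_lead_of_adA hle hcomm
  obtain ⟨h1, h2⟩ := hder.pow_lead hL.monic hle k
  rw [show (k : ℤ) - 1 + -k = -1 by ring] at h1 h2
  rw [opSeries_const _ hdx, constantCoeff_powSeries] at h2
  have hcoef : ∀ j, PowerSeries.X * T ((L ^ k).1 j) =
      (B * L ^ k - L ^ k * B).1 j + (d (L ^ k)).1 j := fun j => by
    simp only [hda, Op.sub_apply, coeffwise_apply, epsMul_apply]
    ring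
  have hz := hT.motion L k
  rw [hL.motion k hk] at hz
  have hz' : T (zc k) = 0 := hT.z _
  have hev : evHom (PowerSeries.X * T (qpow 1)) = 0 := by
    have h5 := congrArg (fun A : Op => A.1 (-1)) hK
    simp only [coeffwise_apply, epsMul_apply, Op.neg_apply, adA_apply, Op.sub_apply] at h5
    rw [kOp_apply] at h5
    norm_num at h5
    rw [h5, map_sub, epsTauDx_apply, ← Op.sub_apply, evHom_comm, map_mul, map_mul, evHom_dx]
    simp
  have h6 : PowerSeries.X * T (zc k) = _ := congrArg (fun f => PowerSeries.X * f) hz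
  rw [hz', mul_sub, mul_sub, mul_add, mul_left_comm _ (qpow 1), mul_left_comm _ ((L ^ k).1 1),
    mul_left_comm _ tau, ← opP_X_mul, hcoef, hcoef, hcoef, h2, h1 0 (by norm_num),
    h1 1 (by norm_num)] at h6
  -- Evaluation at vanishing derivatives annihilates every commutator and εT(q). Since T z_k = 0,
  -- what remains says that k times the leading coefficient is zero.
  have h7 := congrArg evHom h6
  simp only [map_sub, map_add, map_mul, evHom_comm, add_zero, mul_zero, map_zero, zero_add] at h7
  rw [← map_mul, hev, opP, evHom_opSeries, evHom_comm, smul_zero, mul_zero, mul_zero, sub_zero,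
    sub_zero, evHom_of_dx (by rw [map_smul, hdx, smul_zero])] at h7
  exact (smul_eq_zero.1 h7.symm).resolve_left (by exact_mod_cast hk.ne')

/-- The part of negative order, with the opposite sign. -/
def negMinus (Q : DiffOp) : Op := ⟨-opMinus Q, -1, fun k hk => by
  rw [Pi.neg_apply, opMinus, if_neg (by omega), neg_zero]⟩

theorem negMinus_apply (Q : DiffOp) (k : ℤ) :
    (negMinus Q).1 k = if k < 0 then -Q k else 0 := by
  change -(if k < 0 then Q k else 0) = _
  split_ifs <;> simp

theorem negMinus_le (Q : DiffOp) : (negMinus Q).Le (-1) := fun k hk => by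
  rw [negMinus_apply, if_neg (by omega)]

/-- K couples only neighbouring degrees, so cutting Q between degrees 0 and −1 disturbs the relation
[K, Q] = ετ∂Q only in these two degrees. -/
theorem adA_negMinus {Q : DiffOp} (hQ : CommA Q) (k : ℤ) : (adA (negMinus Q)).1 k =
    if k = 0 then -(PowerSeries.X * nabla (Q (-1))) else
      if k = -1 then -(PowerSeries.X * (qpow 1 * nabla (Q 0))) else 0 := by
  rcases lt_trichotomy k (-1) with hk | rfl | hk
  · rw [if_neg (by omega), if_neg (by omega), adA_coeff, negMinus_apply, negMinus_apply,
      negMinus_apply, if_pos (by omega), if_pos (by omega), if_pos (by omega)]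
    have h := hQ k
    rw [comm_kOp_coeff] at h
    simp only [map_neg]
    linear_combination -h
  · rw [if_neg (by omega), if_pos rfl, adA_coeff, negMinus_apply, negMinus_apply,
      negMinus_apply, if_pos (by omega), if_pos (by omega), if_neg (by omega), mul_left_comm _ (qpow 1),
      X_mul_nabla (Q 0)]
    have h := hQ (-1)
    rw [comm_kOp_coeff] at h
    norm_num [shift_zero_apply] at h ⊢
    linear_combination -h
  · by_cases h0 : k = 0
    · subst h0
      rw [if_pos rfl, adA_coeff, negMinus_apply, negMinus_apply, negMinus_apply]
      norm_num
      try ring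
    · rw [if_neg h0, if_neg (by omega), adA_coeff, negMinus_apply, negMinus_apply,
        negMinus_apply, if_neg (by omega), if_neg (by omega), if_neg (by omega)]
      simp

/-- The prescribed evolution of v and u is the zero curvature equation for −Q_-. `Q` ranges over all
formal operators because it is used for L^n and also for the conjugate of L^n. -/
theorem lax_of_negMinus {L : Op} (hL : IsToda L) {T : DiffAlg →+ DiffAlg} (hT : IsEvo T)
    {Q : DiffOp} (hQ : CommA Q) (hv : T (field 0) = nabla (Q (-1)))
    (hu : T (field 1) = nabla (Q 0)) :
    coeffwise (epsMul T) L = negMinus Q * L - L * negMinus Q := by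
  refine lax_of_zero_curvature hL hT (Op.ext' fun k => ?_) ?_
  · rw [Op.neg_apply, adA_negMinus hQ, coeffwise_apply, epsMul_apply, kOp_apply]
    by_cases h1 : k = 1
    · subst h1; simp [leibniz_one hT.leibniz]
    by_cases h2 : k = 0
    · subst h2; simp [hv]
    by_cases h3 : k = -1
    · subst h3; simp [hT.log, hu]
    · simp [h1, h2, h3]
  · have hle : (coeffwise (epsMul T) L).Le 0 := by
      refine Op.Le.pred (n := 1) (coeffwise_le hL.monic.le) ?_
      rw [coeffwise_apply, hL.monic.lead, epsMul_apply, leibniz_one hT.leibniz, mul_zero]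
    have h1 := (negMinus_le Q).mul hL.monic.le
    have h2 := hL.monic.le.mul (negMinus_le Q)
    -- The degree 0 part of the Lax equation is the prescribed equation for v.
    refine Op.Le.pred (n := 0) (hle.sub (h1.sub h2)) ?_
    have e1 := Op.mul_lead (negMinus_le Q) hL.monic.le
    have e2 := Op.mul_lead hL.monic.le (negMinus_le Q)
    norm_num at e1 e2
    rw [Op.sub_apply, Op.sub_apply, e1, e2, hL.monic.lead, shift_one_apply, shift_one_apply,
      coeffwise_apply, epsMul_apply, hL.zero, hv, X_mul_nabla, negMinus_apply, if_pos (by omega),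
      map_neg, map_neg]
    norm_num
    try ring

/-! ### The two families of flows -/

/-- The conjugate of an additive map by the involution. -/
def barConj (T : DiffAlg →+ DiffAlg) : DiffAlg →+ DiffAlg :=
  barHom.toAddMonoidHom.comp (T.comp barHom.toAddMonoidHom)

theorem barConj_apply (T : DiffAlg →+ DiffAlg) (f : DiffAlg) :
    barConj T f = barHom (T (barHom f)) := rfl

theorem barConj_barHom (T : DiffAlg →+ DiffAlg) (f : DiffAlg) :
    barConj T (barHom f) = barHom (T f) := by rw [barConj_apply, barHom_barHom]

theorem barHom_barConj (T : DiffAlg →+ DiffAlg) (f : DiffAlg) :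
    barHom (barConj T f) = T (barHom f) := by rw [barConj_apply, barHom_barHom]

theorem barHom_field_zero : barHom (field 0) = field 0 - tau * opP (field 1) := barHom_v 0

theorem barHom_field_one : barHom (field 1) = field 1 := barHom_u 0

theorem IsEvo.barConj {T : DiffAlg →+ DiffAlg} (h : IsEvo T) : IsEvo (barConj T) where
  eps f := by rw [barConj_apply, barHom_X_mul, h.eps, barHom_X_mul, barConj_apply]
  leibniz f g := by
    simp only [barConj_apply, map_mul, h.leibniz, map_add, barHom_barHom]
  dx f := by rw [barConj_apply, barHom_dx, h.dx, barHom_dx, barConj_apply]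
  tau := by rw [barConj_apply, barHom_tau, map_neg, h.tau, neg_zero, map_zero]
  z k := by rw [barConj_apply, barHom_gen, barGen, h.zbar, map_zero]
  zbar k := by rw [barConj_apply, barHom_gen, barGen, h.z, map_zero]
  log := by
    rw [barConj_apply, barHom_qpow, h.log, map_mul, barHom_qpow, barConj_apply, barHom_field_one]

/-- The values of the flow `∂_n` on the fields. -/
def flowField (L : Op) (n : ℕ) : Fin 2 → DiffAlg :=
  ![nabla ((L ^ n).1 (-1)), nabla ((L ^ n).1 0)]

/-- The flow `∂_n`. -/
def flow (L : Op) (n : ℕ) : DiffAlg →+ DiffAlg := evol (flowField L n)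

theorem isEvo_flow (L : Op) (n : ℕ) : IsEvo (flow L n) := isEvo_evol _

theorem flow_field_zero (L : Op) (n : ℕ) : flow L n (field 0) = nabla ((L ^ n).1 (-1)) :=
  evol_field _ 0

theorem flow_field_one (L : Op) (n : ℕ) : flow L n (field 1) = nabla ((L ^ n).1 0) :=
  evol_field _ 1

theorem IsToda.commA_pow {L : Op} (hL : IsToda L) (n : ℕ) : CommA (L ^ n).1 :=
  commA_of_adA (isDer_adA.pow_eq_zero hL.adA n)

theorem flow_lax {L : Op} (hL : IsToda L) (n : ℕ) (k : ℤ) :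
    PowerSeries.X * flow L n (L.1 k) = opComm (opPlus (opPow L.1 n)) L.1 k := by
  have h := lax_of_negMinus hL (isEvo_flow L n) (hL.commA_pow n) (flow_field_zero L n)
    (flow_field_one L n)
  have hB : negMinus (L ^ n).1 + L ^ n = ⟨opPlus (L ^ n).1, (L ^ n).2.imp fun m hm k hk => by
      rw [opPlus, hm k hk, ite_self]⟩ := Op.ext' fun j => by
    rw [Op.add_apply, negMinus_apply]
    change _ = if 0 ≤ j then _ else _
    by_cases hj : 0 ≤ j
    · rw [if_neg (by omega), if_pos hj, zero_add]
    · rw [if_pos (by omega), if_neg hj, neg_add_cancel]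
  -- L^n commutes with L, so −(L^n)_- may be replaced by (L^n)_+.
  have h2 : negMinus (L ^ n).1 * L - L * negMinus (L ^ n).1 =
      (negMinus (L ^ n).1 + L ^ n) * L - L * (negMinus (L ^ n).1 + L ^ n) := by
    rw [add_mul, mul_add, ← pow_succ, ← pow_succ']
    abel
  rw [h2, hB] at h
  have h3 := congrArg (fun A : Op => A.1 k) h
  rw [← Op.pow_val]
  exact h3

theorem flow_barConj_lax {L : Op} (hL : IsToda L) {n : ℕ} (hn : 0 < n) (k : ℤ) :
    PowerSeries.X * barConj (flow L n) (L.1 k) =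
      opComm (-opMinus (opPow (opConj L.1) n)) L.1 k := by
  have hcoef : ∀ j, opConj (L ^ n).1 j = barHom ((L ^ n).1 (-j)) * qCoeff j := fun j => rfl
  have h := lax_of_negMinus hL (isEvo_flow L n).barConj (hL.commA_pow n).conj ?_ ?_
  · rw [opConj_pow]
    exact congrArg (fun A : Op => A.1 k) h
  · have hm := hL.motion n hn
    rw [motion] at hm
    -- Applying ∇ to the n-th constant of motion gives ∇p_{-1} − τ∂p_0 = ∇(q p_1). The left side is
    -- the flow of v̄, and the conjugate of the right side is ∇ of the Λ⁻¹ coefficient of the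
    -- conjugate of L^n.
    have h1 := congrArg nabla hm
    rw [nabla_const (dx_zc n), map_sub, map_sub, sub_right_comm, sub_eq_zero] at h1
    rw [barConj_apply, barHom_field_zero, map_sub, (isEvo_flow L n).const_mul (isEvo_flow L n).tau,
      (isEvo_flow L n).opP, flow_field_zero, flow_field_one, opP_nabla, ← nabla_opP,
      ← nabla_const_mul dx_tau, h1, barHom_nabla, map_mul, barHom_qpow, hcoef, qCoeff_neg_one,
      neg_neg, mul_comm]
  · rw [barConj_apply, barHom_field_one, flow_field_one, barHom_nabla, hcoef, qCoeff_zero, mul_one,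
      neg_zero]

theorem opPlus_support_finite {A : DiffOp} (h : ∃ n, OrdLE A n) :
    (opPlus A).support.Finite := by
  obtain ⟨n, hn⟩ := h
  refine (Set.finite_Icc 0 n).subset fun k hk => ?_
  rw [Function.mem_support, opPlus] at hk
  rw [Set.mem_Icc]
  by_contra h'
  refine hk ?_
  split_ifs with h0
  · exact hn k (by omega)
  · rfl

theorem opMinus_opConj_support_finite {A : DiffOp} (h : ∃ n, OrdLE A n) :
    (-opMinus (opConj A)).support.Finite := by
  obtain ⟨n, hn⟩ := h
  refine (Set.finite_Icc (-n) 0).subset fun k hk => ?_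
  rw [Function.mem_support, Pi.neg_apply, opMinus] at hk
  rw [Set.mem_Icc]
  by_contra h'
  refine hk ?_
  split_ifs with h0
  · rw [opConj_eq, conjWith, hn (-k) (by omega), map_zero, zero_mul, neg_zero]
  · exact neg_zero

/-- Conjugation of `flow_lax`: with g equal to p̄_0(n), subtracting the conjugate of (L^n)_+ leaves
minus the negative part of the conjugate of L^n. -/
theorem flow_barConj_lax_bar {L : Op} (hL : IsToda L) (n : ℕ) (k : ℤ) :
    PowerSeries.X * barConj (flow L n) (opConj L.1 k) =
      opComm (-opMinus (opPow (opConj L.1) n)) (opConj L.1) k := by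
  have hT := (isEvo_flow L n).barConj
  have h := conj_lax (g := barHom ((L ^ n).1 0)) hT.leibniz hT.shift (barConj_barHom (flow L n))
    (by rw [hT.log, barConj_apply, barHom_field_one, flow_field_one, barHom_nabla])
    (by rw [← Op.pow_val]; exact opPlus_support_finite (L ^ n).2) (flow_lax hL n) k
  rw [h, opConj_pow, ← Op.pow_val]
  congr 2
  funext j
  rw [Pi.sub_apply, Pi.neg_apply, opConj_eq, conjWith, opMinus, opPlus, Pi.single_apply,
    opConj_eq, conjWith]
  rcases lt_trichotomy j 0 with hj | rfl | hj
  · rw [if_neg (by omega), if_pos (by omega), if_pos hj, zero_sub]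
  · simp [qCoeff_zero]
  · rw [if_neg (by omega), if_neg (by omega), if_neg (by omega)]; simp

/-- Conjugation of `flow_barConj_lax`, with g = p_0(n) supplying the degree 0 term of (L^n)_+. -/
theorem flow_lax_bar {L : Op} (hL : IsToda L) {n : ℕ} (hn : 0 < n) (k : ℤ) :
    PowerSeries.X * flow L n (opConj L.1 k) =
      opComm (opPlus (opPow L.1 n)) (opConj L.1) k := by
  have hT := isEvo_flow L n
  have h := conj_lax (g := (L ^ n).1 0) hT.leibniz hT.shift
    (fun f => (barHom_barConj (flow L n) f).symm) (by rw [hT.log, flow_field_one])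
    (by rw [opConj_pow]; exact opMinus_opConj_support_finite (L ^ n).2) (flow_barConj_lax hL hn) k
  rw [h, opConj_pow, ← Op.pow_val]
  congr 2
  funext j
  rw [Pi.sub_apply, opConj_eq, conjWith, Pi.neg_apply, opMinus, opPlus, Pi.single_apply,
    opConj_eq, conjWith]
  rcases lt_trichotomy j 0 with hj | rfl | hj
  · rw [if_neg (by omega), if_neg (by omega), if_neg (by omega)]; simp
  · simp
  · rw [if_neg (by omega), if_pos (by omega), if_pos (by omega), map_neg, map_mul, barHom_barHom,
      ringHom_qCoeff barHom_shift barHom_qpow, neg_neg j]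
    linear_combination (L ^ n).1 j * qCoeff_neg_mul j

/-- The derivation defined by an evolutionary map. -/
def IsEvo.toDer {T : DiffAlg →+ DiffAlg} (h : IsEvo T) : Derivation ℚ DiffAlg DiffAlg :=
  Derivation.mk' T.toRatLinearMap h.leibniz

theorem IsEvo.toDer_apply {T : DiffAlg →+ DiffAlg} (h : IsEvo T) (f : DiffAlg) :
    h.toDer f = T f := rfl

theorem IsEvo.isEvolutionary {T : DiffAlg →+ DiffAlg} (h : IsEvo T) : IsEvolutionary h.toDer where
  eps := by
    rw [h.toDer_apply, ← mul_one (PowerSeries.X : DiffAlg), h.eps, leibniz_one h.leibniz, mul_zero]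
  tau := by rw [h.toDer_apply, h.tau]
  log := by rw [h.toDer_apply, h.toDer_apply, h.log]
  comm f := by rw [h.toDer_apply, h.toDer_apply, h.dx]

theorem isFlow_flow {L : Op} (hL : IsToda L) {n : ℕ} (hn : 0 < n) :
    IsFlow L.1 n (isEvo_flow L n).toDer where
  evol := (isEvo_flow L n).isEvolutionary
  lax k := by rw [IsEvo.toDer_apply, flow_lax hL n]
  lax_bar k := by rw [IsEvo.toDer_apply, flow_lax_bar hL hn]

theorem isFlowBar_flow {L : Op} (hL : IsToda L) {n : ℕ} (hn : 0 < n) :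
    IsFlowBar L.1 n (isEvo_flow L n).barConj.toDer where
  evol := (isEvo_flow L n).barConj.isEvolutionary
  lax k := by rw [IsEvo.toDer_apply, flow_barConj_lax hL hn]
  lax_bar k := by rw [IsEvo.toDer_apply, flow_barConj_lax_bar hL n]

/-! ### Uniqueness of the flows -/

/-- Each z_k is expressed through coefficients of L^k, q, τ and P, all of which are annihilated or
respected by T. -/
theorem zc_eq_zero_of_lax {L : Op} (hL : IsToda L) {T : DiffAlg →+ DiffAlg}
    (hX : ∀ f, T (PowerSeries.X * f) = PowerSeries.X * T f)
    (hl : ∀ f g, T (f * g) = f * T g + g * T f) (hdx : ∀ f, T (dx f) = dx (T f))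
    (ht : T tau = 0) (hq : T (qpow 1) = 0) (h : ∀ k, T (L.1 k) = 0) (k : ℕ) (hk : 0 < k) :
    T (zc k) = 0 := by
  have h1 : coeffwise T (L ^ k) = 0 :=
    (isDer_coeffwise hl (shift_commute hX hdx)).pow_eq_zero (Op.ext' h) k
  have h2 : ∀ j, T ((L ^ k).1 j) = 0 := fun j => congrArg (fun A : Op => A.1 j) h1
  rw [← hL.motion k hk, motion, map_sub, map_sub, hl, hl, h2, h2, hq, ht, opP,
    opSeries_commute hX hdx, h2]
  simp

/-- The difference of two flows annihilates the coefficients of L and of its conjugate. This yields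
v, q and u, then the jets by commutation with ∂, then z_k from the constants of motion and z̄_k from
their conjugates; the parameters are not assumed invariant. -/
theorem isLaxFlow_unique {L : Op} (hL : IsToda L) {B : DiffOp}
    {D₁ D₂ : Derivation ℚ DiffAlg DiffAlg} (h₁ : IsLaxFlow L.1 B D₁) (h₂ : IsLaxFlow L.1 B D₂) :
    D₁ = D₂ := by
  set T : DiffAlg →+ DiffAlg := ((D₁ - D₂ : Derivation ℚ DiffAlg DiffAlg) :
    DiffAlg →ₗ[ℚ] DiffAlg).toAddMonoidHom with hT
  have hTa : ∀ f, T f = D₁ f - D₂ f := fun f => rfl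
  have hl : ∀ f g, T (f * g) = f * T g + g * T f := fun f g => (D₁ - D₂).leibniz f g
  have hX : ∀ f, T (PowerSeries.X * f) = PowerSeries.X * T f := fun f => by
    rw [hl, hTa PowerSeries.X, h₁.evol.eps, h₂.evol.eps, sub_self, mul_zero, add_zero]
  have hdx : ∀ f, T (dx f) = dx (T f) := fun f => by
    rw [hTa, h₁.evol.comm, h₂.evol.comm, ← map_sub, hTa]
  have ht : T tau = 0 := by rw [hTa, h₁.evol.tau, h₂.evol.tau, sub_self]
  have hLk : ∀ k, T (L.1 k) = 0 := fun k => X_mul_cancel (by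
    rw [hTa, mul_sub, h₁.lax, h₂.lax, sub_self, mul_zero])
  have hLb : ∀ k, T (opConj L.1 k) = 0 := fun k => X_mul_cancel (by
    rw [hTa, mul_sub, h₁.lax_bar, h₂.lax_bar, sub_self, mul_zero])
  have hv : T (field 0) = 0 := by rw [← hL.zero, hLk]
  have hq : T (qpow 1) = 0 := by
    have := hLb (-1)
    rwa [opConj_eq, conjWith, neg_neg, hL.monic.lead, map_one, one_mul, qCoeff_neg_one] at this
  have hlog : qpow 1 * T (field 1) = 0 := by
    rw [hTa, mul_sub, ← h₁.evol.log, ← h₂.evol.log, ← hTa, hq]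
  have hu : T (field 1) = 0 := (mul_eq_zero.1 hlog).resolve_left (by
    rw [← qCoeff_neg_one]
    exact qCoeff_ne_zero _)
  have hz := zc_eq_zero_of_lax hL hX hl hdx ht hq hLk
  have hqc : ∀ k, T (qCoeff k) = 0 := fun k => X_mul_cancel (by
    rw [der_qCoeff hl (shift_commute hX hdx) (g := 0) (by rw [hq, map_zero, mul_zero])]
    simp)
  have hLb' : ∀ k, T (barHom (L.1 k)) = 0 := fun k => by
    have := hLb (-k)
    rw [opConj_eq, conjWith, neg_neg, hl, hqc, mul_zero, zero_add] at this
    exact (mul_eq_zero.1 this).resolve_left (qCoeff_ne_zero _)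
  have hzb := zc_eq_zero_of_lax hL (T := barConj T)
    (fun f => by rw [barConj_apply, barHom_X_mul, hX, barHom_X_mul, barConj_apply])
    (fun f g => by simp only [barConj_apply, map_mul, hl, map_add, barHom_barHom])
    (fun f => by rw [barConj_apply, barHom_dx, hdx, barHom_dx, barConj_apply])
    (by rw [barConj_apply, barHom_tau, map_neg, ht, neg_zero, map_zero])
    (by rw [barConj_apply, barHom_qpow, hq, map_zero])
    (fun k => by rw [barConj_apply, hLb', map_zero])
  have hgu : ∀ n, T ((dx ^ n) (field 1)) = 0 := fun n => by
    induction n with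
    | zero => exact hu
    | succ n ih => rw [pow_succ', Module.End.mul_apply, hdx, ih, map_zero]
  have hgv : ∀ n, T ((dx ^ n) (field 0)) = 0 := fun n => by
    induction n with
    | zero => exact hv
    | succ n ih => rw [pow_succ', Module.End.mul_apply, hdx, ih, map_zero]
  refine Derivation.ext fun f => ?_
  rw [← sub_eq_zero, ← hTa]
  refine der_ext (T₂ := 0) hX (fun f => by simp) hl (fun f g => by simp) (fun g => ?_) hq f
  rw [AddMonoidHom.zero_apply]
  cases g with
  | tau => exact ht
  | z k => exact hz (k + 1) k.succ_pos
  | zbar k =>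
    refine barHom_injective ?_
    have := hzb (k + 1) k.succ_pos
    rw [barConj_apply, barHom_zc] at this
    rw [map_zero, ← this]
    rfl
  | v n => rw [gen_v_eq, hgv]
  | u n => rw [gen_u_eq, hgu]

/-! ### Inverses of monic operators -/

/-- Approximations to the right inverse of a monic operator of order `a`. -/
def invApprox (A : Op) (a : ℤ) : ℕ → Op
  | 0 => Op.mono (-a) 1
  | n + 1 => invApprox A a n - Op.mono (-a - (n + 1))
      (shift (-(a : ℚ) / 2) ((A * invApprox A a n - 1).1 (-(n + 1))))

theorem invApprox_sub_le (A : Op) (a : ℤ) (n m : ℕ) :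
    (invApprox A a (n + m) - invApprox A a n).Le (-a - (n + 1)) := by
  induction m with
  | zero => simpa using Op.zero_le _
  | succ m ih =>
    rw [← add_assoc, invApprox, sub_right_comm]
    exact ih.sub ((Op.mono_le _ _).trans (by push_cast; omega))

theorem mul_invApprox_le {A : Op} {a : ℤ} (hA : A.Monic a) (n : ℕ) :
    (A * invApprox A a n - 1).Le (-(n + 1)) := by
  have h0 : (Op.mono (-a) 1).Monic (-a) := ⟨Op.mono_le _ _, by rw [Op.mono_apply, if_pos rfl]⟩
  induction n with
  | zero =>
    have h1 := hA.mul h0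
    rw [add_neg_cancel] at h1
    exact Op.Le.pred (h1.le.sub Op.one_le) (by
      rw [Op.sub_apply, h1.lead, Op.monic_one.lead, sub_self])
  | succ n ih =>
    rw [invApprox, mul_sub, sub_right_comm]
    have h2 := hA.le.mul (Op.mono_le (-a - (n + 1))
      (shift (-(a : ℚ) / 2) ((A * invApprox A a n - 1).1 (-(n + 1)))))
    have h3 := Op.mul_lead hA.le (Op.mono_le (-a - (n + 1))
      (shift (-(a : ℚ) / 2) ((A * invApprox A a n - 1).1 (-(n + 1)))))
    rw [show a + (-a - ((n : ℤ) + 1)) = -(n + 1) by ring] at h2 h3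
    rw [show -(((n + 1 : ℕ) : ℤ) + 1) = -((n : ℤ) + 1) - 1 by push_cast; ring]
    refine Op.Le.pred (ih.sub h2) ?_
    -- The shift E^{-a/2} built into `invApprox` is undone by the shift E^{a/2} that the leading Λ^a
    -- applies.
    rw [Op.sub_apply, h3, hA.lead, shift_one_apply, one_mul, Op.mono_apply, if_pos rfl, neg_div,
      shift_apply_neg, sub_self]

theorem Op.Monic.exists_mul_eq_one {A : Op} {a : ℤ} (hA : A.Monic a) :
    ∃ B : Op, B.Monic (-a) ∧ A * B = 1 := by
  have h0 : ∀ n, (invApprox A a n).Monic (-a) := fun n => by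
    have h1 := invApprox_sub_le A a 0 n
    rw [zero_add] at h1
    have h2 : ∀ k : ℤ, -a ≤ k → (invApprox A a n).1 k = if k = -a then 1 else 0 := fun k hk => by
      rw [← Op.mono_apply]
      exact sub_eq_zero.1 (h1 k (by push_cast; omega))
    exact ⟨fun k hk => by rw [h2 k (by omega), if_neg (by omega)], by rw [h2 _ le_rfl, if_pos rfl]⟩
  let B : Op := ⟨fun k => (invApprox A a (-a - k).toNat).1 k, -a, fun k hk => (h0 _).le k hk⟩
  have hB : ∀ n : ℕ, (B - invApprox A a n).Le (-a - (n + 1)) := by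
    intro n k hk
    rw [Op.sub_apply]
    change (invApprox A a (-a - k).toNat).1 k - _ = 0
    obtain ⟨m, hm⟩ := Nat.exists_eq_add_of_le (show (-a - k).toNat ≤ n by omega)
    have := invApprox_sub_le A a (-a - k).toNat m k (by omega)
    rw [Op.sub_apply, ← hm] at this
    rw [← neg_sub, this, neg_zero]
  refine ⟨B, ⟨fun k hk => (h0 _).le k hk, ?_⟩, ?_⟩
  · exact (h0 _).lead
  · rw [← sub_eq_zero]
    refine Op.ext' fun k => ?_
    have h1 := hA.le.mul (hB (-k).toNat)
    have h2 := mul_invApprox_le hA (-k).toNat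
    have h3 := (h1.trans (by omega)).add h2
    rw [show A * (B - invApprox A a (-k).toNat) + (A * invApprox A a (-k).toNat - 1) = A * B - 1 by
      noncomm_ring] at h3
    exact h3 k (by omega)

/-- A right inverse B is monic, hence has a right inverse C; then A = C, so B is a two-sided
inverse. -/
theorem Op.Monic.exists_unit {A : Op} {a : ℤ} (hA : A.Monic a) :
    ∃ U : Opˣ, (U : Op) = A ∧ ((U⁻¹ : Opˣ) : Op).Monic (-a) := by
  obtain ⟨B, hB, h1⟩ := hA.exists_mul_eq_one
  obtain ⟨C, -, h2⟩ := hB.exists_mul_eq_one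
  have h3 : A = C := by rw [← mul_one A, ← h2, ← mul_assoc, h1, one_mul]
  exact ⟨⟨A, B, h1, by rw [h3, h2]⟩, rfl, hB⟩

/-! ### Divisibility by powers of `ε` -/

/-- Divisibility by `ε^N`. -/
def Op.EpsDvd (N : ℕ) (A : Op) : Prop := ∀ k, (PowerSeries.X : DiffAlg) ^ N ∣ A.1 k

theorem Op.EpsDvd.add {N : ℕ} {A B : Op} (hA : A.EpsDvd N) (hB : B.EpsDvd N) :
    (A + B).EpsDvd N := fun k => dvd_add (hA k) (hB k)

theorem Op.EpsDvd.sub {N : ℕ} {A B : Op} (hA : A.EpsDvd N) (hB : B.EpsDvd N) :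
    (A - B).EpsDvd N := fun k => dvd_sub (hA k) (hB k)

theorem Op.EpsDvd.zero (N : ℕ) : (0 : Op).EpsDvd N := fun _ => dvd_zero _

theorem Op.EpsDvd.smul {N : ℕ} {A : Op} (hA : A.EpsDvd N) (r : ℚ) : (r • A).EpsDvd N := fun k => by
  obtain ⟨f, hf⟩ := hA k
  exact ⟨r • f, by rw [Op.smul_apply, hf, mul_smul_comm]⟩

theorem Op.EpsDvd.mono {M N : ℕ} {A : Op} (hA : A.EpsDvd N) (h : M ≤ N) : A.EpsDvd M :=
  fun k => (pow_dvd_pow _ h).trans (hA k)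

theorem Op.EpsDvd.sum {N : ℕ} {ι : Type*} {s : Finset ι} {A : ι → Op}
    (h : ∀ i ∈ s, (A i).EpsDvd N) : (∑ i ∈ s, A i).EpsDvd N := fun k => by
  rw [Op.sum_apply]
  exact Finset.dvd_sum fun i hi => h i hi k

theorem dx_X_pow (N : ℕ) : dx ((PowerSeries.X : DiffAlg) ^ N) = 0 := by
  induction N with
  | zero => rw [pow_zero, dx_one]
  | succ N ih => rw [pow_succ', dx_X_mul, ih, mul_zero]

theorem Op.EpsDvd.exists_eq {N : ℕ} {A : Op} (hA : A.EpsDvd N) :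
    ∃ B : Op, A = Op.const (PowerSeries.X ^ N) * B := by
  choose f hf using hA
  obtain ⟨n, hn⟩ := A.2
  have hX : ((PowerSeries.X : DiffAlg) ^ N) ≠ 0 := pow_ne_zero _ X_ne_zero
  refine ⟨⟨f, n, fun k hk => ?_⟩, Op.ext' fun k => ?_⟩
  · have := hf k
    rw [hn k hk] at this
    exact (mul_eq_zero.1 this.symm).resolve_left hX
  · rw [Op.const_mul_apply (dx_X_pow N), hf]

theorem Op.epsDvd_const_mul (N : ℕ) (A : Op) :
    (Op.const (PowerSeries.X ^ N) * A).EpsDvd N := fun _ =>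
  ⟨_, Op.const_mul_apply (dx_X_pow N) _ _⟩

theorem Op.EpsDvd.mul_left {N : ℕ} {A : Op} (hA : A.EpsDvd N) (B : Op) : (B * A).EpsDvd N := by
  obtain ⟨C, rfl⟩ := hA.exists_eq
  rw [← mul_assoc, ← Op.const_comm (dx_X_pow N), mul_assoc]
  exact Op.epsDvd_const_mul _ _

theorem Op.EpsDvd.mul_right {N : ℕ} {A : Op} (hA : A.EpsDvd N) (B : Op) : (A * B).EpsDvd N := by
  obtain ⟨C, rfl⟩ := hA.exists_eq
  rw [mul_assoc]
  exact Op.epsDvd_const_mul _ _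

theorem constantCoeff_shift (s : ℚ) (f : DiffAlg) :
    PowerSeries.constantCoeff (shift s f) = PowerSeries.constantCoeff f := by
  rw [shift, opSeries_eq_tail, constantCoeff_exp_rescale, one_smul, map_add, map_mul,
    PowerSeries.constantCoeff_X, zero_mul, add_zero]

theorem mul_comm_of_shift_invariant {S : Type*} [CommRing S] (φ : DiffAlg →+* S)
    (h : ∀ s f, φ (shift s f) = φ f) (A B : Op) (k : ℤ) : φ ((A * B).1 k) = φ ((B * A).1 k) := by
  obtain ⟨a, ha⟩ := A.2
  obtain ⟨b, hb⟩ := B.2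
  rw [Op.mul_val, Op.mul_val, opMul_eq_sum ha hb k _ subset_rfl,
    opMul_eq_sum hb ha k _ subset_rfl, map_sum, map_sum]
  refine Finset.sum_nbij' (fun i => k - i) (fun i => k - i) ?_ ?_ ?_ ?_ ?_
  · intro i hi; simp only [Finset.mem_Icc] at hi ⊢; omega
  · intro i hi; simp only [Finset.mem_Icc] at hi ⊢; omega
  · intro i _; ring
  · intro i _; ring
  · intro i _
    rw [map_mul, map_mul, h, h, h, h, sub_sub_cancel, mul_comm]

/-- Modulo ε the shifts are trivial and operators commute, so each commutator gains a factor ε. -/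
theorem Op.EpsDvd.comm {N : ℕ} {B : Op} (hB : B.EpsDvd N) (A : Op) :
    (A * B - B * A).EpsDvd (N + 1) := by
  obtain ⟨C, rfl⟩ := hB.exists_eq
  rw [← mul_assoc, ← Op.const_comm (dx_X_pow N), mul_assoc, mul_assoc, ← mul_sub]
  intro k
  rw [Op.const_mul_apply (dx_X_pow N), pow_succ]
  refine mul_dvd_mul_left _ (PowerSeries.X_dvd_iff.2 ?_)
  rw [Op.sub_apply, map_sub, sub_eq_zero]
  exact mul_comm_of_shift_invariant PowerSeries.constantCoeff constantCoeff_shift A C k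

/-! ### Linear terms of polynomial sequences -/

open Polynomial in
/-- The sequence `F` is polynomial modulo each power of `ε`, with linear coefficient `Y`. -/
def HasLin (F : ℕ → Op) (Y : Op) : Prop := ∀ N : ℕ, ∃ P : Op[X],
  (P.coeff 1 - Y).EpsDvd N ∧ ∀ n : ℕ, (P.eval (n : Op) - F n).EpsDvd N

theorem HasLin.add {F G : ℕ → Op} {Y Z : Op} (hF : HasLin F Y) (hG : HasLin G Z) :
    HasLin (fun n => F n + G n) (Y + Z) := fun N => by
  obtain ⟨P, h1, h2⟩ := hF N
  obtain ⟨Q, h3, h4⟩ := hG N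
  refine ⟨P + Q, ?_, fun n => ?_⟩
  · rw [Polynomial.coeff_add, add_sub_add_comm]; exact h1.add h3
  · rw [Polynomial.eval_add, add_sub_add_comm]; exact (h2 n).add (h4 n)

theorem HasLin.sub {F G : ℕ → Op} {Y Z : Op} (hF : HasLin F Y) (hG : HasLin G Z) :
    HasLin (fun n => F n - G n) (Y - Z) := fun N => by
  obtain ⟨P, h1, h2⟩ := hF N
  obtain ⟨Q, h3, h4⟩ := hG N
  refine ⟨P - Q, ?_, fun n => ?_⟩
  · rw [Polynomial.coeff_sub, sub_sub_sub_comm]; exact h1.sub h3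
  · rw [Polynomial.eval_sub, sub_sub_sub_comm]; exact (h2 n).sub (h4 n)

/-- The product rule for the linear coefficient; the constant terms are the values at n = 0. -/
theorem HasLin.mul {F G : ℕ → Op} {Y Z : Op} (hF : HasLin F Y) (hG : HasLin G Z) :
    HasLin (fun n => F n * G n) (F 0 * Z + Y * G 0) := fun N => by
  obtain ⟨P, h1, h2⟩ := hF N
  obtain ⟨Q, h3, h4⟩ := hG N
  have key : ∀ {a b c d : Op}, (a - c).EpsDvd N → (b - d).EpsDvd N → (a * b - c * d).EpsDvd N := by
    intro a b c d h h'
    rw [show a * b - c * d = a * (b - d) + (a - c) * d by noncomm_ring]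
    exact (h'.mul_left a).add (h.mul_right d)
  have hP := h2 0
  have hQ := h4 0
  rw [Nat.cast_zero, ← Polynomial.coeff_zero_eq_eval_zero] at hP hQ
  refine ⟨P * Q, ?_, fun n => ?_⟩
  · rw [Polynomial.mul_coeff_one, add_sub_add_comm]
    exact (key hP h3).add (key h1 hQ)
  -- Although operators do not commute, evaluation is multiplicative here because natural numbers
  -- are central.
  · rw [Polynomial.eval, Polynomial.eval₂_mul_noncomm _ _ fun k => Nat.commute_cast _ _]
    exact key (h2 n) (h4 n)

theorem HasLin.map {F : ℕ → Op} {Y : Op} (hF : HasLin F Y) (f : Op →+ Op)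
    (h : ∀ N A, Op.EpsDvd N A → (f A).EpsDvd N) : HasLin (fun n => f (F n)) (f Y) := fun N => by
  obtain ⟨P, h1, h2⟩ := hF N
  refine ⟨∑ i ∈ Finset.range (P.natDegree + 2), Polynomial.monomial i (f (P.coeff i)), ?_,
    fun n => ?_⟩
  · rw [Polynomial.finsetSum_coeff]
    simp only [Polynomial.coeff_monomial]
    rw [Finset.sum_ite_eq' _ 1, if_pos (by simp), ← map_sub]
    exact h N _ h1
  · have e : Polynomial.eval (n : Op) (∑ i ∈ Finset.range (P.natDegree + 2),
        Polynomial.monomial i (f (P.coeff i))) = f (P.eval (n : Op)) := by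
      rw [Polynomial.eval_finsetSum, Polynomial.eval_eq_sum_range' (n := P.natDegree + 2) (by omega),
        map_sum]
      refine Finset.sum_congr rfl fun i _ => ?_
      rw [Polynomial.eval_monomial, ← Nat.cast_pow, ← nsmul_eq_mul', ← nsmul_eq_mul', map_nsmul]
    rw [e, ← map_sub]
    exact h N _ (h2 n)

/-- Linear functionals reduce the claim to rational polynomials, where vanishing at all natural
numbers gives infinitely many roots. -/
theorem polynomial_coeff_eq_zero {V : Type*} [AddCommGroup V] [Module ℚ V] (M : ℕ) (p : ℕ → V)
    (h : ∀ n : ℕ, ∑ i ∈ Finset.range M, ((n : ℚ) ^ i) • p i = 0) (i : ℕ) (hi : i < M) :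
    p i = 0 := by
  rw [← Module.forall_dual_apply_eq_zero_iff ℚ]
  intro φ
  let P : Polynomial ℚ := ∑ i ∈ Finset.range M, Polynomial.monomial i (φ (p i))
  have h1 : P = 0 := by
    refine Polynomial.eq_zero_of_infinite_isRoot P
      ((Set.infinite_range_of_injective (f := fun n : ℕ => (n : ℚ)) Nat.cast_injective).mono ?_)
    rintro _ ⟨n, rfl⟩
    have h2 := congrArg φ (h n)
    rw [map_zero, map_sum] at h2
    change P.eval (n : ℚ) = 0
    rw [← h2, Polynomial.eval_finsetSum]
    refine Finset.sum_congr rfl fun i _ => ?_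
    rw [Polynomial.eval_monomial, map_smul, smul_eq_mul, mul_comm]
  have h3 := congrArg (fun Q : Polynomial ℚ => Q.coeff i) h1
  simpa [P, Polynomial.finsetSum_coeff, Polynomial.coeff_monomial, hi] using h3

/-- The linear coefficient satisfies the linear conditions satisfied by the sequence. -/
theorem HasLin.mem {F : ℕ → Op} {Y : Op} (hF : HasLin F Y) (U : Submodule ℚ DiffPoly) (k : ℤ)
    (h : ∀ n m, PowerSeries.coeff m ((F n).1 k) ∈ U) (m : ℕ) : PowerSeries.coeff m (Y.1 k) ∈ U := by
  obtain ⟨P, h1, h2⟩ := hF (m + 1)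
  have key : ∀ {A : Op}, A.EpsDvd (m + 1) → PowerSeries.coeff m (A.1 k) = 0 := fun hA =>
    PowerSeries.X_pow_dvd_iff.1 (hA k) m m.lt_succ_self
  have h3 := key h1
  rw [Op.sub_apply, map_sub, sub_eq_zero] at h3
  -- At a fixed order in ε and modulo `U`, the polynomial vanishes at every natural number, so all
  -- its coefficients vanish, the linear one among them.
  rw [← h3, ← Submodule.Quotient.mk_eq_zero]
  refine polynomial_coeff_eq_zero (P.natDegree + 2)
    (fun i => U.mkQ (PowerSeries.coeff m ((P.coeff i).1 k))) (fun n => ?_) 1 (by omega)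
  have h4 := key (h2 n)
  rw [Op.sub_apply, map_sub, sub_eq_zero] at h4
  have h5 := h n m
  rw [← h4, ← Submodule.Quotient.mk_eq_zero,
    Polynomial.eval_eq_sum_range' (n := P.natDegree + 2) (by omega), Op.sum_apply, map_sum] at h5
  rw [← h5]
  change _ = U.mkQ _
  rw [map_sum]
  refine Finset.sum_congr rfl fun i _ => ?_
  rw [← Nat.cast_pow, ← Nat.cast_pow, ← nsmul_eq_mul', ← map_smul, ← coeff_rat_smul,
    ← Op.smul_apply, Nat.cast_smul_eq_nsmul]

theorem HasLin.apply_eq_zero {F : ℕ → Op} {Y : Op} (hF : HasLin F Y) (k : ℤ)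
    (h : ∀ n, (F n).1 k = 0) : Y.1 k = 0 := by
  ext1 m
  exact (hF.mem ⊥ k (fun n m => by rw [h, map_zero]; exact Submodule.zero_mem _) m)

theorem HasLin.le {F : ℕ → Op} {Y : Op} (hF : HasLin F Y) {m : ℤ} (h : ∀ n, (F n).Le m) : Y.Le m :=
  fun k hk => hF.apply_eq_zero k fun n => h n k hk

theorem HasLin.unique {F : ℕ → Op} {Y Z : Op} (hY : HasLin F Y) (hZ : HasLin F Z) : Y = Z := by
  rw [← sub_eq_zero]
  exact Op.ext' fun k => (hY.sub hZ).apply_eq_zero k fun n => by rw [sub_self, Op.zero_apply]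

theorem mem_exact_iff {f : DiffAlg} : f ∈ exact ↔
    ∀ m, PowerSeries.coeff m f ∈ LinearMap.range (dx₀ : DiffPoly →ₗ[ℚ] DiffPoly) := by
  constructor
  · rintro ⟨g, rfl⟩ m
    exact ⟨_, (coeff_dx g m).symm⟩
  · intro h
    choose g hg using h
    refine ⟨PowerSeries.mk g, ?_⟩
    ext1 m
    rw [coeff_dx, PowerSeries.coeff_mk]
    exact hg m

theorem HasLin.mem_exact {F : ℕ → Op} {Y : Op} (hF : HasLin F Y) (k : ℤ)
    (h : ∀ n, (F n).1 k ∈ exact) : Y.1 k ∈ exact :=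
  mem_exact_iff.2 (hF.mem _ k fun n m => mem_exact_iff.1 (h n) m)

theorem hasLin_const (A : Op) : HasLin (fun _ => A) 0 := fun N =>
  ⟨Polynomial.C A, by simpa using Op.EpsDvd.zero N, fun n => by simpa using Op.EpsDvd.zero N⟩

theorem hasLin_nsmul (A : Op) : HasLin (fun n => n • A) A := fun N =>
  ⟨Polynomial.monomial 1 A, by simpa using Op.EpsDvd.zero N, fun n => by
    rw [Polynomial.eval_monomial, pow_one, ← nsmul_eq_mul', sub_self]
    exact Op.EpsDvd.zero N⟩

/-- The polynomial `p(t) A`. -/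
def polySmul (p : Polynomial ℚ) (A : Op) : Polynomial Op :=
  ∑ i ∈ Finset.range (p.natDegree + 2), Polynomial.monomial i (p.coeff i • A)

theorem coeff_polySmul (p : Polynomial ℚ) (A : Op) : (polySmul p A).coeff 1 = p.coeff 1 • A := by
  rw [polySmul, Polynomial.finsetSum_coeff]
  simp only [Polynomial.coeff_monomial]
  rw [Finset.sum_ite_eq' _ 1, if_pos (by simp)]

theorem eval_polySmul (p : Polynomial ℚ) (A : Op) (n : ℕ) :
    (polySmul p A).eval (n : Op) = p.eval (n : ℚ) • A := by
  rw [polySmul, Polynomial.eval_finsetSum,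
    Polynomial.eval_eq_sum_range' (n := p.natDegree + 2) (by omega), Finset.sum_smul]
  refine Finset.sum_congr rfl fun i _ => ?_
  rw [Polynomial.eval_monomial, ← Nat.cast_pow, ← nsmul_eq_mul', ← Nat.cast_smul_eq_nsmul ℚ,
    smul_smul, mul_comm, Nat.cast_pow]

/-- The polynomial `t (t - 1) ⋯ (t - k + 1) / k!`. -/
def binomPoly (k : ℕ) : Polynomial ℚ := Polynomial.C ((k.factorial : ℚ)⁻¹) * descPochhammer ℚ k

theorem eval_binomPoly (k n : ℕ) : (binomPoly k).eval (n : ℚ) = n.choose k := by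
  rw [binomPoly, Polynomial.eval_C_mul, descPochhammer_eval_eq_descFactorial,
    Nat.descFactorial_eq_factorial_mul_choose, Nat.cast_mul, inv_mul_cancel_left₀]
  exact_mod_cast k.factorial_ne_zero

/-- A Newton series in binomial coefficients. Modulo ε^N only the terms k ≤ N count, and each
binomial coefficient is a polynomial in n. -/
theorem exists_hasLin_of_sum {a : ℕ → Op} {b : ℤ} (hb : ∀ k, (a k).Le b)
    (ha : ∀ k, (a (k + 1)).EpsDvd k) {F : ℕ → Op}
    (hF : ∀ n, F n = ∑ k ∈ Finset.range (n + 1), n.choose k • a k) : ∃ Y, HasLin F Y := by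
  -- The coefficient of ε^m receives contributions from k ≤ m + 1 only, since the term k is
  -- divisible by ε^{k−1}.
  let Y : Op := ⟨fun j => PowerSeries.mk fun m => ∑ k ∈ Finset.range (m + 2),
    (binomPoly k).coeff 1 • PowerSeries.coeff m ((a k).1 j), b, fun j hj => by
      ext1 m
      rw [PowerSeries.coeff_mk]
      simp [hb _ j hj]⟩
  refine ⟨Y, fun N => ⟨∑ k ∈ Finset.range (N + 1), polySmul (binomPoly k) (a k), fun j => ?_,
    fun n => ?_⟩⟩
  · rw [Polynomial.finsetSum_coeff (R := Op), Op.sub_apply, Op.sum_apply]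
    refine PowerSeries.X_pow_dvd_iff.2 fun m hm => ?_
    have hY : PowerSeries.coeff m (Y.1 j) = ∑ k ∈ Finset.range (m + 2),
      (binomPoly k).coeff 1 • PowerSeries.coeff m ((a k).1 j) := by
      simp only [Y]
      rw [PowerSeries.coeff_mk]
    rw [map_sub, map_sum, sub_eq_zero, hY]
    symm
    refine Finset.sum_subset_zero_on_sdiff (Finset.range_mono (by omega)) (fun k hk => ?_)
      fun k _ => ?_
    · simp only [Finset.mem_sdiff, Finset.mem_range] at hk
      obtain ⟨k, rfl⟩ : ∃ k', k = k' + 1 := ⟨k - 1, by omega⟩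
      rw [coeff_polySmul, Op.smul_apply, coeff_rat_smul,
        PowerSeries.X_pow_dvd_iff.1 (ha k j) m (by omega), smul_zero]
    · rw [coeff_polySmul, Op.smul_apply, coeff_rat_smul]
  · have h1 : F n = ∑ k ∈ Finset.range (N + 1 + n), n.choose k • a k := by
      rw [hF]
      refine Finset.sum_subset (Finset.range_mono (by omega)) fun k _ hk => ?_
      rw [Nat.choose_eq_zero_of_lt (by simpa using hk), zero_smul]
    have h2 : Polynomial.eval (n : Op) (∑ k ∈ Finset.range (N + 1), polySmul (binomPoly k) (a k)) =
        ∑ k ∈ Finset.range (N + 1), n.choose k • a k := by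
      rw [Polynomial.eval_finsetSum]
      refine Finset.sum_congr rfl fun k _ => ?_
      rw [eval_polySmul, eval_binomPoly, Nat.cast_smul_eq_nsmul]
    rw [h1, h2, Finset.sum_range_add _ (N + 1) n, sub_add_cancel_left, ← zero_sub]
    refine (Op.EpsDvd.zero N).sub (Op.EpsDvd.sum fun i _ => ?_)
    rw [show N + 1 + i = (N + i) + 1 by ring, ← Nat.cast_smul_eq_nsmul ℚ]
    exact ((ha _).mono (by omega)).smul _

open scoped fwdDiff in
-- The (k+1)-st finite difference of F is D^k(DF + y), hence divisible by ε^k; Newton's forward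
-- difference formula then applies.
theorem exists_hasLin {D : Op →+ Op} (hD : ∀ N A, Op.EpsDvd N A → (D A).EpsDvd (N + 1))
    (hD' : ∀ A n, Op.Le A n → (D A).Le n) {F : ℕ → Op} {y : Op}
    (hF : ∀ n, F (n + 1) = F n + D (F n) + y) : ∃ Y, HasLin F Y := by
  have h1 : ∀ k n, (Δ_[1])^[k + 1] F n = D^[k] (D (F n) + y) := by
    intro k
    induction k with
    | zero =>
      intro n
      rw [zero_add, Function.iterate_one, fwdDiff, hF, Function.iterate_zero_apply]
      abel
    | succ k ih =>
      intro n
      rw [Function.iterate_succ_apply', fwdDiff, ih, ih, hF, Function.iterate_succ_apply,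
        ← iterate_map_sub]
      congr 1
      simp only [map_add]
      abel
  have hle : ∃ b, (F 0).Le b ∧ (D (F 0) + y).Le b := exists_common_bound _ _
  obtain ⟨b, hb0, hb1⟩ := hle
  have h2 : ∀ k, (D^[k] (D (F 0) + y)).Le b ∧
      (D^[k] (D (F 0) + y)).EpsDvd k := by
    intro k
    induction k with
    | zero => exact ⟨hb1, fun j => by rw [pow_zero]; exact one_dvd _⟩
    | succ k ih =>
      rw [Function.iterate_succ_apply']
      exact ⟨hD' _ _ ih.1, hD _ _ ih.2⟩
  refine exists_hasLin_of_sum (a := fun k => (Δ_[1])^[k] F 0) (b := b) (fun k => ?_)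
    (fun k => by rw [h1]; exact (h2 k).2) fun n => ?_
  · cases k with
    | zero => exact hb0
    | succ k => rw [h1]; exact (h2 k).1
  · have := shift_eq_sum_fwdDiff_iter 1 F n 0
    simpa using this

/-! ### The logarithm of conjugation by a monic operator -/

theorem unit_pow_mul_inv_pow (U : Opˣ) (n : ℕ) : (U : Op) ^ n * ((U⁻¹ : Opˣ) : Op) ^ n = 1 := by
  rw [← Units.val_pow_eq_pow_val, ← Units.val_pow_eq_pow_val, inv_pow, Units.mul_inv]

theorem unit_inv_pow_mul_pow (U : Opˣ) (n : ℕ) : ((U⁻¹ : Opˣ) : Op) ^ n * (U : Op) ^ n = 1 := by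
  rw [← Units.val_pow_eq_pow_val, ← Units.val_pow_eq_pow_val, inv_pow, Units.inv_mul]

/-- A monic unit of order `1`. -/
structure MonicUnit (U : Opˣ) : Prop where
  monic : (U : Op).Monic 1
  inv : ((U⁻¹ : Opˣ) : Op).Monic (-1)

/-- The map `X ↦ U X U⁻¹ - X`. -/
def conjSub (U : Opˣ) : Op →+ Op :=
  (AddMonoidHom.mulLeft (U : Op)).comp (AddMonoidHom.mulRight ((U⁻¹ : Opˣ) : Op)) -
    AddMonoidHom.id Op

theorem conjSub_apply (U : Opˣ) (X : Op) : conjSub U X = U * (X * ((U⁻¹ : Opˣ) : Op)) - X := rfl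

theorem conjSub_epsDvd (U : Opˣ) (N : ℕ) (X : Op) (h : X.EpsDvd N) :
    (conjSub U X).EpsDvd (N + 1) := by
  have h1 : conjSub U X = (U * X - X * U) * ((U⁻¹ : Opˣ) : Op) := by
    rw [conjSub_apply, sub_mul, mul_assoc, mul_assoc, Units.mul_inv, mul_one]
  rw [h1]
  exact (h.comm _).mul_right _

theorem MonicUnit.conjSub_le {U : Opˣ} (hU : MonicUnit U) (X : Op) (n : ℤ) (h : X.Le n) :
    (conjSub U X).Le n := by
  have := hU.monic.le.mul (h.mul hU.inv.le)
  rw [conjSub_apply]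
  exact (this.trans (by omega)).sub h

/-- The sequence `U^n X U^{-n}`. -/
def conjSeq (U : Opˣ) (X : Op) (n : ℕ) : Op := (U : Op) ^ n * X * ((U⁻¹ : Opˣ) : Op) ^ n

/-- The sequence `d(U^n) U^{-n}`. -/
def derSeq (U : Opˣ) (d : Op →+ Op) (n : ℕ) : Op := d ((U : Op) ^ n) * ((U⁻¹ : Opˣ) : Op) ^ n

theorem MonicUnit.exists_conjSeq {U : Opˣ} (hU : MonicUnit U) (X : Op) :
    ∃ Y, HasLin (conjSeq U X) Y :=
  exists_hasLin (conjSub_epsDvd U) hU.conjSub_le (y := 0) fun n => by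
    rw [conjSub_apply, conjSeq, conjSeq, pow_succ', pow_succ]
    noncomm_ring

theorem derSeq_succ (U : Opˣ) {d : Op →+ Op} (hd : IsDer d) (n : ℕ) :
    derSeq U d (n + 1) = U * (derSeq U d n * ((U⁻¹ : Opˣ) : Op)) + d U * ((U⁻¹ : Opˣ) : Op) := by
  have h : (U : Op) ^ n * ((U⁻¹ : Opˣ) : Op) ^ (n + 1) = ((U⁻¹ : Opˣ) : Op) := by
    rw [pow_succ, ← mul_assoc, unit_pow_mul_inv_pow, one_mul]
  rw [derSeq, derSeq, pow_succ', hd, add_mul, mul_assoc (d _), h, pow_succ, add_comm]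
  simp only [mul_assoc]

theorem MonicUnit.exists_derSeq {U : Opˣ} (hU : MonicUnit U) {d : Op →+ Op} (hd : IsDer d) :
    ∃ Y, HasLin (derSeq U d) Y :=
  exists_hasLin (conjSub_epsDvd U) hU.conjSub_le (y := d U * ((U⁻¹ : Opˣ) : Op)) fun n => by
    rw [conjSub_apply, derSeq_succ U hd]
    abel

theorem derSeq_zero (U : Opˣ) {d : Op →+ Op} (hd : IsDer d) : derSeq U d 0 = 0 := by
  rw [derSeq, pow_zero, hd.one, zero_mul]

theorem conjSeq_zero (U : Opˣ) (X : Op) : conjSeq U X 0 = X := by simp [conjSeq]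

theorem IsDer.pow_mul_inv_pow {d : Op →+ Op} (hd : IsDer d) (U : Opˣ) (n : ℕ) :
    (U : Op) ^ n * d (((U⁻¹ : Opˣ) : Op) ^ n) = -derSeq U d n := by
  have h := hd ((U : Op) ^ n) (((U⁻¹ : Opˣ) : Op) ^ n)
  rw [unit_pow_mul_inv_pow, hd.one] at h
  rw [derSeq, eq_neg_iff_add_eq_zero, add_comm, ← h]

/-- The derivative of a conjugate, d(gXg⁻¹) = g(dX)g⁻¹ + [d(g)g⁻¹, gXg⁻¹], for g = U^n. -/
theorem IsDer.conjSeq {d : Op →+ Op} (hd : IsDer d) (U : Opˣ) (X : Op) (n : ℕ) :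
    d (conjSeq U X n) = EqToda.conjSeq U (d X) n + (derSeq U d n * EqToda.conjSeq U X n -
      EqToda.conjSeq U X n * derSeq U d n) := by
  have h1 : EqToda.conjSeq U X n * derSeq U d n = -((U : Op) ^ n * X *
      d (((U⁻¹ : Opˣ) : Op) ^ n)) := by
    rw [← neg_eq_iff_eq_neg, ← mul_neg, ← hd.pow_mul_inv_pow, EqToda.conjSeq, mul_assoc,
      ← mul_assoc _ _ (d _), unit_inv_pow_mul_pow, one_mul]
  have h2 : derSeq U d n * EqToda.conjSeq U X n =
      d ((U : Op) ^ n) * X * ((U⁻¹ : Opˣ) : Op) ^ n := by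
    rw [derSeq, EqToda.conjSeq, mul_assoc, mul_assoc ((U : Op) ^ n), ← mul_assoc _ ((U : Op) ^ n),
      unit_inv_pow_mul_pow, one_mul, mul_assoc]
  rw [h1, h2, EqToda.conjSeq, EqToda.conjSeq, hd, hd]
  noncomm_ring

/-- Compatibility of the logarithm with derivations. -/
theorem HasLin.conjSeq_der {U : Opˣ} {d : Op →+ Op} (hd : IsDer d)
    (hN : ∀ N A, Op.EpsDvd N A → (d A).EpsDvd N) {X Y Z G : Op} (hY : HasLin (conjSeq U X) Y)
    (hZ : HasLin (conjSeq U (d X)) Z) (hG : HasLin (derSeq U d) G) :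
    d Y = Z + (G * X - X * G) := by
  refine (hY.map d hN).unique ?_
  have h := hZ.add ((hG.mul hY).sub (hY.mul hG))
  -- Since d(U^n)U^{-n} vanishes at n = 0, its linear coefficient `G` meets only the constant term
  -- `X` of the conjugates.
  rw [derSeq_zero U hd, conjSeq_zero, zero_mul, zero_add, mul_zero, add_zero] at h
  convert h using 2 with n
  exact hd.conjSeq U X n

theorem opSeries_sum {ι : Type*} (s : Finset ι) (φ : ι → PowerSeries ℚ) (f : DiffAlg) :
    opSeries (∑ i ∈ s, φ i) f = ∑ i ∈ s, opSeries (φ i) f := by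
  classical
  induction s using Finset.induction_on with
  | empty => rw [Finset.sum_empty, Finset.sum_empty, ← map_zero (PowerSeries.C (R := ℚ)), opSeries_C,
      zero_smul]
  | insert i s hi ih => rw [Finset.sum_insert hi, Finset.sum_insert hi, opSeries_add, ih]

theorem opSeries_X_pow (j : ℕ) (f : DiffAlg) :
    opSeries (PowerSeries.X ^ j) f = PowerSeries.X ^ j * (dx ^ j) f := by
  induction j generalizing f with
  | zero => rw [pow_zero, opSeries_one, pow_zero, one_mul, pow_zero, Module.End.one_apply]
  | succ j ih =>
    rw [pow_succ, opSeries_mul, opSeries_X, opSeries_X_mul, ih, pow_succ', pow_succ,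
      Module.End.mul_apply, mul_assoc]

/-- The map `f ↦ ε ∂f`. -/
def epsDx : DiffAlg →+ DiffAlg := epsMul dx.toAddMonoidHom

theorem epsDx_apply (f : DiffAlg) : epsDx f = PowerSeries.X * dx f := rfl

/-- The terms of the exponential series of `ε∂`. -/
def epsDxTerm (j : ℕ) : DiffAlg →+ DiffAlg :=
  (opSeries (PowerSeries.C ((j.factorial : ℚ)⁻¹) * PowerSeries.X ^ j)).toAddMonoidHom

/-- E^n = exp(nε∂) is polynomial in n modulo each power of ε, with linear coefficient ε∂. -/
theorem hasLin_shift (X : Op) :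
    HasLin (fun n => coeffwise (shift n).toAddMonoidHom X) (coeffwise epsDx X) := fun N => by
  refine ⟨∑ j ∈ Finset.range (N + 2), Polynomial.monomial j (coeffwise (epsDxTerm j) X), ?_,
    fun n k => ?_⟩
  · rw [Polynomial.finsetSum_coeff]
    simp only [Polynomial.coeff_monomial]
    rw [Finset.sum_ite_eq' _ 1, if_pos (by simp)]
    have : coeffwise (epsDxTerm 1) X = coeffwise epsDx X := Op.ext' fun k => by
      rw [coeffwise_apply, coeffwise_apply, epsDx_apply, ← opSeries_X]
      change opSeries _ _ = _
      simp
    rw [this, sub_self]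
    exact Op.EpsDvd.zero N
  · have h1 : (Polynomial.eval (n : Op) (∑ j ∈ Finset.range (N + 2),
        Polynomial.monomial j (coeffwise (epsDxTerm j) X))).1 k =
        opSeries (∑ j ∈ Finset.range (N + 2), PowerSeries.C ((n : ℚ) ^ j * (j.factorial : ℚ)⁻¹) *
          PowerSeries.X ^ j) (X.1 k) := by
      rw [Polynomial.eval_finsetSum, Op.sum_apply, opSeries_sum]
      refine Finset.sum_congr rfl fun j _ => ?_
      rw [Polynomial.eval_monomial, ← Nat.cast_pow, ← nsmul_eq_mul', ← Nat.cast_smul_eq_nsmul ℚ,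
        Op.smul_apply, coeffwise_apply, map_mul, mul_assoc, opSeries_mul (PowerSeries.C _),
        opSeries_C, Nat.cast_pow]
      rfl
    have h2 : (PowerSeries.X : PowerSeries ℚ) ^ N ∣
        ∑ j ∈ Finset.range (N + 2), PowerSeries.C ((n : ℚ) ^ j * (j.factorial : ℚ)⁻¹) *
          PowerSeries.X ^ j - PowerSeries.rescale (n : ℚ) (PowerSeries.exp ℚ) := by
      refine PowerSeries.X_pow_dvd_iff.2 fun m hm => ?_
      rw [map_sub, map_sum]
      simp only [PowerSeries.coeff_C_mul, PowerSeries.coeff_X_pow, mul_ite, mul_one, mul_zero]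
      rw [Finset.sum_ite_eq, if_pos (by simp; omega), PowerSeries.coeff_rescale,
        PowerSeries.coeff_exp]
      simp
    obtain ⟨φ, hφ⟩ := h2
    rw [Op.sub_apply, h1, coeffwise_apply]
    change _ ∣ _ - shift n (X.1 k)
    rw [shift, ← opSeries_sub, hφ, opSeries_mul, opSeries_X_pow]
    exact dvd_mul_right _ _

/-- To leading order, conjugation by U^n is conjugation by Λ^n, that is, the shift E^n of
coefficients. -/
theorem MonicUnit.conjSeq_lead {U : Opˣ} (hU : MonicUnit U) {X : Op} {m : ℤ} (hX : X.Le m) (n : ℕ) :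
    (conjSeq U X n - coeffwise (shift n).toAddMonoidHom X).Le (m - 1) := by
  have h1 := hU.monic.pow n
  have h2 := hU.inv.pow n
  have h3 := h1.le.mul hX
  have h4 := Op.mul_lead h1.le hX
  have h5 := h3.mul h2.le
  have h6 := Op.mul_lead h3 h2.le
  rw [show (n : ℤ) * 1 + m + n * -1 = m by ring] at h5 h6
  refine Op.Le.pred (h5.sub (coeffwise_le hX)) ?_
  rw [Op.sub_apply, conjSeq, h6, h2.lead, h4, h1.lead, shift_one_apply, shift_one_apply, one_mul,
    mul_one, coeffwise_apply, ← shift_add_apply]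
  change _ - shift n (X.1 m) = 0
  rw [show -((n * -1 : ℤ) : ℚ) / 2 + ((n * 1 : ℤ) : ℚ) / 2 = n by push_cast; ring, sub_self]

theorem epsDvd_coeffwise {T : DiffAlg →+ DiffAlg}
    (hT : ∀ f, T (PowerSeries.X * f) = PowerSeries.X * T f) (N : ℕ) (A : Op) (hA : A.EpsDvd N) :
    (coeffwise T A).EpsDvd N := by
  intro k
  obtain ⟨g, hg⟩ := hA k
  rw [coeffwise_apply, hg]
  clear hg
  induction N generalizing g with
  | zero => rw [pow_zero]; exact one_dvd _
  | succ N ih =>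
    rw [pow_succ', mul_assoc, hT]
    exact mul_dvd_mul_left _ (ih (hA.mono N.le_succ) g)

theorem epsDvd_grade (N : ℕ) (A : Op) (hA : A.EpsDvd N) : (grade A).EpsDvd N := fun k => by
  rw [grade_apply]
  exact (hA k).mul_left _

theorem grade_coeffwise {T : DiffAlg →+ DiffAlg} (A : Op) :
    grade (coeffwise T A) = coeffwise T (grade A) := Op.ext' fun k => by
  rw [grade_apply, coeffwise_apply, coeffwise_apply, grade_apply, ← zsmul_eq_mul, ← zsmul_eq_mul,
    map_zsmul]

/-- An additive map which lowers the order and commutes with the grading vanishes. -/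
theorem eq_zero_of_lowering {E : Op →+ Op} (h : ∀ X, grade (E X) = E (grade X))
    (hle : ∀ X m, Op.Le X m → (E X).Le (m - 1)) (X : Op) : E X = 0 := by
  have key : ∀ (i : ℕ) (X : Op) (m : ℤ), X.Le m → (E X).Le (m - 1 - i) := by
    intro i
    induction i with
    | zero => intro X m hX; simpa using hle X m hX
    | succ i ih =>
      intro X m hX
      rw [show m - 1 - ((i + 1 : ℕ) : ℤ) = m - 1 - i - 1 by push_cast; ring]
      refine (ih X m hX).pred ?_
      -- Subtracting m from the grading removes the leading term of X. As E commutes with the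
      -- grading, the coefficient of E X in degree m − 1 − i is multiplied by −1 − i ≠ 0 and must
      -- vanish.
      have h1 : (grade X - m • X).Le (m - 1) := by
        have h2 : ∀ k, (grade X - m • X).1 k = ((k - m : ℤ) : DiffAlg) * X.1 k := fun k => by
          rw [Op.sub_apply, grade_apply]
          change _ - m • X.1 k = _
          rw [zsmul_eq_mul]
          push_cast
          ring
        refine Op.Le.pred (fun k hk => ?_) ?_
        · rw [h2, hX k hk, mul_zero]
        · rw [h2, sub_self, Int.cast_zero, zero_mul]
      have h3 := ih _ _ h1 (m - 1 - i) (by omega)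
      rw [map_sub, map_zsmul, ← h, Op.sub_apply, grade_apply] at h3
      change _ - m • (E X).1 _ = 0 at h3
      rw [← zsmul_eq_mul, ← sub_smul, ← Int.cast_smul_eq_zsmul ℚ, smul_eq_zero] at h3
      exact h3.resolve_left (Int.cast_ne_zero.2 (by omega))
  obtain ⟨m, hm⟩ := X.2
  exact Op.ext' fun k => key (m - 1 - k).toNat.succ X m hm k (by push_cast; omega)

theorem MonicUnit.derSeq_grade_le {U : Opˣ} (hU : MonicUnit U) (n : ℕ) :
    (derSeq U grade n - n • (1 : Op)).Le (-1) := by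
  have h1 := hU.monic.pow n
  have h2 := hU.inv.pow n
  have h3 := (grade_le h1.le).mul h2.le
  have h4 := Op.mul_lead (grade_le h1.le) h2.le
  rw [show (n : ℤ) * 1 + n * -1 = 0 by ring] at h3 h4
  have h5 : (n • (1 : Op)).Le 0 := fun k hk => by
    change n • (1 : Op).1 k = 0
    rw [Op.one_le k hk, smul_zero]
  refine Op.Le.pred (n := 0) (h3.sub h5) ?_
  rw [Op.sub_apply, derSeq, h4, h2.lead, shift_one_apply, grade_apply, h1.lead, mul_one, mul_one,
    shift_const _ (dx_intCast _)]
  change _ - n • (1 : Op).1 0 = 0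
  rw [Op.one_apply, if_pos rfl, nsmul_one]
  push_cast
  ring

theorem MonicUnit.derSeq_coeffwise_le {U : Opˣ} (hU : MonicUnit U) {T : DiffAlg →+ DiffAlg}
    (hT : T 1 = 0) (n : ℕ) : (derSeq U (coeffwise T) n).Le (-1) := by
  have h1 := hU.monic.pow n
  have h3 : (coeffwise T ((U : Op) ^ n)).Le (n * 1 - 1) :=
    (coeffwise_le h1.le).pred (by rw [coeffwise_apply, h1.lead, hT])
  exact (h3.mul (hU.inv.pow n).le).trans (by ring_nf; rfl)

/-- The logarithm of the conjugation by `U` has the form `ε∂ + [w, ·]`. -/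
theorem MonicUnit.exists_log {U : Opˣ} (hU : MonicUnit U) : ∃ w : Op, w.Le (-1) ∧
    HasLin (derSeq U grade) (1 + grade w) ∧
    ∀ X, HasLin (conjSeq U X) (coeffwise epsDx X + (w * X - X * w)) := by
  obtain ⟨G, hG⟩ := hU.exists_derSeq isDer_grade
  choose lam hlam using hU.exists_conjSeq
  have hle : (G - 1).Le (-1) := (hG.sub (hasLin_nsmul 1)).le hU.derSeq_grade_le
  -- w solves N w = G − 1 for the grading N. Since G − 1 has negative order, the division by j is
  -- harmless; at j = 0 the quotient has the default value 0 and the coefficient itself is 0.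
  let w : Op := ⟨fun j => ((j : ℚ)⁻¹) • (G - 1).1 j, -1, fun j hj => by
    change ((j : ℚ)⁻¹) • (G - 1).1 j = 0
    rw [hle j hj, smul_zero]⟩
  have hw : w.Le (-1) := fun j hj => by
    change ((j : ℚ)⁻¹) • (G - 1).1 j = 0
    rw [hle j hj, smul_zero]
  have hgw : 1 + grade w = G := by
    rw [← eq_sub_iff_add_eq']
    refine Op.ext' fun j => ?_
    rw [grade_apply]
    change (j : DiffAlg) * (((j : ℚ)⁻¹) • (G - 1).1 j) = _
    by_cases hj : j = 0
    · rw [hj, hle 0 (by norm_num), smul_zero, mul_zero]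
    · rw [← zsmul_eq_mul, ← Int.cast_smul_eq_zsmul ℚ, smul_smul,
        mul_inv_cancel₀ (Int.cast_ne_zero.2 hj), one_smul]
  refine ⟨w, hw, hgw ▸ hG, fun X => ?_⟩
  -- E is the difference between the linear coefficient of conjugation and ε∂ + [w, ·]. The choice
  -- of w makes it commute with the grading and the leading terms make it lower the order, so it
  -- vanishes.
  let E : Op →+ Op :=
    { toFun := fun X => lam X - (coeffwise epsDx X + (w * X - X * w))
      map_zero' := by
        have h0 : conjSeq U 0 = fun _ => 0 := funext fun n => by rw [conjSeq, mul_zero, zero_mul]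
        have : lam 0 = 0 := (hlam 0).unique (h0 ▸ hasLin_const 0)
        rw [this]
        simp
      map_add' := fun X Y => by
        have : lam (X + Y) = lam X + lam Y := (hlam _).unique (by
          convert (hlam X).add (hlam Y) using 2 with n
          rw [conjSeq, conjSeq, conjSeq, mul_add, add_mul])
        rw [this, map_add]
        noncomm_ring }
  have hE : ∀ X, E X = lam X - (coeffwise epsDx X + (w * X - X * w)) := fun X => rfl
  have h0 := eq_zero_of_lowering (E := E) (fun X => ?_) (fun X m hX => ?_) X
  · rw [hE, sub_eq_zero] at h0
    rw [← h0]
    exact hlam X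
  · rw [hE, hE, map_sub, HasLin.conjSeq_der isDer_grade epsDvd_grade (hlam X) (hlam (grade X)) hG,
      map_add, grade_coeffwise, isDer_grade.comm, ← hgw]
    noncomm_ring
  · rw [hE, ← sub_sub]
    have h1 := ((hlam X).sub (hasLin_shift X)).le (hU.conjSeq_lead hX)
    have h2 := (hw.mul hX).trans (show -1 + m ≤ m - 1 by omega)
    have h3 := (hX.mul hw).trans (show m + -1 ≤ m - 1 by omega)
    exact h1.sub (h2.sub h3)

/-! ### Operators commuting with a monic unit -/

/-- Comparing leading terms of U X and X U gives E^{1/2} f = E^{-1/2} f for the leading coefficient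
f of X. -/
theorem dx_lead_of_comm {U : Opˣ} (hU : MonicUnit U) {X : Op} {m : ℤ} (hX : X.Le m)
    (h : (U : Op) * X = X * U) : dx (X.1 m) = 0 := by
  have h1 := Op.mul_lead hU.monic.le hX
  have h2 := Op.mul_lead hX hU.monic.le
  rw [h, add_comm 1 m, h2, hU.monic.lead, shift_one_apply, shift_one_apply, one_mul, mul_one,
    Int.cast_one] at h1
  refine dx_eq_zero_of_shift ?_
  rw [← h1]
  congr 2
  ring

/-- A central operator of negative order vanishes. -/
theorem eq_zero_of_central {X : Op} (hX : X.Le (-1)) (h : ∀ A : Op, X * A = A * X) : X = 0 := by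
  refine Op.ext' fun k => ?_
  by_cases hk : -1 < k
  · exact hX k hk
  have h1 := congrArg (fun A : Op => A.1 k) (h (Op.mono 0 (field 0)))
  simp only [Op.mul_mono_apply, Op.mono_mul_apply, sub_zero, Int.cast_zero, neg_zero, zero_div,
    shift_zero_apply] at h1
  rw [mul_comm, ← sub_eq_zero, ← sub_mul, mul_eq_zero] at h1
  refine h1.resolve_left fun h2 => ?_
  -- The ε-linear part of E^{k/2}v − E^{-k/2}v is k∂v, which is nonzero for k < 0.
  have h3 := congrArg (PowerSeries.coeff 1) h2
  rw [field, gen, map_sub, coeff_shift_C, coeff_shift_C, ← sub_smul] at h3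
  have h4 : dx₀ (LaurentPolynomial.C (MvPolynomial.X (jet 0 0))) ≠ 0 := by
    have h5 := dx_gen_v 0
    rw [gen, gen, dx_C] at h5
    rw [show jet 0 0 = Gen.v 0 from rfl, PowerSeries.C_injective h5]
    intro h6
    exact MvPolynomial.X_ne_zero (R := ℚ) (Gen.v 1) (AddMonoidAlgebra.single_eq_zero.1 h6)
  rw [map_zero, smul_eq_zero] at h3
  rcases h3 with h3 | h3
  · have : (k : ℚ) = 0 := by linarith
    have : k = 0 := by exact_mod_cast this
    omega
  · refine h4 ?_
    simpa using h3

/-- The remainders of the expansion of `S` in powers of `U⁻¹`. -/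
def remainder (U : Opˣ) (S : Op) : ℕ → Op
  | 0 => S
  | n + 1 => remainder U S n -
      Op.const ((remainder U S n).1 (-(n + 1))) * ((U⁻¹ : Opˣ) : Op) ^ (n + 1)

/-- The leading coefficient of an operator commuting with U is a constant, so subtracting it times a
power of U⁻¹ preserves commutation and lowers the order. -/
theorem MonicUnit.remainder_spec {U : Opˣ} (hU : MonicUnit U) {S : Op} (hS : S.Le (-1))
    (h : (U : Op) * S = S * U) (n : ℕ) : (remainder U S n).Le (-(n + 1)) ∧
      (U : Op) * remainder U S n = remainder U S n * U := by
  induction n with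
  | zero =>
    rw [Nat.cast_zero, zero_add]
    exact ⟨hS, h⟩
  | succ n ih =>
    have hc := dx_lead_of_comm hU ih.1 ih.2
    have h2 := hU.inv.pow (n + 1)
    rw [show ((n + 1 : ℕ) : ℤ) * -1 = -(n + 1) by push_cast; ring] at h2
    refine ⟨?_, ?_⟩
    · rw [remainder, show -(((n + 1 : ℕ) : ℤ) + 1) = -((n : ℤ) + 1) - 1 by push_cast; ring]
      refine Op.Le.pred (ih.1.sub fun k hk => ?_) ?_
      · rw [Op.const_mul_apply hc, h2.le k hk, mul_zero]
      · rw [Op.sub_apply, Op.const_mul_apply hc, h2.lead, mul_one, sub_self]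
    · have h3 : Commute (U : Op) (((U⁻¹ : Opˣ) : Op) ^ (n + 1)) :=
        Commute.pow_right (by rw [Commute, SemiconjBy, Units.mul_inv, Units.inv_mul]) _
      rw [remainder, mul_sub, sub_mul, ih.2, ← mul_assoc, ← Op.const_comm hc, mul_assoc,
        mul_assoc, h3.eq]

theorem eq_remainder_add (U : Opˣ) (S : Op) (n : ℕ) : S = remainder U S n +
    ∑ m ∈ Finset.range n,
      Op.const ((remainder U S m).1 (-(m + 1))) * ((U⁻¹ : Opˣ) : Op) ^ (m + 1) := by
  induction n with
  | zero => simp [remainder]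
  | succ n ih =>
    rw [Finset.sum_range_succ, remainder]
    nth_rewrite 1 [ih]
    abel

/-! ### The trace `∫ res` -/

/-- The trace `∫ p_0 dx` of the operator `∑ p_k Λ^k`. -/
def tr : Op →ₗ[ℚ] Functional := integral ∘ₗ Op.coeff 0

theorem tr_apply (A : Op) : tr A = integral (A.1 0) := rfl

theorem integral_eq_zero_iff {f : DiffAlg} : integral f = 0 ↔ f ∈ exact :=
  Submodule.Quotient.mk_eq_zero _

theorem integral_eq_iff {f g : DiffAlg} : integral f = integral g ↔ f - g ∈ exact :=
  Submodule.Quotient.eq _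

theorem tr_mul_comm (A B : Op) : tr (A * B) = tr (B * A) :=
  integral_eq_iff.2 (Op.mul_apply_zero_sub_mem A B)

theorem tr_eq_zero {A : Op} (h : A.Le (-1)) : tr A = 0 := by
  rw [tr_apply, h 0 (by norm_num), map_zero]

theorem tr_const_mul {c : DiffAlg} (hc : dx c = 0) {A B : Op} (h : tr A = tr B) :
    tr (Op.const c * A) = tr (Op.const c * B) := by
  rw [tr_apply, tr_apply, integral_eq_iff, Op.const_mul_apply hc, Op.const_mul_apply hc, ← mul_sub]
  exact const_mul_mem_exact hc (integral_eq_iff.1 h)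

theorem tr_grade (A : Op) : tr (grade A) = 0 := by
  rw [tr_apply, grade_apply, Int.cast_zero, zero_mul, map_zero]

theorem HasLin.tr_eq {F : ℕ → Op} {Y A B : Op} (hF : HasLin F Y)
    (h : ∀ n, tr (A * F n) = n • tr B) : tr (A * Y) = tr B := by
  rw [← sub_eq_zero, ← map_sub, tr_apply, integral_eq_zero_iff]
  refine ((hF.map (AddMonoidHom.mulLeft A) fun N X hX => hX.mul_left A).sub
    (hasLin_nsmul B)).mem_exact 0 fun n => ?_
  rw [← integral_eq_zero_iff, ← tr_apply, map_sub, map_nsmul, ← h, sub_eq_zero]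
  rfl

section

variable {U : Opˣ} {d : Op →+ Op}

/-- The logarithmic derivative `d(U) U⁻¹`. -/
def logDer (U : Opˣ) (d : Op →+ Op) : Op := d U * ((U⁻¹ : Opˣ) : Op)

/-- Under the trace, conjugation by U leaves U^j times an operator unchanged, so each step from n to
n + 1 adds the same amount. -/
theorem tr_pow_mul_derSeq (hd : IsDer d) (j n : ℕ) :
    tr ((U : Op) ^ j * derSeq U d n) = n • tr ((U : Op) ^ j * logDer U d) := by
  induction n with
  | zero => rw [derSeq_zero U hd, mul_zero, map_zero, zero_smul]
  | succ n ih =>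
    have h : (U : Op) ^ j * (U * (derSeq U d n * ((U⁻¹ : Opˣ) : Op))) =
        U * ((U : Op) ^ j * derSeq U d n) * ((U⁻¹ : Opˣ) : Op) := by
      simp only [← mul_assoc]
      rw [← pow_succ, ← pow_succ']
    rw [derSeq_succ U hd, mul_add, map_add, add_smul, one_smul, ← ih, logDer, h, tr_mul_comm,
      ← mul_assoc, Units.inv_mul, one_mul]

theorem tr_der_pow (hd : IsDer d) (j : ℕ) :
    tr (d ((U : Op) ^ j)) = j • tr ((U : Op) ^ j * logDer U d) := by
  rw [← tr_pow_mul_derSeq hd, tr_mul_comm, derSeq, mul_assoc, unit_inv_pow_mul_pow, mul_one]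

theorem tr_pow_mul_lin (hd : IsDer d) {G : Op} (hG : HasLin (derSeq U d) G) (j : ℕ) :
    tr ((U : Op) ^ j * G) = tr ((U : Op) ^ j * logDer U d) :=
  hG.tr_eq fun n => tr_pow_mul_derSeq hd j n

theorem tr_pow_mul_der_inv_pow (hd : IsDer d) (j m : ℕ) :
    tr ((U : Op) ^ (j + m) * d (((U⁻¹ : Opˣ) : Op) ^ m)) =
      -(m • tr ((U : Op) ^ j * logDer U d)) := by
  rw [pow_add, mul_assoc, hd.pow_mul_inv_pow, mul_neg, map_neg, tr_pow_mul_derSeq hd]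

theorem tr_pow_mul_der (j : ℕ) :
    tr ((U : Op) ^ j * d U) = tr ((U : Op) ^ (j + 1) * logDer U d) := by
  rw [logDer, pow_succ', mul_assoc, tr_mul_comm (U : Op), mul_assoc, mul_assoc, Units.inv_mul,
    mul_one]

/-- The coefficients of the expansion of `S` in powers of `U⁻¹`. -/
def expCoeff (U : Opˣ) (S : Op) (m : ℕ) : DiffAlg := (remainder U S m).1 (-(m + 1))

theorem MonicUnit.dx_expCoeff (hU : MonicUnit U) {S : Op} (hS : S.Le (-1))
    (h : (U : Op) * S = S * U) (m : ℕ) : dx (expCoeff U S m) = 0 :=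
  dx_lead_of_comm hU (hU.remainder_spec hS h m).1 (hU.remainder_spec hS h m).2

/-- S is expanded in powers of U⁻¹ with constant coefficients. After n steps, U^n times d of the
remainder has order −1 and no trace; d of U^{-m-1} contributes −(m+1) U^{n-1-m} d(U)U⁻¹ under the
trace. -/
theorem MonicUnit.tr_pow_mul_der_of_comm (hU : MonicUnit U) (hd : IsDer d)
    (hle : ∀ A m, Op.Le A m → (d A).Le m) {S : Op} (hS : S.Le (-1)) (h : (U : Op) * S = S * U)
    (hc : ∀ m A, d (Op.const (expCoeff U S m) * A) = Op.const (expCoeff U S m) * d A) (n : ℕ) :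
    tr ((U : Op) ^ n * d S) = ∑ m ∈ Finset.range n,
      tr (Op.const (-((m + 1) • expCoeff U S m)) * ((U : Op) ^ (n - 1 - m) * logDer U d)) := by
  have h1 : tr ((U : Op) ^ n * d (remainder U S n)) = 0 :=
    tr_eq_zero (((hU.monic.pow n).le.mul (hle _ _ (hU.remainder_spec hS h n).1)).trans (by omega))
  conv_lhs => rw [eq_remainder_add U S n]
  rw [map_add, map_sum, mul_add, map_add, h1, zero_add, Finset.mul_sum, map_sum]
  refine Finset.sum_congr rfl fun m hm => ?_
  have hcm := hU.dx_expCoeff hS h m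
  have h2 := tr_pow_mul_der_inv_pow (U := U) hd (n - 1 - m) (m + 1)
  rw [show n - 1 - m + (m + 1) = n by have := Finset.mem_range.1 hm; omega] at h2
  change tr ((U : Op) ^ n * d (Op.const (expCoeff U S m) * _)) = _
  have h3 : Op.const (-((m + 1) • expCoeff U S m)) * ((U : Op) ^ (n - 1 - m) * logDer U d) =
      Op.const (expCoeff U S m) * -(((m + 1 : ℕ) : ℚ) • ((U : Op) ^ (n - 1 - m) * logDer U d)) :=
    Op.ext' fun k => by
      rw [Op.const_mul_apply hcm, Op.const_mul_apply (by rw [map_neg, map_nsmul, hcm, smul_zero,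
        neg_zero]), Op.neg_apply, Op.smul_apply, Nat.cast_smul_eq_nsmul, nsmul_eq_mul, nsmul_eq_mul]
      ring
  rw [hc, ← mul_assoc, ← Op.const_comm hcm, mul_assoc, h3]
  exact tr_const_mul hcm (by rw [h2, map_neg, map_smul, Nat.cast_smul_eq_nsmul])

end

/-! ### The differential of the Hamiltonians -/

theorem IsToda.exists_unit {L : Op} (hL : IsToda L) : ∃ U : Opˣ, (U : Op) = L ∧ MonicUnit U := by
  obtain ⟨U, h1, h2⟩ := hL.monic.exists_unit
  exact ⟨U, h1, by rw [h1]; exact hL.monic, h2⟩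

/-- The operator `S = K - L + τ w`. -/
def sOp (L w : Op) : Op := kOp - L + Op.const tau * w

theorem IsToda.sOp_le {L w : Op} (hL : IsToda L) (hw : w.Le (-1)) : (sOp L w).Le (-1) := by
  have h1 := (sub_kOp_le hL.monic hL.zero).neg
  rw [neg_sub] at h1
  refine h1.add fun k hk => ?_
  rw [Op.const_mul_apply dx_tau, hw k hk, mul_zero]

/-- S is formally (K − ετ∂) − L + τ(ε∂ + w). The first term commutes with L by the constraint, the
last because conjugation by L fixes L. -/
theorem IsToda.sOp_comm {w : Op} {U : Opˣ} (hL : IsToda U)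
    (hw : ∀ X, HasLin (conjSeq U X) (coeffwise epsDx X + (w * X - X * w))) :
    (U : Op) * sOp U w = sOp U w * U := by
  have h1 : coeffwise epsDx (U : Op) + (w * U - U * w) = 0 := by
    have h2 : conjSeq U U = fun _ => (U : Op) := funext fun n => by
      rw [conjSeq, ← pow_succ, pow_succ', mul_assoc, unit_pow_mul_inv_pow, mul_one]
    exact (h2 ▸ hw U).unique (hasLin_const _)
  have h3 : coeffwise epsTauDx (U : Op) = Op.const tau * coeffwise epsDx U := Op.ext' fun k => by
    rw [Op.const_mul_apply dx_tau, coeffwise_apply, coeffwise_apply, epsTauDx_apply, epsDx_apply,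
      mul_left_comm]
  have h4 := hL.adA
  rw [adA_apply, h3] at h4
  have h5 : sOp U w * U - U * sOp U w = (kOp * U - U * kOp - Op.const tau * coeffwise epsDx U) +
      Op.const tau * (coeffwise epsDx U + (w * U - U * w)) := by
    rw [sOp, mul_add (U : Op), ← mul_assoc, ← Op.const_comm dx_tau]
    noncomm_ring
  rw [h4, h1, mul_zero, add_zero, sub_eq_zero] at h5
  exact h5.symm

theorem grade_const_mul {c : DiffAlg} (hc : dx c = 0) (A : Op) :
    grade (Op.const c * A) = Op.const c * grade A := Op.ext' fun k => by
  rw [grade_apply, Op.const_mul_apply hc, Op.const_mul_apply hc, grade_apply, mul_left_comm]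

theorem tr_pow_mul_logDer_grade (U : Opˣ) {j : ℕ} (hj : 0 < j) :
    tr ((U : Op) ^ j * logDer U grade) = 0 := by
  have h := tr_der_pow (U := U) isDer_grade j
  rw [tr_grade, ← Nat.cast_smul_eq_nsmul ℚ, eq_comm, smul_eq_zero] at h
  exact h.resolve_left (by exact_mod_cast hj.ne')

theorem MonicUnit.logDer_grade {U : Opˣ} (hU : MonicUnit U) : (logDer U grade).1 0 = 1 := by
  have h := Op.mul_lead (grade_le hU.monic.le) hU.inv.le
  rw [add_neg_cancel, grade_apply, hU.monic.lead, hU.inv.lead, Int.cast_one, mul_one,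
    shift_one_apply, shift_one_apply, mul_one] at h
  exact h

theorem tr_mul_grade_kOp (A : Op) :
    tr (A * grade kOp) = integral (A.1 (-1) - qpow 1 * A.1 1) := by
  have h1 : grade kOp = Op.mono 1 1 - Op.mono (-1) (qpow 1) := Op.ext' fun k => by
    rw [grade_apply, kOp_apply, Op.sub_apply, Op.mono_apply, Op.mono_apply]
    split_ifs with h1 h2 h3 h4
    · omega
    · rw [h1]; simp
    · omega
    · simp [h3]
    · rename_i h4; rw [h4]; push_cast; ring
    · simp
  rw [h1, mul_sub, map_sub, tr_apply, tr_apply, map_sub, Op.mul_mono_apply, Op.mul_mono_apply]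
  refine congrArg₂ (· - ·) ?_ ?_
  · rw [integral_eq_iff, shift_one_apply, mul_one]
    exact shift_sub_mem _ _
  · rw [integral_eq_iff]
    have := shift_sub_mem (1 / 2) (qpow 1 * A.1 1)
    rw [shift_mul] at this
    norm_num at this ⊢
    rwa [mul_comm (shift (1 / 2) (A.1 1))]

/-- Modulo total derivatives P is the identity, and p_{-1} − q p_1 is the trace against the grading
of K, namely Λ − qΛ⁻¹. -/
theorem integral_motion (L : Op) (k : ℕ) : integral (motion tau L k) =
    tr (L ^ k * grade kOp) - tr (Op.const tau * L ^ k) := by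
  rw [tr_mul_grade_kOp, tr_apply, Op.const_mul_apply dx_tau, ← map_sub, integral_eq_iff, motion,
    sub_sub_sub_cancel_left, ← mul_sub, ← neg_mem_iff, ← mul_neg, neg_sub]
  exact const_mul_mem_exact dx_tau (opP_sub_mem _)

/-- In the trace of U^{m+1} times the grading of S, only the coefficient of U^{-m-1} survives, since
U^j N(U)U⁻¹ has zero trace for j > 0. Computed directly from S = K − L + τw, the same trace is the
integral of the (m+1)-st constant of motion. -/
theorem IsToda.expCoeff_eq {w : Op} {U : Opˣ} (hL : IsToda U) (hU : MonicUnit U) (hw : w.Le (-1))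
    (hG : HasLin (derSeq U grade) (1 + grade w))
    (hlog : ∀ X, HasLin (conjSeq U X) (coeffwise epsDx X + (w * X - X * w))) (m : ℕ) :
    -((m + 1) • expCoeff U (sOp U w) m) = zc (m + 1) := by
  have hS := hL.sOp_le hw
  have hc := hL.sOp_comm hlog
  have hr := hU.dx_expCoeff hS hc
  have hr' : ∀ m, dx (-((m + 1) • expCoeff U (sOp U w) m)) = 0 := fun m => by
    rw [map_neg, map_nsmul, hr, smul_zero, neg_zero]
  have h1 := hU.tr_pow_mul_der_of_comm isDer_grade (fun A m h => grade_le h) hS hc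
    (fun m A => grade_const_mul (hr m) A) (m + 1)
  rw [Finset.sum_range_succ, Finset.sum_eq_zero, zero_add, show m + 1 - 1 - m = 0 by omega,
    pow_zero, one_mul] at h1
  swap
  · intro i hi
    have hi' := Finset.mem_range.1 hi
    rw [tr_const_mul (hr' i) (B := 0) (by
      rw [tr_pow_mul_logDer_grade U (by omega), map_zero]), mul_zero, map_zero]
  rw [tr_apply (Op.const _ * _), Op.const_mul_apply (hr' m), hU.logDer_grade, mul_one] at h1
  have h2 : tr ((U : Op) ^ (m + 1) * grade w) = -tr ((U : Op) ^ (m + 1)) := by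
    have h3 := tr_pow_mul_lin isDer_grade hG (m + 1)
    rw [tr_pow_mul_logDer_grade U m.succ_pos, mul_add, mul_one, map_add] at h3
    exact eq_neg_of_add_eq_zero_right h3
  have h4 : tr ((U : Op) ^ (m + 1) * grade (sOp U w)) = integral (zc (m + 1)) := by
    rw [← hL.motion (m + 1) m.succ_pos, integral_motion, sOp, map_add, map_sub,
      grade_const_mul dx_tau, mul_add, mul_sub, map_add, map_sub, tr_pow_mul_der,
      tr_pow_mul_logDer_grade U (by omega), sub_zero, ← mul_assoc, ← Op.const_comm dx_tau,
      mul_assoc, tr_const_mul dx_tau (B := -(U : Op) ^ (m + 1)) (by rw [h2, map_neg]), mul_neg,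
      map_neg, sub_eq_add_neg]
  rw [h4, eq_comm, integral_eq_iff] at h1
  rw [← sub_eq_zero]
  refine eq_zero_of_const_of_exact ?_ h1
  rw [map_sub, dx_zc, hr', sub_zero]

theorem IsEvo.eq_evol {T : DiffAlg →+ DiffAlg} (h : IsEvo T) (f : DiffAlg) :
    T f = evol (fun i => T (field i)) f :=
  h.ext (isEvo_evol _) (fun i => (evol_field (fun i => T (field i)) i).symm) f

theorem IsEvo.const {T : DiffAlg →+ DiffAlg} (h : IsEvo T) {c : DiffAlg} (hc : EqToda.dx c = 0) :
    T c = 0 := by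
  have h1 : ∀ n, dx₀ (PowerSeries.coeff n c) = 0 := fun n => by rw [← coeff_dx, hc, map_zero]
  rw [h.eq_evol]
  ext1 n
  rw [evol, coeff_epsLift]
  refine Finset.sum_eq_zero fun p _ => ?_
  rw [← epsLift_C]
  change PowerSeries.coeff p.1 (evol _ _) = 0
  rw [evol_C]
  simp [pd_eq_zero_of_dx₀ (h1 _)]

theorem IsEvo.coeffwise_const_mul {T : DiffAlg →+ DiffAlg} (h : IsEvo T) {c : DiffAlg}
    (hc : EqToda.dx c = 0) (A : Op) : coeffwise T (Op.const c * A) = Op.const c * coeffwise T A :=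
  Op.ext' fun k => by
    rw [coeffwise_apply, Op.const_mul_apply hc, Op.const_mul_apply hc, coeffwise_apply,
      h.const_mul (h.const hc)]

/-- Differentiating [log U, X] in two ways shows that T w and the linear coefficient of T(U^n)U^{-n}
have the same commutators. Their difference is central of negative order, hence zero. -/
theorem IsEvo.coeffwise_log {T : DiffAlg →+ DiffAlg} (h : IsEvo T) {U : Opˣ} (hU : MonicUnit U)
    {w : Op} (hw : w.Le (-1))
    (hlog : ∀ X, HasLin (conjSeq U X) (coeffwise epsDx X + (w * X - X * w))) :
    HasLin (derSeq U (coeffwise T)) (coeffwise T w) := by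
  obtain ⟨G, hG⟩ := hU.exists_derSeq h.isDer
  have hGle : G.Le (-1) := hG.le (hU.derSeq_coeffwise_le (leibniz_one h.leibniz))
  have h1 : coeffwise T w - G = 0 := by
    refine eq_zero_of_central ((coeffwise_le hw).sub hGle) fun X => ?_
    have h2 := HasLin.conjSeq_der h.isDer (epsDvd_coeffwise h.eps) (hlog X) (hlog _) hG
    have h3 : coeffwise T (coeffwise epsDx X) = coeffwise epsDx (coeffwise T X) :=
      Op.ext' fun k => by
        simp only [coeffwise_apply, epsDx_apply, h.eps, h.dx]
    rw [map_add, h3, h.isDer.comm, ← sub_eq_zero] at h2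
    rw [← sub_eq_zero, ← h2]
    noncomm_ring
  rw [sub_eq_zero] at h1
  rw [h1]
  exact hG

theorem IsEvo.integral_hDensity {T : DiffAlg →+ DiffAlg} (h : IsEvo T) (U : Opˣ) (n : ℕ) :
    integral (T (hDensity (U : Op).1 n)) = tr ((U : Op) ^ (n + 1) * logDer U (coeffwise T)) := by
  rw [hDensity, map_rat_smul T, map_smul, ← Op.pow_val]
  change _ • tr (coeffwise T ((U : Op) ^ (n + 1))) = _
  rw [tr_der_pow h.isDer, ← Nat.cast_smul_eq_nsmul ℚ, smul_smul, Nat.cast_succ,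
    one_div_mul_cancel (by positivity), one_smul]

/-- The variation of the Hamiltonian `H_n`. -/
theorem IsToda.integral_hamDensity {L : Op} (hL : IsToda L) {T : DiffAlg →+ DiffAlg} (h : IsEvo T)
    {n : ℕ} (hn : 0 < n) :
    integral (T (hamDensity L.1 n)) = tr (L ^ n * coeffwise T kOp) := by
  obtain ⟨U, rfl, hU⟩ := hL.exists_unit
  obtain ⟨w, hw, hG, hlog⟩ := hU.exists_log
  have hS := hL.sOp_le hw
  have hc := hL.sOp_comm hlog
  have hr := hU.dx_expCoeff hS hc
  have h1 := hU.tr_pow_mul_der_of_comm h.isDer (fun A m h => coeffwise_le h) hS hc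
    (fun m A => h.coeffwise_const_mul (hr m) A) n
  have h2 := tr_pow_mul_lin h.isDer (h.coeffwise_log hU hw hlog) n
  have h3 : tr ((U : Op) ^ n * coeffwise T (sOp U w)) = tr ((U : Op) ^ n * coeffwise T kOp) -
      tr ((U : Op) ^ (n + 1) * logDer U (coeffwise T)) +
      tr (Op.const tau * ((U : Op) ^ n * logDer U (coeffwise T))) := by
    rw [sOp, map_add, map_sub, h.coeffwise_const_mul dx_tau, mul_add, mul_sub, map_add, map_sub,
      tr_pow_mul_der, ← mul_assoc, ← Op.const_comm dx_tau, mul_assoc, tr_const_mul dx_tau h2]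
  have hlog1 : (logDer U (coeffwise T)).Le (-1) := by
    have := hU.derSeq_coeffwise_le (leibniz_one h.leibniz) 1
    rwa [derSeq, pow_one, pow_one] at this
  obtain ⟨n, rfl⟩ := Nat.exists_eq_succ_of_ne_zero hn.ne'
  have h5 : ∀ k j, integral (T (zc k * hDensity (U : Op).1 j)) =
      tr (Op.const (zc k) * ((U : Op) ^ (j + 1) * logDer U (coeffwise T))) := fun k j => by
    rw [h.const_mul (h.const (dx_zc k)), tr_apply, integral_eq_iff, Op.const_mul_apply (dx_zc k),
      ← mul_sub]
    exact const_mul_mem_exact (dx_zc k) (integral_eq_iff.1 (h.integral_hDensity U j))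
  have h6 : integral (T (tau * hDensity (U : Op).1 n)) =
      tr (Op.const tau * ((U : Op) ^ (n + 1) * logDer U (coeffwise T))) := by
    rw [h.const_mul h.tau, tr_apply, integral_eq_iff, Op.const_mul_apply dx_tau, ← mul_sub]
    exact const_mul_mem_exact dx_tau (integral_eq_iff.1 (h.integral_hDensity U n))
  simp only [hL.expCoeff_eq hU hw hG hlog] at h1
  -- The term with z_{n+1} (in the shifted n) multiplies T(U)U⁻¹, which has order −1 because the
  -- leading coefficient 1 is not varied; so it has no trace. The other terms are the variations of
  -- the summands of H_{n+1}.
  rw [h3, Finset.sum_range_succ, show n + 1 - 1 - n = 0 by omega, pow_zero, one_mul,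
    tr_eq_zero (A := Op.const (zc (n + 1)) * _) (fun k hk => by
      rw [Op.const_mul_apply (dx_zc _), hlog1 k hk, mul_zero]), add_zero] at h1
  have h7 : ∑ k ∈ Finset.Icc 1 n, integral (T (zc k * hDensity (U : Op).1 (n + 1 - k - 1))) =
      ∑ m ∈ Finset.range n, tr (Op.const (zc (m + 1)) *
        ((U : Op) ^ (n + 1 - 1 - m) * logDer U (coeffwise T))) := by
    refine Finset.sum_nbij' (fun k => k - 1) (fun m => m + 1) ?_ ?_ ?_ ?_ ?_
    · intro k hk; simp only [Finset.mem_Icc, Finset.mem_range] at hk ⊢; omega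
    · intro k hk; simp only [Finset.mem_Icc, Finset.mem_range] at hk ⊢; omega
    · intro k hk; simp only [Finset.mem_Icc] at hk; omega
    · intro k _; rfl
    · intro k hk
      have hk' := Finset.mem_Icc.1 hk
      rw [h5, Nat.sub_add_cancel hk'.1, show n + 1 - k - 1 + 1 = n + 1 - 1 - (k - 1) by omega]
  rw [hamDensity, map_add, map_sub, map_sum, map_add, map_sub, map_sum, Nat.succ_sub_one, h6, h7,
    ← h1, h.integral_hDensity]
  abel

/-! ### Variational derivatives -/

/-- The variational derivative of a density. -/
def delta (i : Fin 2) : DiffAlg →ₗ[ℚ] DiffAlg := epsExt (varDer₀ i)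

theorem varDer_integral (i : Fin 2) (f : DiffAlg) : varDer i (integral f) = delta i f := rfl

theorem mem_exact_of_C {T : DiffAlg →+ DiffAlg}
    (hT : ∀ f, T (PowerSeries.X * f) = PowerSeries.X * T f)
    (h : ∀ a, T (PowerSeries.C a) ∈ exact) (f : DiffAlg) : T f ∈ exact := by
  have h1 := epsLift_unique (d := T.comp (PowerSeries.C (R := DiffPoly)).toAddMonoidHom) hT
    (fun _ => rfl) f
  rw [h1, mem_exact_iff]
  intro m
  rw [coeff_epsLift]
  exact Submodule.sum_mem _ fun p _ => mem_exact_iff.1 (h _) _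

theorem dx_pow_mul_sub_mem (n : ℕ) (a : DiffAlg) (b : DiffPoly) :
    (dx ^ n) a * PowerSeries.C b -
      a * PowerSeries.C (((-(dx₀ : DiffPoly →ₗ[ℚ] DiffPoly)) ^ n) b) ∈ exact := by
  induction n generalizing a with
  | zero => simp
  | succ n ih =>
    have h1 := ih (dx a)
    have h2 := mul_dx_add_mem a (PowerSeries.C (((-(dx₀ : DiffPoly →ₗ[ℚ] DiffPoly)) ^ n) b))
    set B := ((-(dx₀ : DiffPoly →ₗ[ℚ] DiffPoly)) ^ n) b with hB
    have h3 : ((-(dx₀ : DiffPoly →ₗ[ℚ] DiffPoly)) ^ (n + 1)) b + dx₀ B = 0 := by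
      rw [pow_succ', Module.End.mul_apply, LinearMap.neg_apply, ← hB]
      exact neg_add_cancel _
    have h4 := congrArg (PowerSeries.C (R := DiffPoly)) h3
    rw [map_add, ← dx_C, map_zero] at h4
    rw [eq_neg_of_add_eq_zero_left h4, pow_succ, Module.End.mul_apply]
    convert Submodule.add_mem _ h1 h2 using 1
    ring

theorem finsum_sub_mem {s t : ℕ → DiffAlg} (N : ℕ) (hs : ∀ n, N ≤ n → s n = 0)
    (ht : ∀ n, N ≤ n → t n = 0) (h : ∀ n, s n - t n ∈ exact) :
    (∑ᶠ n, s n) - ∑ᶠ n, t n ∈ exact := by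
  have key : ∀ r : ℕ → DiffAlg, (∀ n, N ≤ n → r n = 0) →
      ∑ᶠ n, r n = ∑ n ∈ Finset.range N, r n := fun r hr =>
    finsum_eq_sum_of_support_subset _ fun n hn => by
      rw [Finset.coe_range, Set.mem_Iio]
      by_contra h'
      exact hn (hr n (not_lt.1 h'))
  rw [key s hs, key t ht, ← Finset.sum_sub_distrib]
  exact Submodule.sum_mem _ fun n _ => h n

/-- The first variation formula: each term (∂^n a)(∂f/∂x^{(n)}) is integrated by parts n times. -/
theorem evol_sub_mem (a : Fin 2 → DiffAlg) (f : DiffAlg) :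
    evol a f - ∑ i, a i * delta i f ∈ exact := by
  let T : DiffAlg →+ DiffAlg := evol a -
    ∑ i, (AddMonoidHom.mulLeft (a i)).comp (delta i).toAddMonoidHom
  have hT : ∀ f, T f = evol a f - ∑ i, a i * delta i f := fun f => by
    simp only [T, AddMonoidHom.sub_apply, AddMonoidHom.finsetSum_apply]
    rfl
  rw [← hT]
  refine mem_exact_of_C (fun f => ?_) (fun g => ?_) f
  · have h1 : ∑ i, a i * delta i (PowerSeries.X * f) = PowerSeries.X * ∑ i, a i * delta i f := by
      rw [Finset.mul_sum]
      exact Finset.sum_congr rfl fun i _ => by rw [delta, epsExt_X_mul, mul_left_comm]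
    rw [hT, hT, (isEvo_evol a).eps, h1, mul_sub]
  · rw [hT, evol_C, ← Finset.sum_sub_distrib]
    refine Submodule.sum_mem _ fun i _ => ?_
    obtain ⟨N, hN⟩ := exists_bound_jet (jet i) (jet_injective i) g
    have h1 : a i * delta i (PowerSeries.C g) = ∑ᶠ n, a i * PowerSeries.C (varTerm i n g) := by
      rw [delta, epsExt_C, ← mul_finsum' _ _ ?_]
      · congr 1
        exact (PowerSeries.C (R := DiffPoly)).toAddMonoidHom.map_finsum (varTerm_finite i g)
      · exact (varTerm_finite i g).subset fun n hn h => hn (by simp [h])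
    rw [h1]
    exact finsum_sub_mem N (fun n hn => by simp [hN n hn])
      (fun n hn => by simp [varTerm, hN n hn]) fun n => dx_pow_mul_sub_mem n (a i) _

theorem IsEvo.integral_eq {T : DiffAlg →+ DiffAlg} (h : IsEvo T) (f : DiffAlg) :
    integral (T f) = integral (∑ i, T (field i) * delta i f) := by
  rw [integral_eq_iff, h.eq_evol f]
  exact evol_sub_mem _ f

theorem IsEvo.mem_exact {T : DiffAlg →+ DiffAlg} (h : IsEvo T) {f : DiffAlg} (hf : f ∈ exact) :
    T f ∈ exact := by
  obtain ⟨g, rfl⟩ := hf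
  exact ⟨T g, (h.dx g).symm⟩

theorem IsEvo.integral_congr {T : DiffAlg →+ DiffAlg} (h : IsEvo T) {f g : DiffAlg}
    (hf : integral f = integral g) : integral (T f) = integral (T g) := by
  rw [integral_eq_iff, ← map_sub]
  exact h.mem_exact (integral_eq_iff.1 hf)

/-! ### Nondegeneracy of the pairing and symmetry of the second variation -/

theorem pd_comm (i j : Fin 2) (m n : ℕ) (f : DiffPoly) :
    pd (jet i m) (pd (jet j n) f) = pd (jet j n) (pd (jet i m) f) := by
  rw [pd, pd, extDer_comm]
  have h1 : ⁅MvPolynomial.pderiv (R := ℚ) (jet i m), MvPolynomial.pderiv (R := ℚ) (jet j n)⁆ = 0 :=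
    MvPolynomial.derivation_ext fun g => by
      simp only [Derivation.commutator_apply, MvPolynomial.pderiv_X, Pi.single_apply]
      split_ifs <;> simp
  have h2 : MvPolynomial.pderiv (R := ℚ) (jet i m) (if jet j n = Gen.u 0 then 1 else 0) -
      MvPolynomial.pderiv (R := ℚ) (jet j n) (if jet i m = Gen.u 0 then 1 else 0) = 0 := by
    split_ifs <;> simp
  rw [h1, h2, extDer_zero, add_zero]

/-- A total derivative is affine in its highest jet. The product of g with the square of a jet of u
above all those occurring in g therefore cannot be one unless g = 0. -/
theorem eq_zero_of_mul_mem_range {g : DiffPoly}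
    (h : ∀ a, g * a ∈ LinearMap.range (dx₀ : DiffPoly →ₗ[ℚ] DiffPoly)) : g = 0 := by
  obtain ⟨M, hM⟩ := exists_bound_jet (jet 1) (jet_injective 1) g
  set x : DiffPoly := LaurentPolynomial.C (MvPolynomial.X (jet 1 (M + 1))) with hx
  obtain ⟨k, hk⟩ := h (x * x)
  rw [Derivation.coeFn_coe] at hk
  obtain ⟨N, hN⟩ := exists_bound_jet (jet 1) (jet_injective 1) k
  have hpx : ∀ n, pd (jet 1 n) x = if n = M + 1 then 1 else 0 := fun n => by
    rw [hx, pd_C_X]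
    exact if_congr ⟨fun h => (jet_injective 1 h).symm, fun h => by rw [h]⟩ rfl rfl
  have hpg : ∀ n, M ≤ n → pd (jet 1 n) (g * (x * x)) = if n = M + 1 then 2 * (g * x) else 0 := by
    intro n hn
    rw [Derivation.leibniz, Derivation.leibniz, hM n hn, hpx]
    split_ifs
    · simp only [smul_eq_mul]; ring
    · simp
  -- Descending from the bound N, the primitive k is independent of u^{(n)} for n ≥ M + 1. Then 2gx
  -- = ∂k/∂u^{(M)}, and one more derivative in u^{(M+1)} gives 2g = 0.
  have h1 : ∀ j n, M + 1 ≤ n → N ≤ n + j → pd (jet 1 n) k = 0 := by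
    intro j
    induction j with
    | zero => exact fun n _ hn => hN n hn
    | succ j ih =>
      intro n hn hj
      have h2 := pd_dx_succ 1 n k
      rw [ih (n + 1) (by omega) (by omega), map_zero, zero_add, hk, hpg _ (by omega),
        if_neg (by omega)] at h2
      exact h2.symm
  have h2 := pd_dx_succ 1 M k
  rw [h1 N (M + 1) le_rfl (by omega), map_zero, zero_add, hk, hpg _ (by omega), if_pos rfl] at h2
  have h3 := congrArg (pd (jet 1 (M + 1))) h2
  rw [pd_comm, h1 N (M + 1) le_rfl (by omega), map_zero, two_mul, map_add, Derivation.leibniz, hpx,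
    if_pos rfl, hM _ (by omega), smul_zero, add_zero, smul_eq_mul, mul_one, ← two_mul] at h3
  have h4 : (2 : ℚ) • g = 0 := by rw [← h3, two_smul, two_mul]
  exact (smul_eq_zero.1 h4).resolve_left two_ne_zero

/-- The fundamental lemma of the calculus of variations. -/
theorem eq_zero_of_mul_mem_exact {f : DiffAlg} (h : ∀ a, f * a ∈ exact) : f = 0 := by
  ext1 n
  rw [map_zero]
  refine eq_zero_of_mul_mem_range fun a => ?_
  have := mem_exact_iff.1 (h (PowerSeries.C a)) n
  rwa [PowerSeries.coeff_mul_C] at this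

/-- Variational derivatives are determined by the variation along evolutionary derivations. -/
theorem delta_eq {f : DiffAlg} {g : Fin 2 → DiffAlg}
    (h : ∀ T : DiffAlg →+ DiffAlg, IsEvo T →
      integral (T f) = integral (∑ i, T (field i) * g i)) (i : Fin 2) : delta i f = g i := by
  rw [← sub_eq_zero]
  refine eq_zero_of_mul_mem_exact fun a => ?_
  have h1 := h _ (isEvo_evol (Pi.single i a))
  rw [(isEvo_evol _).integral_eq, integral_eq_iff, ← Finset.sum_sub_distrib,
    Finset.sum_eq_single i] at h1
  · rw [evol_field, Pi.single_eq_same, ← mul_sub, mul_comm] at h1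
    exact h1
  · intro j _ hj
    rw [evol_field, Pi.single_eq_of_ne hj, zero_mul, zero_mul, sub_zero]
  · simp

theorem IsEvo.comm {S T : DiffAlg →+ DiffAlg} (hS : IsEvo S) (hT : IsEvo T) :
    IsEvo (S.comp T - T.comp S) := by
  have e : ∀ f, (S.comp T - T.comp S) f = S (T f) - T (S f) := fun _ => rfl
  refine ⟨fun f => ?_, fun f g => ?_, fun f => ?_, ?_, fun k => ?_, fun k => ?_, ?_⟩
  · simp only [e, hS.eps, hT.eps]; ring
  · simp only [e, hS.leibniz, hT.leibniz, map_add]; ring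
  · simp only [e, hS.dx, hT.dx, map_sub]
  · simp only [e, hS.tau, hT.tau, map_zero, sub_zero]
  · simp only [e, hS.z, hT.z, map_zero, sub_zero]
  · simp only [e, hS.zbar, hT.zbar, map_zero, sub_zero]
  · simp only [e, hS.log, hT.log, hS.leibniz, hT.leibniz]; ring

/-- The second variation is symmetric. -/
theorem IsEvo.second_variation {S T : DiffAlg →+ DiffAlg} (hS : IsEvo S) (hT : IsEvo T)
    (f : DiffAlg) : integral (∑ i, T (field i) * S (delta i f)) =
      integral (∑ i, S (field i) * T (delta i f)) := by
  have key : ∀ {S T : DiffAlg →+ DiffAlg}, IsEvo S → IsEvo T → integral (S (T f)) =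
      integral (∑ i, S (T (field i)) * delta i f) +
        integral (∑ i, T (field i) * S (delta i f)) := by
    intro S T hS hT
    rw [hS.integral_congr (hT.integral_eq f), ← map_add, map_sum, ← Finset.sum_add_distrib]
    congr 1
    refine Finset.sum_congr rfl fun i _ => ?_
    rw [hS.leibniz]
    ring
  -- The commutator of S and T is evolutionary, so its first variation accounts for the terms with S
  -- T x_i and T S x_i; the second variations are what remains.
  have h := (hS.comm hT).integral_eq f
  have e : ∀ f, (S.comp T - T.comp S) f = S (T f) - T (S f) := fun _ => rfl
  simp only [e, sub_mul, Finset.sum_sub_distrib] at h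
  rw [map_sub, map_sub, key hS hT, key hT hS] at h
  rw [← sub_eq_zero]
  rw [← sub_eq_zero] at h
  rw [← h]
  abel

/-! ### Poisson structures with constant coefficients -/

/-- Skew-adjoint matrices of operators which commute with evolutionary derivations. -/
structure IsConstSkew (P : MatOp) : Prop where
  skew : ∀ i j f g, f * P i j g + g * P j i f ∈ exact
  evo : ∀ {T : DiffAlg →+ DiffAlg}, IsEvo T → ∀ i j f, T (P i j f) = P i j (T f)

/-- The Hamiltonian vector field of the functional `F`. -/
def hamField (P : MatOp) (F : Functional) : DiffAlg →+ DiffAlg :=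
  evol fun i => ∑ j, P i j (varDer j F)

theorem isEvo_hamField (P : MatOp) (F : Functional) : IsEvo (hamField P F) := isEvo_evol _

theorem hamField_field (P : MatOp) (F : Functional) (i : Fin 2) :
    hamField P F (field i) = ∑ j, P i j (varDer j F) := evol_field _ i

theorem bracket_eq (P : MatOp) (F G : Functional) :
    bracket P F G = integral (∑ i, hamField P G (field i) * varDer i F) := by
  rw [bracket]
  congr 1
  refine Finset.sum_congr rfl fun i _ => ?_
  rw [hamField_field, mul_comm, Finset.mul_sum]

theorem IsEvo.integral_eq_bracket {P : MatOp} {H : Functional} {T : DiffAlg →+ DiffAlg}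
    (h : IsEvo T) (hT : ∀ i, T (field i) = ∑ j, P i j (varDer j H)) (f : DiffAlg) :
    integral (T f) = bracket P (integral f) H := by
  have e : ∀ i, T (field i) * delta i f = hamField P H (field i) * varDer i (integral f) :=
    fun i => by rw [hT, hamField_field, varDer_integral]
  rw [h.integral_eq, bracket_eq, Finset.sum_congr rfl fun i _ => e i]

theorem integral_hamField (P : MatOp) (f : DiffAlg) (H : Functional) :
    integral (hamField P H f) = bracket P (integral f) H :=
  (isEvo_hamField P H).integral_eq_bracket (hamField_field P H) f

theorem IsConstSkew.sum_skew {P : MatOp} (hP : IsConstSkew P) (a b : Fin 2 → DiffAlg) :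
    integral (∑ i, ∑ j, a i * P i j (b j)) = -integral (∑ i, ∑ j, b i * P i j (a j)) := by
  rw [← sub_eq_zero, sub_neg_eq_add, ← map_add, integral_eq_zero_iff,
    Finset.sum_comm (f := fun i j => b i * P i j (a j)), ← Finset.sum_add_distrib]
  refine Submodule.sum_mem _ fun i _ => ?_
  rw [← Finset.sum_add_distrib]
  exact Submodule.sum_mem _ fun j _ => hP.skew i j _ _

theorem IsConstSkew.bracket_skew {P : MatOp} (hP : IsConstSkew P) (F G : Functional) :
    bracket P F G = -bracket P G F := hP.sum_skew (fun i => varDer i F) fun i => varDer i G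

/-- The form `∑ ∫ (X_F (δ_i G)) (X_H x_i) dx`. -/
def secondVar (P : MatOp) (F G H : Functional) : Functional :=
  integral (∑ i, hamField P H (field i) * hamField P F (varDer i G))

theorem secondVar_symm (P : MatOp) (F G H : Functional) :
    secondVar P F G H = secondVar P H G F := by
  obtain ⟨g, rfl⟩ := Submodule.mkQ_surjective _ G
  exact (isEvo_hamField P F).second_variation (isEvo_hamField P H) g

/-- The vector field of F passes through P unchanged, so it acts only on the variational derivatives
of G and H. -/
theorem IsConstSkew.bracket_bracket {P : MatOp} (hP : IsConstSkew P) (F G H : Functional) :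
    bracket P F (bracket P G H) = secondVar P F H G - secondVar P F G H := by
  have h1 : bracket P (bracket P G H) F =
      integral (hamField P F (∑ i, ∑ j, varDer i G * P i j (varDer j H))) :=
    (integral_hamField P _ F).symm
  have hX := isEvo_hamField P F
  have h2 : integral (hamField P F (∑ i, ∑ j, varDer i G * P i j (varDer j H))) =
      integral (∑ i, ∑ j, hamField P F (varDer i G) * P i j (varDer j H)) +
      integral (∑ i, ∑ j, varDer i G * P i j (hamField P F (varDer j H))) := by
    rw [← map_add, map_sum, ← Finset.sum_add_distrib]
    congr 1
    refine Finset.sum_congr rfl fun i _ => ?_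
    rw [map_sum, ← Finset.sum_add_distrib]
    refine Finset.sum_congr rfl fun j _ => ?_
    rw [hX.leibniz, hP.evo hX]
    ring
  have h3 : ∀ G H, integral (∑ i, ∑ j, hamField P F (varDer i G) * P i j (varDer j H)) =
      secondVar P F G H := fun G H => by
    rw [secondVar]
    congr 1
    refine Finset.sum_congr rfl fun i _ => ?_
    rw [hamField_field, Finset.sum_mul]
    exact Finset.sum_congr rfl fun j _ => mul_comm _ _
  rw [hP.bracket_skew, h1, h2, h3, hP.sum_skew, h3]
  abel

theorem IsConstSkew.isPoisson {P : MatOp} (hP : IsConstSkew P) : IsPoisson P where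
  skew := hP.bracket_skew
  jacobi F G H := by
    rw [hP.bracket_bracket, hP.bracket_bracket, hP.bracket_bracket, secondVar_symm P F H G,
      secondVar_symm P G F H, secondVar_symm P H G F]
    abel

theorem mem_exact_of_X_mul {f : DiffAlg} (h : PowerSeries.X * f ∈ exact) : f ∈ exact := by
  rw [mem_exact_iff] at h ⊢
  intro m
  have := h (m + 1)
  rwa [PowerSeries.coeff_succ_X_mul] at this

theorem shift_adjoint (s : ℚ) (f g : DiffAlg) : f * shift s g - shift (-s) f * g ∈ exact := by
  have h := shift_sub_mem (-s) (f * shift s g)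
  rw [shift_mul, shift_neg_apply, ← neg_mem_iff, neg_sub] at h
  exact h

/-- The adjoint of E^s is E^{-s}, so E^{1/2} − E^{-1/2} is skew; the factor ε can be removed because
exactness is a condition on each ε-coefficient. -/
theorem nabla_skew (f g : DiffAlg) : f * nabla g + g * nabla f ∈ exact := by
  refine mem_exact_of_X_mul ?_
  have h := Submodule.sub_mem _ (shift_adjoint (1 / 2) f g) (shift_adjoint (-(1 / 2)) f g)
  rw [neg_neg] at h
  convert h using 1
  rw [mul_add, mul_left_comm, mul_left_comm _ g, X_mul_nabla, X_mul_nabla]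
  ring

theorem dx_skew (f g : DiffAlg) : f * (tau * dx g) + g * (tau * dx f) ∈ exact := by
  have h := const_mul_mem_exact dx_tau (mul_dx_add_mem f g)
  convert h using 1
  ring

theorem isConstSkew_equivariantPoisson : IsConstSkew equivariantPoisson where
  skew i j f g := by
    fin_cases i <;> fin_cases j
    · exact dx_skew f g
    · exact nabla_skew f g
    · exact nabla_skew f g
    · change f * 0 + g * 0 ∈ exact
      rw [mul_zero, mul_zero, add_zero]
      exact Submodule.zero_mem _
  evo {T} hT i j f := by
    fin_cases i <;> fin_cases j
    · change T (tau * dx f) = tau * dx (T f)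
      rw [hT.const_mul hT.tau, hT.dx]
    · exact hT.nabla f
    · exact hT.nabla f
    · exact map_zero T

theorem isConstSkew_todaPoisson : IsConstSkew todaPoisson where
  skew i j f g := by
    have h0 : f * 0 + g * 0 ∈ exact := by
      rw [mul_zero, mul_zero, add_zero]
      exact Submodule.zero_mem _
    fin_cases i <;> fin_cases j
    · exact h0
    · exact nabla_skew f g
    · exact nabla_skew f g
    · exact h0
  evo {T} hT i j f := by
    fin_cases i <;> fin_cases j
    · exact map_zero T
    · exact hT.nabla f
    · exact hT.nabla f
    · exact map_zero T

/-! ### Variational derivatives of the Hamiltonians -/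

theorem tail_rescale_neg_one (φ : PowerSeries ℚ) : tail (PowerSeries.rescale (-1) φ) =
    -PowerSeries.rescale (-1) (tail φ) := by
  ext n
  rw [map_neg, PowerSeries.coeff_rescale, tail, tail, PowerSeries.coeff_mk, PowerSeries.coeff_mk,
    PowerSeries.coeff_rescale, pow_succ]
  ring

theorem opSeries_neg (φ : PowerSeries ℚ) (f : DiffAlg) : opSeries (-φ) f = -opSeries φ f := by
  have h := opSeries_add (-φ) φ f
  rw [neg_add_cancel, ← map_zero (PowerSeries.C (R := ℚ)), opSeries_C, zero_smul] at h
  exact eq_neg_of_add_eq_zero_left h.symm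

/-- Integration by parts turns φ(ε∂) into φ(−ε∂). -/
theorem opSeries_adjoint (φ : PowerSeries ℚ) (f g : DiffAlg) :
    f * opSeries φ g - opSeries (PowerSeries.rescale (-1) φ) f * g ∈ exact := by
  have key : ∀ (N : ℕ) (φ : PowerSeries ℚ) (f g : DiffAlg), ∃ h, (PowerSeries.X : DiffAlg) ^ N ∣
      f * opSeries φ g - opSeries (PowerSeries.rescale (-1) φ) f * g - dx h := by
    intro N
    induction N with
    | zero => exact fun φ f g => ⟨0, by rw [pow_zero]; exact one_dvd _⟩
    | succ N ih =>
      intro φ f g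
      obtain ⟨h, hh⟩ := ih (tail φ) (dx f) g
      refine ⟨PowerSeries.X * (f * opSeries (tail φ) g - h), ?_⟩
      have h0 : PowerSeries.constantCoeff (PowerSeries.rescale (-1 : ℚ) φ) =
          PowerSeries.constantCoeff φ := by
        rw [← PowerSeries.coeff_zero_eq_constantCoeff_apply, PowerSeries.coeff_rescale]
        simp
      have h1 : f * opSeries φ g - opSeries (PowerSeries.rescale (-1) φ) f * g -
          dx (PowerSeries.X * (f * opSeries (tail φ) g - h)) = PowerSeries.X * -(dx f *
          opSeries (tail φ) g - opSeries (PowerSeries.rescale (-1) (tail φ)) (dx f) * g - dx h) := by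
        rw [opSeries_eq_tail φ, opSeries_eq_tail (PowerSeries.rescale (-1) φ), h0,
          tail_rescale_neg_one, opSeries_neg, dx_X_mul, map_sub, dx_mul, opSeries_dx (tail φ),
          mul_add, mul_smul_comm, add_mul, smul_mul_assoc]
        ring
      rw [h1, pow_succ']
      exact mul_dvd_mul_left _ (dvd_neg.2 hh)
  -- The primitives found modulo different powers of ε need not fit together, because exactness is
  -- tested coefficient by coefficient.
  rw [mem_exact_iff]
  intro m
  obtain ⟨h, hh⟩ := key (m + 1) φ f g
  have h1 := PowerSeries.X_pow_dvd_iff.1 hh m m.lt_succ_self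
  rw [map_sub, sub_eq_zero, coeff_dx] at h1
  exact ⟨_, h1.symm⟩

theorem rescale_neg_one_sinhc : PowerSeries.rescale (-1) sinhc = sinhc := by
  have h := congrArg (PowerSeries.rescale (-1 : ℚ)) X_mul_sinhc
  rw [map_mul, map_sub, PowerSeries.rescale_rescale, PowerSeries.rescale_rescale,
    PowerSeries.rescale_X, show (1 / 2 : ℚ) * -1 = -(1 / 2) by norm_num,
    show (-(1 / 2) : ℚ) * -1 = 1 / 2 by norm_num, ← neg_sub, ← X_mul_sinhc, map_neg, map_one] at h
  refine mul_left_cancel₀ (PowerSeries.X_ne_zero (R := ℚ)) ?_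
  linear_combination -h

theorem rescale_neg_one_sinhc_inv : PowerSeries.rescale (-1) sinhc⁻¹ = sinhc⁻¹ := by
  have h0 : PowerSeries.constantCoeff sinhc ≠ 0 := by
    rw [constantCoeff_sinhc]; exact one_ne_zero
  rw [PowerSeries.eq_inv_iff_mul_eq_one h0]
  nth_rewrite 2 [← rescale_neg_one_sinhc]
  rw [← map_mul, PowerSeries.inv_mul_cancel _ h0, map_one]

theorem opP_adjoint (f g : DiffAlg) : f * opP g - opP f * g ∈ exact := by
  have h := opSeries_adjoint sinhc⁻¹ f g
  rw [rescale_neg_one_sinhc_inv] at h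
  exact h

theorem tr_mul_coeffwise_kOp {T : DiffAlg →+ DiffAlg} (h : IsEvo T) (A : Op) :
    tr (A * coeffwise T kOp) =
      integral (T (field 0) * A.1 0 + T (field 1) * (qpow 1 * A.1 1)) := by
  have h1 : coeffwise T kOp = Op.mono 0 (T (field 0)) + Op.mono (-1) (qpow 1 * T (field 1)) :=
    Op.ext' fun k => by
      rw [coeffwise_apply, kOp_apply, Op.add_apply, Op.mono_apply, Op.mono_apply]
      by_cases h1 : k = 1
      · subst h1
        simp [leibniz_one h.leibniz]
      by_cases h0 : k = 0
      · subst h0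
        simp
      by_cases h2 : k = -1
      · subst h2
        simp [h.log]
      · simp [h1, h0, h2]
  rw [h1, mul_add, map_add, tr_apply, tr_apply, Op.mul_mono_apply, Op.mul_mono_apply, map_add]
  refine congrArg₂ (· + ·) ?_ ?_
  · simp only [sub_zero, Int.cast_zero, neg_zero, zero_div, shift_zero_apply]
    rw [mul_comm]
  · rw [integral_eq_iff]
    have := shift_sub_mem (1 / 2) (A.1 1 * (qpow 1 * T (field 1)))
    rw [shift_mul] at this
    norm_num at this ⊢
    rwa [show T (field 1) * (qpow 1 * A.1 1) = A.1 1 * (qpow 1 * T (field 1)) by ring]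

theorem IsToda.integral_hamDensity' {L : Op} (hL : IsToda L) {T : DiffAlg →+ DiffAlg} (h : IsEvo T)
    {n : ℕ} (hn : 0 < n) : integral (T (hamDensity L.1 n)) =
      integral (T (field 0) * (L ^ n).1 0 + T (field 1) * (qpow 1 * (L ^ n).1 1)) := by
  rw [hL.integral_hamDensity h hn, tr_mul_coeffwise_kOp h]

theorem IsToda.delta_ham {L : Op} (hL : IsToda L) {n : ℕ} (hn : 0 < n) (i : Fin 2) :
    delta i (hamDensity L.1 n) = (![(L ^ n).1 0, qpow 1 * (L ^ n).1 1] : Fin 2 → DiffAlg) i := by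
  refine delta_eq (fun T hT => ?_) i
  rw [hL.integral_hamDensity' hT hn, Fin.sum_univ_two]
  rfl

theorem barHom_integral_congr {f g : DiffAlg} (h : integral f = integral g) :
    integral (barHom f) = integral (barHom g) := by
  rw [integral_eq_iff, ← map_sub]
  exact barHom_mem_exact (integral_eq_iff.1 h)

/-- The variation along T is the conjugate of the variation of H_n along the conjugate of T. The
term −τPu in v̄ contributes −τ P p̄_0 to δ_u, as P is self-adjoint. -/
theorem IsToda.delta_hamBar {L : Op} (hL : IsToda L) {n : ℕ} (hn : 0 < n) (i : Fin 2) :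
    delta i (barHom (hamDensity L.1 n)) = (![barHom ((L ^ n).1 0),
      qpow 1 * barHom ((L ^ n).1 1) - tau * opP (barHom ((L ^ n).1 0))] : Fin 2 → DiffAlg) i := by
  refine delta_eq (fun T hT => ?_) i
  have h1 := barHom_integral_congr (hL.integral_hamDensity' hT.barConj hn)
  rw [barHom_barConj, map_add, map_mul, map_mul, map_mul, barHom_qpow, barHom_barConj,
    barHom_barConj, barHom_field_zero, barHom_field_one, map_sub, hT.const_mul hT.tau, hT.opP] at h1
  rw [h1, integral_eq_iff, Fin.sum_univ_two]
  have h2 := const_mul_mem_exact dx_tau (opP_adjoint (T (field 1)) (barHom ((L ^ n).1 0)))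
  convert h2 using 1
  simp only [Matrix.cons_val_zero, Matrix.cons_val_one]
  ring

/-- ∇ annihilates z_n and ∇P = ∂. This puts the equation for v in Hamiltonian form. -/
theorem IsToda.nabla_motion {L : Op} (hL : IsToda L) {n : ℕ} (hn : 0 < n) :
    nabla ((L ^ n).1 (-1)) = tau * dx ((L ^ n).1 0) + nabla (qpow 1 * (L ^ n).1 1) := by
  have h := congrArg nabla (hL.motion n hn)
  rw [EqToda.motion, nabla_const (dx_zc n), map_sub, map_sub, nabla_const_mul dx_tau, nabla_opP] at h
  linear_combination h

theorem equivariantPoisson_zero (g : Fin 2 → DiffAlg) :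
    ∑ j, equivariantPoisson 0 j (g j) = tau * dx (g 0) + nabla (g 1) := Fin.sum_univ_two _

theorem equivariantPoisson_one (g : Fin 2 → DiffAlg) :
    ∑ j, equivariantPoisson 1 j (g j) = nabla (g 0) :=
  (Fin.sum_univ_two _).trans (add_zero _)

theorem IsToda.varDer_ham_zero {L : Op} (hL : IsToda L) {n : ℕ} (hn : 0 < n) :
    varDer 0 (ham L.1 n) = (L ^ n).1 0 := hL.delta_ham hn 0

theorem IsToda.varDer_ham_one {L : Op} (hL : IsToda L) {n : ℕ} (hn : 0 < n) :
    varDer 1 (ham L.1 n) = qpow 1 * (L ^ n).1 1 := hL.delta_ham hn 1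

theorem IsToda.varDer_hamBar_zero {L : Op} (hL : IsToda L) {n : ℕ} (hn : 0 < n) :
    varDer 0 (hamBar L.1 n) = barHom ((L ^ n).1 0) := hL.delta_hamBar hn 0

theorem IsToda.varDer_hamBar_one {L : Op} (hL : IsToda L) {n : ℕ} (hn : 0 < n) :
    varDer 1 (hamBar L.1 n) =
      qpow 1 * barHom ((L ^ n).1 1) - tau * opP (barHom ((L ^ n).1 0)) := hL.delta_hamBar hn 1

theorem IsToda.flow_field {L : Op} (hL : IsToda L) {n : ℕ} (hn : 0 < n) (i : Fin 2) :
    flow L n (field i) = ∑ j, equivariantPoisson i j (varDer j (ham L.1 n)) := by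
  match i with
  | 0 =>
    rw [equivariantPoisson_zero fun j => varDer j (ham L.1 n), hL.varDer_ham_zero hn,
      hL.varDer_ham_one hn, flow_field_zero, hL.nabla_motion hn]
  | 1 =>
    rw [equivariantPoisson_one fun j => varDer j (ham L.1 n), hL.varDer_ham_zero hn,
      flow_field_one]

theorem IsToda.flow_barConj_field {L : Op} (hL : IsToda L) {n : ℕ} (hn : 0 < n) (i : Fin 2) :
    barConj (flow L n) (field i) = ∑ j, equivariantPoisson i j (varDer j (hamBar L.1 n)) := by
  have hE := isEvo_flow L n
  match i with
  | 0 =>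
    rw [equivariantPoisson_zero fun j => varDer j (hamBar L.1 n), hL.varDer_hamBar_zero hn,
      hL.varDer_hamBar_one hn, barConj_apply, barHom_field_zero, map_sub, hE.const_mul hE.tau,
      hE.opP, flow_field_zero, flow_field_one, opP_nabla, hL.nabla_motion hn,
      add_sub_cancel_left, barHom_nabla, map_mul, barHom_qpow, map_sub, nabla_const_mul dx_tau,
      nabla_opP]
    ring
  | 1 =>
    rw [equivariantPoisson_one fun j => varDer j (hamBar L.1 n), hL.varDer_hamBar_zero hn,
      barConj_apply, barHom_field_one, flow_field_one, barHom_nabla]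

theorem IsEvo.isHamiltonianFlow {T : DiffAlg →+ DiffAlg} (h : IsEvo T) {P : MatOp} {H : Functional}
    (hT : ∀ i, T (field i) = ∑ j, P i j (varDer j H)) : IsHamiltonianFlow P H h.toDer where
  fields i := by rw [h.toDer_apply, hT]
  z k _ := by rw [h.toDer_apply]; exact h.z _
  zbar k _ := by rw [h.toDer_apply]; exact h.zbar _
  functionals f := by rw [h.toDer_apply, h.integral_eq_bracket hT]

theorem IsToda.isHamiltonianFlow {L : Op} (hL : IsToda L) {n : ℕ} (hn : 0 < n)
    {D : Derivation ℚ DiffAlg DiffAlg} (hD : IsFlow L.1 n D) :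
    IsHamiltonianFlow equivariantPoisson (ham L.1 n) D := by
  rw [isLaxFlow_unique hL hD (isFlow_flow hL hn)]
  exact (isEvo_flow L n).isHamiltonianFlow (hL.flow_field hn)

theorem IsToda.isHamiltonianFlow_bar {L : Op} (hL : IsToda L) {n : ℕ} (hn : 0 < n)
    {D : Derivation ℚ DiffAlg DiffAlg} (hD : IsFlowBar L.1 n D) :
    IsHamiltonianFlow equivariantPoisson (hamBar L.1 n) D := by
  rw [isLaxFlow_unique hL hD (isFlowBar_flow hL hn)]
  exact (isEvo_flow L n).barConj.isHamiltonianFlow (hL.flow_barConj_field hn)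

/-! ### Specialization to the Toda chain -/

/-- The specialization at `τ = 0`, `z_k = z̄_k = 0`. -/
def spHom : DiffAlg →+* DiffAlg := substHom spGen

theorem spHom_X_mul (f : DiffAlg) : spHom (PowerSeries.X * f) = PowerSeries.X * spHom f :=
  substHom_X_mul _ f

theorem spHom_gen (g : Gen) : spHom (gen g) = spGen g := substHom_gen _ g

theorem spHom_qpow (n : ℤ) : spHom (qpow n) = qpow n := substHom_qpow _ n

theorem spHom_tau : spHom tau = 0 := spHom_gen _

theorem spHom_z (k : ℕ) : spHom (gen (Gen.z k)) = 0 := spHom_gen _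

theorem spHom_zbar (k : ℕ) : spHom (gen (Gen.zbar k)) = 0 := spHom_gen _

theorem spHom_dx (f : DiffAlg) : spHom (dx f) = dx (spHom f) := by
  refine ringHom_dx spHom_X_mul (fun g => ?_) spHom_qpow (spHom_gen _) f
  cases g with
  | tau =>
    change spHom (dx tau) = dx (spHom tau)
    rw [dx_tau, spHom_tau, map_zero, map_zero]
  | z k => rw [dx_gen_z, spHom_z, map_zero, map_zero]
  | zbar k => rw [dx_gen_zbar, spHom_zbar, map_zero, map_zero]
  | v n => rw [dx_gen_v, spHom_gen, spHom_gen, spGen, spGen, dx_gen_v]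
  | u n => rw [dx_gen_u, spHom_gen, spHom_gen, spGen, spGen, dx_gen_u]

theorem spHom_opSeries (φ : PowerSeries ℚ) (f : DiffAlg) :
    spHom (opSeries φ f) = opSeries φ (spHom f) :=
  opSeries_commute (T := spHom.toAddMonoidHom) spHom_X_mul spHom_dx φ f

theorem spHom_shift (s : ℚ) (f : DiffAlg) : spHom (shift s f) = shift s (spHom f) :=
  spHom_opSeries _ f

theorem spHom_nabla (f : DiffAlg) : spHom (nabla f) = nabla (spHom f) := by
  rw [nabla_eq, nabla_eq, spHom_opSeries, spHom_dx]

theorem spHom_barHom (f : DiffAlg) : spHom (barHom f) = spHom f := by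
  refine ringHom_eps_ext (T₁ := spHom.comp barHom) (T₂ := spHom) (fun f => ?_) spHom_X_mul
    (fun g => ?_) (fun n => ?_) f
  · simp only [RingHom.comp_apply, barHom_X_mul, spHom_X_mul]
  · rw [RingHom.comp_apply]
    cases g with
    | tau =>
      change spHom (barHom tau) = spHom tau
      rw [barHom_tau, map_neg, spHom_tau, neg_zero]
    | z k => rw [barHom_gen, barGen, spHom_z, spHom_zbar]
    | zbar k => rw [barHom_gen, barGen, spHom_z, spHom_zbar]
    | v n => rw [barHom_v, map_sub, map_mul, spHom_tau, zero_mul, sub_zero]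
    | u n => rw [barHom_u]
  · rw [RingHom.comp_apply, barHom_qpow]

theorem todaChainLax_eq : todaChainLax = kOp.1 := funext fun k => (kOp_apply k).symm

theorem coeffwise_spHom_mul (A B : Op) : coeffwise spHom.toAddMonoidHom (A * B) =
    coeffwise spHom.toAddMonoidHom A * coeffwise spHom.toAddMonoidHom B := by
  obtain ⟨a, ha⟩ := A.2
  obtain ⟨b, hb⟩ := B.2
  refine Op.ext' fun k => ?_
  rw [coeffwise_apply, Op.mul_val, Op.mul_val, opMul_eq_sum ha hb k _ subset_rfl,
    opMul_eq_sum (coeffwise_le (T := spHom.toAddMonoidHom) (A := A) ha)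
      (coeffwise_le (T := spHom.toAddMonoidHom) (A := B) hb) k _ subset_rfl, map_sum]
  refine Finset.sum_congr rfl fun i _ => ?_
  change spHom (_ * _) = _
  rw [map_mul, spHom_shift, spHom_shift]
  rfl

theorem coeffwise_spHom_one : coeffwise spHom.toAddMonoidHom 1 = 1 := by
  refine Op.ext' fun k => ?_
  rw [coeffwise_apply, Op.one_apply]
  split_ifs
  exacts [map_one spHom, map_zero spHom]

theorem coeffwise_spHom_pow (A : Op) (n : ℕ) : coeffwise spHom.toAddMonoidHom (A ^ n) =
    coeffwise spHom.toAddMonoidHom A ^ n := by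
  induction n with
  | zero => rw [pow_zero, pow_zero, coeffwise_spHom_one]
  | succ n ih => rw [pow_succ, pow_succ, coeffwise_spHom_mul, ih]

theorem conjWith_id_kOp : conjWith (RingHom.id DiffAlg) kOp.1 = kOp.1 := by
  funext k
  rw [conjWith, RingHom.id_apply, kOp_apply, kOp_apply]
  by_cases h1 : k = 1
  · subst h1
    simp [qCoeff_one, qpow_mul_neg]
  by_cases h0 : k = 0
  · subst h0
    simp [qCoeff_zero]
  by_cases h2 : k = -1
  · subst h2
    simp [qCoeff_neg_one]
  · rw [if_neg (by omega), if_neg (by omega), if_neg (by omega), if_neg h1, if_neg h0, if_neg h2,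
      zero_mul]

theorem conjWith_id_kOp_pow (n : ℕ) :
    conjWith (RingHom.id DiffAlg) (kOp ^ n).1 = (kOp ^ n).1 := by
  induction n with
  | zero =>
    funext k
    rw [conjWith, pow_zero, Op.one_apply, Op.one_apply, RingHom.id_apply]
    by_cases h0 : k = 0
    · subst h0
      simp [qCoeff_zero]
    · rw [if_neg (by omega), if_neg h0, zero_mul]
  | succ n ih =>
    have h := conjWith_mul (β := RingHom.id DiffAlg) (fun _ _ => rfl) Function.injective_id
      (kOp ^ n).1 kOp.1
    rw [ih, conjWith_id_kOp, ← Op.mul_val, ← Op.mul_val, ← pow_succ, ← pow_succ'] at h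
    exact h

/-- At τ = 0 the constants of motion measure the asymmetry under conjugation, and all powers of Λ +
v + qΛ⁻¹ are symmetric. -/
theorem motion_kOp (k : ℕ) : motion 0 kOp k = 0 := by
  have h := congrFun (conjWith_id_kOp_pow k) (-1)
  rw [conjWith, RingHom.id_apply, qCoeff_neg_one, neg_neg] at h
  rw [motion, ← h]
  ring

theorem spHom_motion (t : DiffAlg) (L : Op) (k : ℕ) :
    spHom (motion t L k) = motion (spHom t) (coeffwise spHom.toAddMonoidHom L) k := by
  rw [motion, motion, map_sub, map_sub, map_mul, map_mul, spHom_qpow, ← coeffwise_spHom_pow,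
    opP, spHom_opSeries]
  rfl

/-- Both operators are monic with the same v and have vanishing constants of motion at τ = 0, so
`eq_of_motion` identifies them. -/
theorem IsToda.coeffwise_spHom {L : Op} (hL : IsToda L) :
    coeffwise spHom.toAddMonoidHom L = kOp := by
  refine eq_of_motion ⟨coeffwise_le hL.monic.le, ?_⟩ kOp_monic 0 ?_ fun k hk => ?_
  · rw [coeffwise_apply, hL.monic.lead]
    exact map_one spHom
  · rw [coeffwise_apply, hL.zero, kOp_apply, if_neg (by omega), if_pos rfl]
    exact spHom_gen _
  · have h := spHom_motion tau L k
    rw [hL.motion k hk, spHom_tau] at h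
    rw [motion_kOp, ← h]
    exact spHom_z _

theorem IsToda.spHom_apply {L : Op} (hL : IsToda L) (k : ℤ) : spHom (L.1 k) = todaChainLax k := by
  rw [todaChainLax_eq, ← hL.coeffwise_spHom]
  rfl

theorem IsToda.spHom_opConj {L : Op} (hL : IsToda L) (k : ℤ) :
    spHom (opConj L.1 k) = todaChainLax k := by
  rw [opConj_eq, conjWith, map_mul, spHom_barHom, ringHom_qCoeff spHom_shift spHom_qpow,
    hL.spHom_apply, todaChainLax_eq]
  exact congrFun conjWith_id_kOp k

theorem spHom_equivariantPoisson (i j : Fin 2) (f : DiffAlg) :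
    spHom (equivariantPoisson i j f) = todaPoisson i j (spHom f) := by
  match i, j with
  | 0, 0 =>
    change spHom (tau * dx f) = 0
    rw [map_mul, spHom_tau, zero_mul]
  | 0, 1 => exact spHom_nabla f
  | 1, 0 => exact spHom_nabla f
  | 1, 1 => exact map_zero spHom

end
end EqToda

theorem mainTheorem2 :
    -- the operator defines a Hamiltonian structure
    EqToda.IsPoisson EqToda.equivariantPoisson ∧
    -- the Lax operator of the equivariant Toda lattice exists and is unique
    (∃! L : EqToda.DiffOp, EqToda.IsEquivariantToda L) ∧
    ∀ L : EqToda.DiffOp, EqToda.IsEquivariantToda L →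
      -- the flows exist, are unique, and are Hamiltonian
      (∀ n : ℕ, 0 < n →
        (∃! D, EqToda.IsFlow L n D) ∧ (∃! D, EqToda.IsFlowBar L n D) ∧
        (∀ D, EqToda.IsFlow L n D →
          EqToda.IsHamiltonianFlow EqToda.equivariantPoisson (EqToda.ham L n) D) ∧
        (∀ D, EqToda.IsFlowBar L n D →
          EqToda.IsHamiltonianFlow EqToda.equivariantPoisson (EqToda.hamBar L n) D)) ∧
      -- at `τ = 0`, `z_k = z̄_k = 0` this is the Toda chain with its first Hamiltonian structure
      (∀ k : ℤ, EqToda.specialize (L k) = EqToda.todaChainLax k) ∧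
      (∀ k : ℤ, EqToda.specialize (EqToda.opConj L k) = EqToda.todaChainLax k) ∧
      EqToda.IsPoisson EqToda.todaPoisson ∧
      ∀ (i j : Fin 2) (f : EqToda.DiffAlg),
        EqToda.specialize (EqToda.equivariantPoisson i j f) =
          EqToda.todaPoisson i j (EqToda.specialize f) := by
  refine ⟨EqToda.isConstSkew_equivariantPoisson.isPoisson, EqToda.existsUnique_toda,
    fun A hA => ?_⟩
  obtain ⟨L, rfl, hL⟩ := hA.exists_op
  refine ⟨fun n hn => ⟨⟨_, EqToda.isFlow_flow hL hn, fun D hD =>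
      EqToda.isLaxFlow_unique hL hD (EqToda.isFlow_flow hL hn)⟩,
    ⟨_, EqToda.isFlowBar_flow hL hn, fun D hD =>
      EqToda.isLaxFlow_unique hL hD (EqToda.isFlowBar_flow hL hn)⟩,
    fun D hD => hL.isHamiltonianFlow hn hD, fun D hD => hL.isHamiltonianFlow_bar hn hD⟩,
    hL.spHom_apply, hL.spHom_opConj, EqToda.isConstSkew_todaPoisson.isPoisson,
    EqToda.spHom_equivariantPoisson⟩
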